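/- Let $d\ge 2$ and let $\Omega\subset\mathbb R^d$ be a bounded Lipschitz domain whose boundary is a disjoint union $\partial\Omega=\gamma^0\cup\gamma^1$ of closed sets, $\gamma^0\neq\emptyset$. For $|t|<\varepsilon$ let $T_t:\Omega\to\Omega_t=T_t(\Omega)$ be bi-Lipschitz homeomorphisms onto open sets, extended to $\overline\Omega$ by continuity, with $T_0=I$, and let $\gamma^i_t=T_t(\gamma^i)$. Assume that $\{T_t\}$ is differentiable: $t\mapsto T_tx$ is $C^1$ on $(-\varepsilon,\varepsilon)$ for every $x\in\Omega$, and the Jacobi matrices $DT_t$ and their inverses $(DT_t)^{-1}$ have $t$-derivatives $\frac{\partial}{\partial t}DT_t$, $\frac{\partial}{\partial t}(DT_t)^{-1}$ which are bounded uniformly on $\Omega\times(-\varepsilon,\varepsilon)$ and continuous in $t$ (derivatives and continuity being understood in $L^2(\Omega)$). Put $S=\frac{\partial T_t}{\partial t}\big|_{t=0}$. Fix $y\in\Omega$ such that $y\in\Omega_t$ for all $|t|<\varepsilon$ (which holds after decreasing $\varepsilon$). Let $\Gamma$ be the fundamental solution of $-\Delta$, that is, $\Gamma(x)=-\frac1{2\pi}\log|x|$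 for $d=2$ and $\Gamma(x)=\frac{1}{(d-2)\omega_d}|x|^{2-d}$ for $d\ge3$, where $\omega_d$ is the area of the unit sphere. For $|t|<\varepsilon$ let $u(\cdot,t)\in H^1(\Omega_t)$ be the (weak) solution of $$\Delta u(\cdot,t)=0\ \text{ in }\Omega_t,\qquad u(\cdot,t)=-\Gamma(\cdot-y)\ \text{ on }\gamma^0_t,\qquad \frac{\partial u}{\partial\nu}(\cdot,t)=-\frac{\partial}{\partial\nu}\Gamma(\cdot-y)\ \text{ on }\gamma^1_t,$$ let $N(x,y,t)=\Gamma(x-y)+u(x,t)$ be the Green's function of $\Omega_t$, and let $u_0=u(\cdot,0)\in H^1(\Omega)$. Then the function $v(x,t)=u(T_tx,t)$ satisfies $$v\in C^1(-\varepsilon,\varepsilon;H^1(\Omega)).$$ Moreover, $S$ is Lipschitz continuous on $\overline\Omega$, and the first Hadamard variation $$\delta N(\cdot,y)=\frac{\partial N}{\partial t}(\cdot,y,t)\Big|_{t=0}=\frac{\partial u}{\partial t}(\cdot,t)\Big|_{t=0}$$ exists in the sense of distributions in $\Omega$, satisfies $\Delta\,\delta N(\cdot,y)=0$ in $\Omega$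 in the sense of distributions, belongs to $L^2(\Omega)$, and is given by $$\delta N(x,y)=\frac{\partial v}{\partial t}(x,t)\Big|_{t=0}-(S\cdot\nabla)u_0(x)\qquad\text{for a.e. }x\in\Omega.$$ -/

import Mathlib

open Set Filter Topology MeasureTheory
open scoped ENNReal NNReal ContDiff Gradient Laplacian

noncomputable section

/-- `d`-dimensional Euclidean space. -/
abbrev Euc (d : ℕ) : Type := EuclideanSpace ℝ (Fin d)

variable {d : ℕ}

/-! ### Bounded Lipschitz domains -/

/-- A bounded Lipschitz domain: a nonempty, bounded, connected open set which, near each of its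
boundary points, is the set of points lying above the graph of a Lipschitz function over the
hyperplane orthogonal to some unit vector `e`
(`x - ⟪e, x⟫ e` is the component of `x` in that hyperplane, `⟪e, x⟫` the height of `x` over it). -/
structure IsBoundedLipschitzDomain (Ω : Set (Euc d)) : Prop where
  isOpen : IsOpen Ω
  isConnected : IsConnected Ω
  isBounded : Bornology.IsBounded Ω
  locally_graph : ∀ p ∈ frontier Ω, ∃ (e : Euc d) (g : Euc d → ℝ) (K : ℝ≥0) (r : ℝ),
    ‖e‖ = 1 ∧ LipschitzWith K g ∧ 0 < r ∧
      ∀ x ∈ Metric.ball p r, x ∈ Ω ↔ g (x - inner ℝ e x • e) < inner ℝ e x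

/-! ### Test functions, weak gradients, the space `H¹` -/

/-- `φ ∈ C_c^∞(Ω)`. -/
structure IsTestFunction (Ω : Set (Euc d)) (φ : Euc d → ℝ) : Prop where
  contDiff : ContDiff ℝ ∞ φ
  hasCompactSupport : HasCompactSupport φ
  tsupport_subset : tsupport φ ⊆ Ω

/-- `g = ∇ f` in the sense of distributions in `Ω`: `∫_Ω f ∇φ = - ∫_Ω φ g` for all test
functions `φ`. Used for `f` and `g` square integrable on `Ω`. -/
def HasWeakGradient (Ω : Set (Euc d)) (f : Euc d → ℝ) (g : Euc d → Euc d) : Prop :=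
  ∀ φ : Euc d → ℝ, IsTestFunction Ω φ →
    ∫ x in Ω, f x • ∇ φ x = - ∫ x in Ω, φ x • g x

/-- `Δ f = 0` in the sense of distributions in `Ω`. Used for `f` square integrable on `Ω`. -/
def IsWeaklyHarmonic (Ω : Set (Euc d)) (f : Euc d → ℝ) : Prop :=
  ∀ φ : Euc d → ℝ, IsTestFunction Ω φ → ∫ x in Ω, f x * Δ φ x = 0

theorem IsTestFunction.continuous_gradient {Ω : Set (Euc d)} {φ : Euc d → ℝ}
    (h : IsTestFunction Ω φ) : Continuous (∇ φ) :=
  (InnerProductSpace.toDual ℝ (Euc d)).symm.continuous.comp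
    (h.contDiff.continuous_fderiv (by simp))

theorem IsTestFunction.hasCompactSupport_gradient {Ω : Set (Euc d)} {φ : Euc d → ℝ}
    (h : IsTestFunction Ω φ) : HasCompactSupport (∇ φ) :=
  (h.hasCompactSupport.fderiv (𝕜 := ℝ)).comp_left
    (g := (InnerProductSpace.toDual ℝ (Euc d)).symm) (map_zero _)

theorem integrable_smul_gradient {Ω : Set (Euc d)} {φ f : Euc d → ℝ} (h : IsTestFunction Ω φ)
    (hf : MemLp f 2 (volume.restrict Ω)) :
    Integrable (fun x => f x • ∇ φ x) (volume.restrict Ω) :=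
  memLp_one_iff_integrable.1
    ((h.continuous_gradient.memLp_of_hasCompactSupport (p := 2) h.hasCompactSupport_gradient).smul
      hf)

theorem integrable_test_smul {Ω : Set (Euc d)} {φ : Euc d → ℝ} {g : Euc d → Euc d}
    (h : IsTestFunction Ω φ) (hg : MemLp g 2 (volume.restrict Ω)) :
    Integrable (fun x => φ x • g x) (volume.restrict Ω) :=
  memLp_one_iff_integrable.1
    (hg.smul (h.contDiff.continuous.memLp_of_hasCompactSupport (p := 2) h.hasCompactSupport))

/-- The Sobolev space `H¹(Ω)`: the pairs `(f, g) ∈ L²(Ω) × L²(Ω; ℝ^d)` such that `g = ∇ f` weakly,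
with the norm `(‖f‖² + ‖∇ f‖²)^{1/2}`. -/
def H1 (Ω : Set (Euc d)) : Submodule ℝ
    (WithLp 2 (Lp ℝ 2 (volume.restrict Ω) × Lp (Euc d) 2 (volume.restrict Ω))) where
  carrier := {p | HasWeakGradient Ω p.fst p.snd}
  zero_mem' := by
    intro φ hφ
    have h1 : ∫ x in Ω, (0 : Lp ℝ 2 (volume.restrict Ω)) x • ∇ φ x = 0 := by
      refine integral_eq_zero_of_ae ?_
      filter_upwards [Lp.coeFn_zero ℝ 2 (volume.restrict Ω)] with x hx
      rw [hx, Pi.zero_apply, zero_smul, Pi.zero_apply]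
    have h2 : ∫ x in Ω, φ x • (0 : Lp (Euc d) 2 (volume.restrict Ω)) x = 0 := by
      refine integral_eq_zero_of_ae ?_
      filter_upwards [Lp.coeFn_zero (Euc d) 2 (volume.restrict Ω)] with x hx
      rw [hx, Pi.zero_apply, smul_zero]
    simp only [WithLp.zero_fst, WithLp.zero_snd]
    rw [h1, h2, neg_zero]
  add_mem' := by
    intro p q hp hq φ hφ
    have h1 : ∫ x in Ω, (p.fst + q.fst) x • ∇ φ x
        = ∫ x in Ω, (p.fst x • ∇ φ x + q.fst x • ∇ φ x) := by
      refine integral_congr_ae ?_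
      filter_upwards [Lp.coeFn_add p.fst q.fst] with x hx
      rw [hx, Pi.add_apply, add_smul]
    have h2 : ∫ x in Ω, φ x • (p.snd + q.snd) x
        = ∫ x in Ω, (φ x • p.snd x + φ x • q.snd x) := by
      refine integral_congr_ae ?_
      filter_upwards [Lp.coeFn_add p.snd q.snd] with x hx
      rw [hx, Pi.add_apply, smul_add]
    simp only [WithLp.add_fst, WithLp.add_snd]
    rw [h1, h2, integral_add (integrable_smul_gradient hφ (Lp.memLp _))
      (integrable_smul_gradient hφ (Lp.memLp _)), integral_add (integrable_test_smul hφ (Lp.memLp _))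
      (integrable_test_smul hφ (Lp.memLp _)), hp φ hφ, hq φ hφ]
    abel
  smul_mem' := by
    intro c p hp φ hφ
    have h1 : ∫ x in Ω, (c • p.fst) x • ∇ φ x = ∫ x in Ω, c • (p.fst x • ∇ φ x) := by
      refine integral_congr_ae ?_
      filter_upwards [Lp.coeFn_smul c p.fst] with x hx
      rw [hx, Pi.smul_apply, smul_assoc]
    have h2 : ∫ x in Ω, φ x • (c • p.snd) x = ∫ x in Ω, c • (φ x • p.snd x) := by
      refine integral_congr_ae ?_
      filter_upwards [Lp.coeFn_smul c p.snd] with x hx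
      rw [hx, Pi.smul_apply, smul_comm]
    simp only [WithLp.smul_fst, WithLp.smul_snd]
    rw [h1, h2, integral_smul, integral_smul, hp φ hφ, smul_neg]

/-- The function underlying an element of `H¹(Ω)` (defined almost everywhere in `Ω`). -/
def H1.fn {Ω : Set (Euc d)} (w : H1 Ω) : Euc d → ℝ := w.1.fst

/-- The weak gradient of an element of `H¹(Ω)` (defined almost everywhere in `Ω`). -/
def H1.grad {Ω : Set (Euc d)} (w : H1 Ω) : Euc d → Euc d := w.1.snd

/-- The elements `w` of `H¹(Ω)` with `w = g` on the compact subset `γ` of the boundary, in the sense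
of traces, for `g` smooth near `γ`: the closure in `H¹(Ω)` of the restrictions to `Ω` of the
`φ ∈ C_c^∞(ℝ^d)` with `φ = g` in a neighbourhood of `γ`. -/
def H1.withTrace (Ω γ : Set (Euc d)) (g : Euc d → ℝ) : Set (H1 Ω) :=
  closure {w : H1 Ω | ∃ φ : Euc d → ℝ, ContDiff ℝ ∞ φ ∧ HasCompactSupport φ ∧
    (∀ᶠ x in 𝓝ˢ γ, φ x = g x) ∧ H1.fn w =ᵐ[volume.restrict Ω] φ}

/-- The space `V` of all `w ∈ H¹(Ω)` with `w = 0` on `γ`. -/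
def H1.vanishingOn (Ω γ : Set (Euc d)) : Set (H1 Ω) := H1.withTrace Ω γ 0

/-! ### The Green's function of the mixed problem -/

/-- The fundamental solution of `-Δ`, i.e. `-(2π)⁻¹ log |x|` for `d = 2` and
`|x|^{2-d} / ((d-2) ω)` for `d ≥ 3`, where `ω` is the area of the unit sphere, that is, `d` times
the volume of the unit ball. -/
def fundamentalSolution (d : ℕ) (x : Euc d) : ℝ :=
  if d = 2 then -(2 * Real.pi)⁻¹ * Real.log ‖x‖
  else ‖x‖ ^ (2 - (d : ℤ)) /
    (((d : ℝ) - 2) * ((d : ℝ) * volume.real (Metric.ball (0 : Euc d) 1)))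

/-- The pairing `⟨φ, ∂w/∂ν⟩` over the part `γ¹ = ∂Ω \ γ⁰` of the boundary between the trace
of `φ ∈ V` and the normal derivative of a function `w` with gradient `G`, as given by Green's
formula `⟨φ, ∂w/∂ν⟩ = ∫_Ω ∇w · ∇φ + ∫_Ω φ Δw`, in the case that `Δ w = 0` on the support of `φ`. -/
def normalDerivativePairing (Ω : Set (Euc d)) (G : Euc d → Euc d) (φ : H1 Ω) : ℝ :=
  ∫ x in Ω, inner ℝ (G x) (H1.grad φ x)

/-- `u ∈ H¹(Ω)` is the solution to
`Δ u = 0` in `Ω`, `u = -Γ(· - y)` on `γ⁰`, `∂u/∂ν = -∂Γ(· - y)/∂ν` on `γ¹ = ∂Ω \ γ⁰`.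
The last condition is an identity of functionals on the traces on `γ¹` of the `φ ∈ V`; as it only
involves these traces, it suffices to take `φ` vanishing near `y`, the singularity of
`Γ(· - y)`. -/
structure SolvesMixedProblem (Ω γ₀ : Set (Euc d)) (y : Euc d) (u : H1 Ω) : Prop where
  harmonic : IsWeaklyHarmonic Ω (H1.fn u)
  dirichlet : u ∈ H1.withTrace Ω γ₀ (fun x => -fundamentalSolution d (x - y))
  neumann : ∀ φ ∈ H1.vanishingOn Ω γ₀,
    (∃ r > 0, ∀ᵐ x ∂(volume.restrict Ω), x ∈ Metric.ball y r → H1.fn φ x = 0) →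
      normalDerivativePairing Ω (H1.grad u) φ
        = -normalDerivativePairing Ω (∇ (fun x => fundamentalSolution d (x - y))) φ

/-- The Green's function `N(x, y) = Γ(x - y) + u(x)`. -/
def greenFunction {Ω : Set (Euc d)} (y : Euc d) (u : H1 Ω) (x : Euc d) : ℝ :=
  fundamentalSolution d (x - y) + H1.fn u x

/-! ### Domain perturbations -/

/-- A family `T_t : Ω → Ω_t = T_t(Ω)`, `|t| < ε`, of bi-Lipschitz homeomorphisms onto open sets, with
`T_0` the identity. (A bi-Lipschitz map on `Ω` has a unique bi-Lipschitz extension to the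
closure of `Ω`; `T t` denotes this extension, and its values elsewhere are irrelevant.) -/
structure IsDeformation (Ω : Set (Euc d)) (ε : ℝ) (T : ℝ → Euc d → Euc d) : Prop where
  zero : ∀ x ∈ closure Ω, T 0 x = x
  lipschitz : ∀ t ∈ Ioo (-ε) ε, ∃ K : ℝ≥0, LipschitzOnWith K (T t) (closure Ω)
  antilipschitz : ∀ t ∈ Ioo (-ε) ε, ∃ c : ℝ, 0 < c ∧
    ∀ x ∈ closure Ω, ∀ x' ∈ closure Ω, c * dist x x' ≤ dist (T t x) (T t x')
  isOpen_image : ∀ t ∈ Ioo (-ε) ε, IsOpen (T t '' Ω)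

/-- The family of fields `F t`, `|t| < ε`, on `Ω` has a `t`-derivative `∂F/∂t` which is
bounded uniformly in `(x, t)` and depends continuously on `t`; derivative and continuity are taken
in `L²(Ω)`. -/
def HasBoundedContinuousTimeDeriv {G : Type*} [NormedAddCommGroup G] [NormedSpace ℝ G]
    (Ω : Set (Euc d)) (ε : ℝ) (F : ℝ → Euc d → G) : Prop :=
  ∃ (F' : ℝ → Euc d → G) (M : ℝ), ∀ t ∈ Ioo (-ε) ε,
    AEStronglyMeasurable (F' t) (volume.restrict Ω) ∧
    (∀ᵐ x ∂(volume.restrict Ω), ‖F' t x‖ ≤ M) ∧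
    Tendsto (fun h : ℝ => eLpNorm (fun x => h⁻¹ • (F (t + h) x - F t x) - F' t x) 2
      (volume.restrict Ω)) (𝓝[≠] 0) (𝓝 0) ∧
    Tendsto (fun s : ℝ => eLpNorm (fun x => F' s x - F' t x) 2 (volume.restrict Ω)) (𝓝 t) (𝓝 0)

/-- The family `{T_t}` is differentiable: `T_t x` is continuously differentiable in `t` for every
`x ∈ Ω`, and the Jacobi matrices `DT_t` and their inverses `(DT_t)⁻¹` (which exist almost everywhere
in `Ω`) have uniformly bounded `t`-derivatives that depend continuously on `t`. -/
structure IsDifferentiableDeformation (Ω : Set (Euc d)) (ε : ℝ) (T : ℝ → Euc d → Euc d) : Prop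
    extends IsDeformation Ω ε T where
  contDiffOn : ∀ x ∈ Ω, ContDiffOn ℝ 1 (fun t => T t x) (Ioo (-ε) ε)
  deriv_jacobian : HasBoundedContinuousTimeDeriv Ω ε (fun t x => fderiv ℝ (T t) x)
  deriv_jacobian_inv : HasBoundedContinuousTimeDeriv Ω ε (fun t x => (fderiv ℝ (T t) x).inverse)

/-- The vector field `S = ∂T_t/∂t` at `t = 0`. -/
def deformationField (T : ℝ → Euc d → Euc d) (x : Euc d) : Euc d := deriv (fun t => T t x) 0

/-- The family `F t` of functions, `|t|` small, is differentiable at `t = 0` in the sense of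
distributions in `Ω`, with derivative `F'`. (Only the values `F t x` with `x` in a compact
subset of `Ω` and `|t|` small matter.) -/
def HasDistribDerivAtZero (Ω : Set (Euc d)) (F : ℝ → Euc d → ℝ) (F' : Euc d → ℝ) : Prop :=
  ∀ φ : Euc d → ℝ, IsTestFunction Ω φ →
    HasDerivAt (fun t => ∫ x in Ω, F t x * φ x) (∫ x in Ω, F' x * φ x) 0

end

/-!
The regularity of `v` is proved by reducing the mixed problem on the moving domain `T_t(Ω)` to a
coercive equation on a fixed Hilbert space.

*Removal of the singularity.* Let `χ` be a cutoff function that is `1` near `y` and supported in all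
the domains under consideration. Then `w = u + (1 - χ) Γ(· - y)` vanishes on `T_t(γ⁰)`
(`SolvesMixedProblem.add_mem_V`) and satisfies `∫ ∇w · ∇φ = ∫ X · ∇φ + ∫ F φ` for all `φ` in the
space of functions vanishing there, where `X = -Γ(· - y) ∇χ` and `F = ∇Γ(· - y) · ∇χ` are smooth and
do not depend on `t` (`SolvesMixedProblem.variational`).

*Change of variables.* Composition with `T_t` turns this into a problem on the space `V` of
functions on `Ω` vanishing on `γ⁰`, with coefficients `|det A| A⁻¹ A⁻ᵀ` and data `|det A| A⁻¹ X`,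
`|det A| F` evaluated at the pair `(T_t, A) = (T_t, DT_t)` (`IsBiLip.exists_variational_comp`). It
is coercive on `V` by the Poincaré inequality (`IsBoundedLipschitzDomain.exists_poincare`), which is
proved by translating a neighbourhood of a point of `γ⁰` out of the domain.

*Dependence on time.* The pair `(T_t, DT_t)` is of class `C¹` with values in `L²` and Lipschitz in
`t` with respect to the sup norm (`IsBddC1`, `IsDifferentiableDeformation.exists_isBddC1_pair`). For
`DT_t`, this follows from the assumptions on the Jacobi matrices. For `T_t`, it holds because a
bound of `DT_s - DT_t` bounds the Lipschitz constant of `T_s - T_t` along segments, and Lipschitz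
domains are locally quasiconvex. The class is preserved by smooth maps (`IsBddC1.comp`), so the
coefficients and data belong to it. Multiplication by such coefficients is only strongly
differentiable in `t`, but this suffices for the solution to be of class `C¹`
(`contDiffOn_of_coercive_equation`).

*First variation.* For a test function `φ` and small `t`, the integral of `u(·, t) φ` over `Ω`
equals `∫_Ω v(·, t) φ(T_t) |det DT_t|`. The transported test function `φ(T_t) |det DT_t|` is
differentiable in `L²(Ω)`, and its derivative at `t = 0` is `div (φ S)`, as one sees by replacing
`u` by a fixed smooth function, for which the integral is constant
(`IsDifferentiableDeformation.exists_hasDerivAt_transported_test`). The product rule and an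
integration by parts give the formula for the variation
(`IsDifferentiableDeformation.hasDistribDerivAtZero_of_hasDerivAt`).
-/

noncomputable section

variable {d : ℕ}

/-! ### Solutions of coercive equations depending on a parameter -/

theorem contDiffOn_one_of_hasDerivAt {V : Type*} [NormedAddCommGroup V] [NormedSpace ℝ V]
    {I : Set ℝ} (hI : IsOpen I) {f f' : ℝ → V} (h : ∀ t ∈ I, HasDerivAt f (f' t) t)
    (hc : ContinuousOn f' I) : ContDiffOn ℝ 1 f I := by
  refine (contDiffOn_one_iff_derivWithin hI.uniqueDiffOn).2
    ⟨fun t ht => (h t ht).differentiableAt.differentiableWithinAt, hc.congr fun t ht => ?_⟩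
  rw [derivWithin_of_isOpen hI ht, (h t ht).deriv]

/-- The solution `w t` of a uniformly coercive equation `L t (w t) = f t` is of class `C¹` if `f` is
and if `t ↦ L t g` is for every fixed `g`, with `L' t` bounded; differentiability of `L` in the
operator norm is not needed. The derivative `z` of `w` solves `L t (z t) = f' t - L' t (w t)`. -/
theorem contDiffOn_of_coercive_equation {V : Type*} [NormedAddCommGroup V]
    [InnerProductSpace ℝ V] [CompleteSpace V] {I : Set ℝ} (hI : IsOpen I)
    {L L' : ℝ → V →L[ℝ] V} {f f' w : ℝ → V} {c C : ℝ} (hc : 0 < c)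
    (hcoer : ∀ t ∈ I, ∀ g, c * ‖g‖ ^ 2 ≤ inner ℝ (L t g) g)
    (hL : ∀ t ∈ I, ∀ g, HasDerivAt (fun s => L s g) (L' t g) t)
    (hL' : ∀ g, ContinuousOn (fun t => L' t g) I) (hC : ∀ t ∈ I, ‖L' t‖ ≤ C)
    (hf : ∀ t ∈ I, HasDerivAt f (f' t) t) (hf' : ContinuousOn f' I)
    (hw : ∀ t ∈ I, L t (w t) = f t) : ContDiffOn ℝ 1 w I := by
  have hbelow : ∀ t ∈ I, ∀ g, ‖g‖ ≤ c⁻¹ * ‖L t g‖ := by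
    intro t ht g
    rcases eq_or_ne g 0 with rfl | hg
    · simp
    have hg' : 0 < ‖g‖ := norm_pos_iff.2 hg
    have h1 := (hcoer t ht g).trans (real_inner_le_norm _ _)
    rw [le_inv_mul_iff₀ hc]
    nlinarith
  have hbij : ∀ t ∈ I, ∀ b, ∃ g, L t g = b := by
    intro t ht b
    have hco : IsCoercive ((innerSL ℝ).comp (L t) : V →L[ℝ] V →L[ℝ] ℝ) :=
      ⟨c, hc, fun g => by
        have := hcoer t ht g
        simpa [pow_two, mul_assoc] using this⟩
    obtain ⟨g, hg⟩ := hco.continuousLinearEquivOfBilin.surjective b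
    refine ⟨g, ?_⟩
    rw [← hg]
    refine ext_inner_right ℝ fun v => ?_
    rw [hco.continuousLinearEquivOfBilin_apply]
    rfl
  -- by coercivity, a family tends to `0` as soon as its images under the operators do
  have hsmall : ∀ t ∈ I, ∀ q : ℝ → V, ∀ l : Filter ℝ, (∀ᶠ s in l, s ∈ I) →
      Tendsto (fun s => L s (q s)) l (𝓝 0) → Tendsto q l (𝓝 0) := by
    intro t _ q l hl hq
    refine squeeze_zero_norm' (hl.mono fun s hs => hbelow s hs (q s)) ?_
    simpa using hq.norm.const_mul c⁻¹
  have hwcont : ∀ t ∈ I, Tendsto w (𝓝 t) (𝓝 (w t)) := by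
    intro t ht
    rw [← tendsto_sub_nhds_zero_iff]
    refine hsmall t ht _ _ (hI.mem_nhds ht) ?_
    have h1 : Tendsto (fun s => f s - L s (w t)) (𝓝 t) (𝓝 (f t - L t (w t))) :=
      (hf t ht).continuousAt.tendsto.sub (hL t ht (w t)).continuousAt.tendsto
    rw [hw t ht, sub_self] at h1
    refine h1.congr' ?_
    filter_upwards [hI.mem_nhds ht] with s hs
    rw [map_sub, hw s hs]
  -- the candidate for the derivative, found by differentiating the equation formally
  have hz : ∀ t, ∃ z, t ∈ I → L t z = f' t - L' t (w t) := by
    intro t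
    by_cases ht : t ∈ I
    · obtain ⟨z, hz⟩ := hbij t ht (f' t - L' t (w t))
      exact ⟨z, fun _ => hz⟩
    · exact ⟨0, fun h => absurd h ht⟩
  choose z hz using hz
  refine contDiffOn_one_of_hasDerivAt hI (f' := z) (fun t ht => ?_) fun t ht => ?_
  · rw [hasDerivAt_iff_tendsto_slope, ← tendsto_sub_nhds_zero_iff]
    refine hsmall t ht _ _ (mem_nhdsWithin_of_mem_nhds (hI.mem_nhds ht)) ?_
    -- `L s` maps the difference quotient of `w`, minus `z t`, to the following family
    have h1 : Tendsto (fun s => slope f t s - slope (fun s => L s (w t)) t s - L s (z t)) (𝓝[≠] t)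
        (𝓝 (f' t - L' t (w t) - L t (z t))) :=
      ((hasDerivAt_iff_tendsto_slope.1 (hf t ht)).sub
        (hasDerivAt_iff_tendsto_slope.1 (hL t ht (w t)))).sub
        ((hL t ht (z t)).continuousAt.tendsto.mono_left nhdsWithin_le_nhds)
    rw [hz t ht, sub_self] at h1
    refine h1.congr' ?_
    filter_upwards [mem_nhdsWithin_of_mem_nhds (hI.mem_nhds ht)] with s hs
    simp only [slope_def_module, map_sub, map_smul, hw s hs, hw t ht, ← smul_sub]
    congr 2
    abel
  · refine ContinuousAt.continuousWithinAt ?_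
    unfold ContinuousAt
    rw [← tendsto_sub_nhds_zero_iff]
    refine hsmall t ht _ _ (hI.mem_nhds ht) ?_
    have h0 : Tendsto (fun s => L' s (w s - w t)) (𝓝 t) (𝓝 0) := by
      refine squeeze_zero_norm' (a := fun s => C * ‖w s - w t‖) ?_ ?_
      · filter_upwards [hI.mem_nhds ht] with s hs
        exact (L' s).le_of_opNorm_le (hC s hs) _
      · have := ((hwcont t ht).sub_const (w t)).norm.const_mul C
        simpa using this
    have h1 : Tendsto (fun s => f' s - (L' s (w s - w t) + L' s (w t)) - L s (z t)) (𝓝 t)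
        (𝓝 (f' t - (0 + L' t (w t)) - L t (z t))) :=
      ((hf'.continuousAt (hI.mem_nhds ht)).tendsto.sub
        (h0.add ((hL' (w t)).continuousAt (hI.mem_nhds ht)).tendsto)).sub
        (hL t ht (z t)).continuousAt.tendsto
    rw [hz t ht, zero_add, sub_self] at h1
    refine h1.congr' ?_
    filter_upwards [hI.mem_nhds ht] with s hs
    rw [map_sub (L s), hz s hs, map_sub, sub_add_cancel]

/-! ### Families of class `C¹` in `L²` -/

section BddC1

variable {α G G' : Type*} [MeasurableSpace α] {μ : Measure α} [NormedAddCommGroup G]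
  [NormedSpace ℝ G] [NormedAddCommGroup G'] [NormedSpace ℝ G']

/-- The family of functions `F t`, `t ∈ I`, is continuously differentiable as a map into `L²(μ)`,
with derivative `F'` bounded by `M`, and is `M`-Lipschitz in `t` with respect to the sup norm. -/
structure IsBddC1 (μ : Measure α) (I : Set ℝ) (M : ℝ) (F F' : ℝ → α → G) : Prop where
  meas : ∀ t ∈ I, AEStronglyMeasurable (F t) μ
  meas_deriv : ∀ t ∈ I, AEStronglyMeasurable (F' t) μ
  bound : ∀ t ∈ I, ∀ᵐ x ∂μ, ‖F' t x‖ ≤ M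
  lip : ∀ s ∈ I, ∀ t ∈ I, ∀ᵐ x ∂μ, ‖F s x - F t x‖ ≤ M * |s - t|
  deriv : ∀ t ∈ I, Tendsto
    (fun s => eLpNorm (fun x => (s - t)⁻¹ • (F s x - F t x) - F' t x) 2 μ) (𝓝[≠] t) (𝓝 0)
  cont : ∀ t ∈ I, Tendsto (fun s => eLpNorm (fun x => F' s x - F' t x) 2 μ) (𝓝 t) (𝓝 0)

theorem eventually_mem_punctured {I : Set ℝ} (hI : IsOpen I) {t : ℝ} (ht : t ∈ I) :
    ∀ᶠ s in 𝓝[≠] t, s ∈ I ∧ s ≠ t :=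
  Filter.Eventually.and (mem_nhdsWithin_of_mem_nhds (hI.mem_nhds ht)) self_mem_nhdsWithin

theorem IsBddC1.congr {I : Set ℝ} (hI : IsOpen I) {M : ℝ} {F F' H H' : ℝ → α → G}
    (h : IsBddC1 μ I M F F') (hF : ∀ t ∈ I, F t =ᵐ[μ] H t) (hF' : ∀ t ∈ I, F' t =ᵐ[μ] H' t) :
    IsBddC1 μ I M H H' where
  meas t ht := (h.meas t ht).congr (hF t ht)
  meas_deriv t ht := (h.meas_deriv t ht).congr (hF' t ht)
  bound t ht := by
    filter_upwards [h.bound t ht, hF' t ht] with x h1 h2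
    rwa [← h2]
  lip s hs t ht := by
    filter_upwards [h.lip s hs t ht, hF t ht, hF s hs] with x h1 h2 h3
    rwa [← h2, ← h3]
  deriv t ht := by
    refine (h.deriv t ht).congr' ?_
    filter_upwards [eventually_mem_punctured hI ht] with s hs
    refine eLpNorm_congr_ae ?_
    filter_upwards [hF t ht, hF s hs.1, hF' t ht] with x h1 h2 h3
    rw [h1, h2, h3]
  cont t ht := by
    refine (h.cont t ht).congr' ?_
    filter_upwards [hI.mem_nhds ht] with s hs
    refine eLpNorm_congr_ae ?_
    filter_upwards [hF' t ht, hF' s hs] with x h1 h2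
    rw [h1, h2]

theorem IsBddC1.mono {I J : Set ℝ} (hJ : J ⊆ I) {M M' : ℝ} (hM : M ≤ M') {F F' : ℝ → α → G}
    (h : IsBddC1 μ I M F F') : IsBddC1 μ J M' F F' where
  meas t ht := h.meas t (hJ ht)
  meas_deriv t ht := h.meas_deriv t (hJ ht)
  bound t ht := (h.bound t (hJ ht)).mono fun _ hx => hx.trans hM
  lip s hs t ht := (h.lip s (hJ hs) t (hJ ht)).mono fun _ hx =>
    hx.trans (mul_le_mul_of_nonneg_right hM (abs_nonneg _))
  deriv t ht := h.deriv t (hJ ht)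
  cont t ht := h.cont t (hJ ht)

/-- The pair of two families of class `C¹` is of class `C¹`. -/
theorem IsBddC1.prodMk {I : Set ℝ} (hI : IsOpen I) {M : ℝ} {F F' : ℝ → α → G}
    {H H' : ℝ → α → G'} (hF : IsBddC1 μ I M F F') (hH : IsBddC1 μ I M H H') :
    IsBddC1 μ I M (fun t x => (F t x, H t x)) (fun t x => (F' t x, H' t x)) where
  meas t ht := (hF.meas t ht).prodMk (hH.meas t ht)
  meas_deriv t ht := (hF.meas_deriv t ht).prodMk (hH.meas_deriv t ht)
  bound t ht := by
    filter_upwards [hF.bound t ht, hH.bound t ht] with x h1 h2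
    exact max_le h1 h2
  lip s hs t ht := by
    filter_upwards [hF.lip s hs t ht, hH.lip s hs t ht] with x h1 h2
    exact max_le h1 h2
  deriv t ht := by
    have h := (hF.deriv t ht).add (hH.deriv t ht)
    rw [add_zero] at h
    refine tendsto_of_tendsto_of_tendsto_of_le_of_le' tendsto_const_nhds h
      (Eventually.of_forall fun _ => zero_le) ?_
    filter_upwards [eventually_mem_punctured hI ht] with s hs
    refine (eLpNorm_mono_real (g := fun x => ‖(s - t)⁻¹ • (F s x - F t x) - F' t x‖
      + ‖(s - t)⁻¹ • (H s x - H t x) - H' t x‖) fun x => ?_).trans ?_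
    · exact max_le_add_of_nonneg (norm_nonneg ((s - t)⁻¹ • (F s x - F t x) - F' t x))
        (norm_nonneg ((s - t)⁻¹ • (H s x - H t x) - H' t x))
    · refine (eLpNorm_add_le ?_ ?_ (by norm_num)).trans (le_of_eq ?_)
      · exact ((((hF.meas s hs.1).sub (hF.meas t ht)).const_smul (s - t)⁻¹).sub
          (hF.meas_deriv t ht)).norm
      · exact ((((hH.meas s hs.1).sub (hH.meas t ht)).const_smul (s - t)⁻¹).sub
          (hH.meas_deriv t ht)).norm
      · rw [eLpNorm_norm, eLpNorm_norm]
  cont t ht := by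
    have h := (hF.cont t ht).add (hH.cont t ht)
    rw [add_zero] at h
    refine tendsto_of_tendsto_of_tendsto_of_le_of_le' tendsto_const_nhds h
      (Eventually.of_forall fun _ => zero_le) ?_
    filter_upwards [hI.mem_nhds ht] with s hs
    refine (eLpNorm_mono_real (g := fun x => ‖F' s x - F' t x‖ + ‖H' s x - H' t x‖)
      fun x => ?_).trans ?_
    · exact max_le_add_of_nonneg (norm_nonneg (F' s x - F' t x)) (norm_nonneg (H' s x - H' t x))
    · refine (eLpNorm_add_le ?_ ?_ (by norm_num)).trans (le_of_eq ?_)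
      · exact ((hF.meas_deriv s hs).sub (hF.meas_deriv t ht)).norm
      · exact ((hH.meas_deriv s hs).sub (hH.meas_deriv t ht)).norm
      · rw [eLpNorm_norm, eLpNorm_norm]

theorem IsBddC1.hasDerivAt {I : Set ℝ} {M : ℝ} {f f' : ℝ → Lp G 2 μ}
    (h : IsBddC1 μ I M (fun t => f t) (fun t => f' t)) {t : ℝ} (ht : t ∈ I) :
    HasDerivAt f (f' t) t := by
  rw [hasDerivAt_iff_tendsto_slope, Lp.tendsto_Lp_iff_tendsto_eLpNorm']
  refine (h.deriv t ht).congr fun s => eLpNorm_congr_ae ?_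
  filter_upwards [Lp.coeFn_sub (f s) (f t), Lp.coeFn_smul (s - t)⁻¹ (f s - f t)] with x h1 h2
  simp only [slope_def_module, Pi.sub_apply]
  rw [h2, Pi.smul_apply, h1, Pi.sub_apply]

theorem IsBddC1.continuousOn_deriv {I : Set ℝ} {M : ℝ} {f f' : ℝ → Lp G 2 μ}
    (h : IsBddC1 μ I M (fun t => f t) (fun t => f' t)) : ContinuousOn f' I := by
  intro t ht
  refine ContinuousAt.continuousWithinAt ?_
  unfold ContinuousAt
  rw [Lp.tendsto_Lp_iff_tendsto_eLpNorm']
  exact h.cont t ht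

/-- A family differentiable in `L²` with derivative bounded by `M` is `M`-Lipschitz in `t`,
uniformly in `x`: apply the mean value inequality in `L²` of the set where this fails. -/
theorem ae_norm_sub_le_of_tendsto [IsFiniteMeasure μ] {I : Set ℝ} (hI : IsOpen I)
    (hconv : Convex ℝ I) {M : ℝ} (hM : 0 ≤ M) {F F' : ℝ → α → G} (hF : ∀ t ∈ I, MemLp (F t) 2 μ)
    (hF' : ∀ t ∈ I, AEStronglyMeasurable (F' t) μ) (hb : ∀ t ∈ I, ∀ᵐ x ∂μ, ‖F' t x‖ ≤ M)
    (hd : ∀ t ∈ I, Tendsto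
      (fun s => eLpNorm (fun x => (s - t)⁻¹ • (F s x - F t x) - F' t x) 2 μ) (𝓝[≠] t) (𝓝 0))
    {s t : ℝ} (hs : s ∈ I) (ht : t ∈ I) : ∀ᵐ x ∂μ, ‖F s x - F t x‖ ≤ M * |s - t| := by
  have hm : AEStronglyMeasurable (fun x => F s x - F t x) μ := (hF s hs).1.sub (hF t ht).1
  suffices H : ∀ n : ℕ, ∀ᵐ x ∂μ, ‖hm.mk _ x‖ < M * |s - t| + 1 / ((n : ℝ) + 1) by
    filter_upwards [ae_all_iff.2 H, hm.ae_eq_mk] with x hx hx2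
    rw [hx2]
    refine le_of_forall_pos_lt_add fun δ hδ => ?_
    obtain ⟨n, hn⟩ := exists_nat_one_div_lt hδ
    linarith [hx n]
  intro n
  set δ : ℝ := 1 / ((n : ℝ) + 1) with hδ
  have hδ0 : 0 < δ := Nat.one_div_pos_of_nat
  set k : ℝ := M * |s - t| + δ with hk
  have hk0 : 0 < k := by positivity
  -- the set on which the bound is exceeded
  set B : Set α := {x | k ≤ ‖hm.mk _ x‖} with hB
  have hBm : MeasurableSet B :=
    measurableSet_le measurable_const hm.stronglyMeasurable_mk.norm.measurable
  let ν := μ.restrict B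
  have hFB : ∀ t ∈ I, MemLp (F t) 2 ν := fun t ht => (hF t ht).restrict B
  have hFB' : ∀ t ∈ I, MemLp (F' t) 2 ν := fun t ht =>
    (MemLp.of_bound (hF' t ht) M (hb t ht)).restrict B
  classical
  let f : ℝ → Lp G 2 ν := fun t => if h : t ∈ I then (hFB t h).toLp else 0
  let f' : ℝ → Lp G 2 ν := fun t => if h : t ∈ I then (hFB' t h).toLp else 0
  have hf : ∀ t ∈ I, f t =ᵐ[ν] F t := fun t ht => by
    simp only [f, dif_pos ht]
    exact (hFB t ht).coeFn_toLp
  have hf' : ∀ t ∈ I, f' t =ᵐ[ν] F' t := fun t ht => by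
    simp only [f', dif_pos ht]
    exact (hFB' t ht).coeFn_toLp
  have hder : ∀ t ∈ I, HasDerivAt f (f' t) t := by
    intro t ht
    rw [hasDerivAt_iff_tendsto_slope, Lp.tendsto_Lp_iff_tendsto_eLpNorm']
    refine tendsto_of_tendsto_of_tendsto_of_le_of_le' tendsto_const_nhds (hd t ht)
      (Eventually.of_forall fun _ => zero_le) ?_
    filter_upwards [eventually_mem_punctured hI ht] with s hs
    refine le_trans (le_of_eq (eLpNorm_congr_ae ?_))
      (eLpNorm_mono_measure _ Measure.restrict_le_self)
    filter_upwards [Lp.coeFn_sub (f s) (f t), Lp.coeFn_smul (s - t)⁻¹ (f s - f t), hf s hs.1,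
      hf t ht, hf' t ht] with x h1 h2 h3 h4 h5
    simp only [slope_def_module, Pi.sub_apply]
    rw [h2, Pi.smul_apply, h1, Pi.sub_apply, h3, h4, h5]
  have hnorm : ∀ t ∈ I, ‖f' t‖ ≤ M * μ.real B ^ (1 / 2 : ℝ) := by
    intro t ht
    have h1 : ∀ᵐ x ∂ν, ‖f' t x‖ ≤ M := by
      filter_upwards [hf' t ht, ae_restrict_of_ae (hb t ht)] with x h1 h2
      rwa [h1]
    have h2 := Lp.norm_le_of_ae_bound hM h1
    refine h2.trans (le_of_eq ?_)
    rw [mul_comm]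
    simp only [ν, measureUnivNNReal, Measure.real, one_div, Measure.restrict_apply_univ]
    rfl
  have hmv := hconv.norm_image_sub_le_of_norm_hasDerivWithin_le
    (fun t ht => (hder t ht).hasDerivWithinAt) hnorm ht hs
  -- on `B`, Chebyshev's inequality contradicts the mean value inequality unless `B` is a null set
  have hcheb := mul_meas_ge_le_pow_eLpNorm' ν (p := 2) (by norm_num) (by norm_num)
    (f := hm.mk _) hm.stronglyMeasurable_mk.aestronglyMeasurable (ENNReal.ofReal k)
  have hset : {x | ENNReal.ofReal k ≤ ‖hm.mk _ x‖ₑ} = B := by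
    ext x
    simp only [hB, mem_ofPred_eq, ← ofReal_norm]
    exact ENNReal.ofReal_le_ofReal_iff (norm_nonneg _)
  have heq : eLpNorm (hm.mk _) 2 ν = ENNReal.ofReal ‖f s - f t‖ := by
    rw [← toReal_enorm, ENNReal.ofReal_toReal enorm_ne_top, Lp.enorm_def]
    refine eLpNorm_congr_ae ?_
    filter_upwards [Lp.coeFn_sub (f s) (f t), hf s hs, hf t ht,
      ae_restrict_of_ae hm.ae_eq_mk] with x h1 h2 h3 h4
    rw [h1, Pi.sub_apply, h2, h3, ← h4]
  rw [hset, heq, show ν B = μ B by simp [ν]] at hcheb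
  have hreal : k ^ 2 * μ.real B ≤ ‖f s - f t‖ ^ 2 := by
    have h1 : μ B = ENNReal.ofReal (μ.real B) := (ENNReal.ofReal_toReal (measure_ne_top μ B)).symm
    have h2 : (2 : ℝ≥0∞).toReal = ((2 : ℕ) : ℝ) := by norm_num
    rw [h1, h2, ENNReal.rpow_natCast, ENNReal.rpow_natCast, ← ENNReal.ofReal_pow hk0.le,
      ← ENNReal.ofReal_pow (norm_nonneg _), ← ENNReal.ofReal_mul (by positivity)] at hcheb
    exact (ENNReal.ofReal_le_ofReal_iff (by positivity)).1 hcheb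
  have hm0 : 0 ≤ μ.real B := measureReal_nonneg
  have hsq : (μ.real B ^ (1 / 2 : ℝ)) ^ 2 = μ.real B := by
    rw [← Real.sqrt_eq_rpow, Real.sq_sqrt hm0]
  have h3 : ‖f s - f t‖ ^ 2 ≤ (M * |s - t|) ^ 2 * μ.real B := by
    calc ‖f s - f t‖ ^ 2 ≤ (M * μ.real B ^ (1 / 2 : ℝ) * ‖s - t‖) ^ 2 := by gcongr
      _ = (M * |s - t|) ^ 2 * μ.real B := by rw [Real.norm_eq_abs]; nlinarith [hsq]
  have h4 : (M * |s - t|) ^ 2 < k ^ 2 := by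
    have : 0 ≤ M * |s - t| := by positivity
    nlinarith
  have h5 : μ.real B = 0 := by nlinarith
  have h6 : μ B = 0 := by
    rwa [measureReal_eq_zero_iff] at h5
  rw [ae_iff]
  convert h6 using 2
  ext x
  simp [hB]

end BddC1

/-! ### Composition and multiplication of families of class `C¹` -/

theorem aestronglyMeasurable_comp_of_continuousOn {α G G' : Type*} [MeasurableSpace α]
    {μ : Measure α} [NormedAddCommGroup G] [NormedAddCommGroup G']
    [SecondCountableTopology G'] {K : Set G} (hK : IsClosed K) {Φ : G → G'}
    (hΦ : ContinuousOn Φ K) {f : α → G} (hf : AEStronglyMeasurable f μ)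
    (hfK : ∀ᵐ x ∂μ, f x ∈ K) : AEStronglyMeasurable (fun x => Φ (f x)) μ := by
  classical
  borelize G
  borelize G'
  have h1 : Measurable (K.piecewise Φ (fun _ => 0)) :=
    hΦ.measurable_piecewise continuousOn_const hK.measurableSet
  have h2 : AEStronglyMeasurable (fun x => K.piecewise Φ (fun _ => 0) (f x)) μ :=
    (h1.comp_aemeasurable hf.aemeasurable).aestronglyMeasurable
  refine h2.congr ?_
  filter_upwards [hfK] with x hx
  rw [piecewise_eq_of_mem _ _ _ hx]

section

variable {α G G' : Type*} [MeasurableSpace α] {μ : Measure α} [NormedAddCommGroup G]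
  [NormedSpace ℝ G] [NormedAddCommGroup G'] [NormedSpace ℝ G']

/-- A `C¹` map is differentiable uniformly at the points of a compact set. The points `p` at which
the linearization is compared with the map need not belong to this set. -/
theorem exists_uniform_fderiv_bound {U K : Set G} (hU : IsOpen U) (hK : IsCompact K) (hKU : K ⊆ U)
    {Φ : G → G'} (hΦ : ContDiffOn ℝ 1 Φ U) {η : ℝ} (hη : 0 < η) :
    ∃ δ > 0, ∀ q ∈ K, ∀ p, dist p q < δ → ‖Φ p - Φ q - fderiv ℝ Φ q (p - q)‖ ≤ η * ‖p - q‖ := by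
  refine hK.induction_on (p := fun S => ∃ δ > 0, ∀ q ∈ S, ∀ p, dist p q < δ →
    ‖Φ p - Φ q - fderiv ℝ Φ q (p - q)‖ ≤ η * ‖p - q‖) ⟨1, one_pos, by simp⟩ ?_ ?_ ?_
  · rintro S S' hS ⟨δ, hδ, h⟩
    exact ⟨δ, hδ, fun q hq => h q (hS hq)⟩
  · rintro S S' ⟨δ, hδ, h⟩ ⟨δ', hδ', h'⟩
    refine ⟨min δ δ', lt_min hδ hδ', fun q hq p hp => ?_⟩
    rcases hq with hq | hq
    · exact h q hq p (hp.trans_le (min_le_left _ _))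
    · exact h' q hq p (hp.trans_le (min_le_right _ _))
  · intro A hA
    have hAU := hU.mem_nhds (hKU hA)
    have hs : HasStrictFDerivAt Φ (fderiv ℝ Φ A) A :=
      (hΦ.contDiffAt hAU).hasStrictFDerivAt (by norm_num)
    have hc : ContinuousAt (fderiv ℝ Φ) A :=
      (hΦ.continuousOn_fderiv_of_isOpen hU le_rfl).continuousAt hAU
    have h1 := hs.isLittleO.bound (half_pos hη)
    rw [Metric.eventually_nhds_iff] at h1
    obtain ⟨r, hr, h1⟩ := h1
    obtain ⟨r', hr', h2⟩ := Metric.continuousAt_iff.1 hc (η / 2) (half_pos hη)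
    refine ⟨Metric.ball A (min (r / 2) r'), mem_nhdsWithin_of_mem_nhds
      (Metric.ball_mem_nhds _ (by positivity)), r / 2, by positivity, fun q hq p hp => ?_⟩
    have hq1 : dist q A < r / 2 := (Metric.mem_ball.1 hq).trans_le (min_le_left _ _)
    have hq2 : dist q A < r' := (Metric.mem_ball.1 hq).trans_le (min_le_right _ _)
    have hpA : dist p A < r := by linarith [dist_triangle p q A]
    have h3 := h1 (y := (p, q)) (max_lt hpA (by simpa using by linarith))
    have h4 := h2 hq2
    simp only at h3
    calc ‖Φ p - Φ q - fderiv ℝ Φ q (p - q)‖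
        = ‖(Φ p - Φ q - fderiv ℝ Φ A (p - q)) - (fderiv ℝ Φ q - fderiv ℝ Φ A) (p - q)‖ := by
          congr 1
          simp only [_root_.sub_apply]
          abel
      _ ≤ η / 2 * ‖p - q‖ + η / 2 * ‖p - q‖ := by
          refine (norm_sub_le _ _).trans (add_le_add h3 ?_)
          refine ((fderiv ℝ Φ q - fderiv ℝ Φ A).le_opNorm _).trans ?_
          gcongr
          rw [← dist_eq_norm]
          exact h4.le
      _ = η * ‖p - q‖ := by ring

/-- **Chain rule.** If `Φ` is `C¹` near a compact set that contains the values of a family of class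
`C¹`, then `Φ ∘ F` is again of class `C¹`. -/
theorem IsBddC1.comp [FiniteDimensional ℝ G] [FiniteDimensional ℝ G'] [IsFiniteMeasure μ]
    {I : Set ℝ} (hI : IsOpen I) {M : ℝ}
    (hM : 0 ≤ M) {F F' : ℝ → α → G} (h : IsBddC1 μ I M F F') {U K : Set G} (hU : IsOpen U)
    (hK : IsCompact K) (hKU : K ⊆ U) {Φ : G → G'} (hΦ : ContDiffOn ℝ 1 Φ U)
    (hFK : ∀ t ∈ I, ∀ᵐ x ∂μ, F t x ∈ K) :
    ∃ M', 0 ≤ M' ∧ IsBddC1 μ I M' (fun t x => Φ (F t x))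
      (fun t x => fderiv ℝ Φ (F t x) (F' t x)) := by
  have hDc : ContinuousOn (fderiv ℝ Φ) K :=
    (hΦ.continuousOn_fderiv_of_isOpen hU le_rfl).mono hKU
  obtain ⟨C, hC⟩ := hK.exists_bound_of_continuousOn hDc
  obtain ⟨C', hC'⟩ : ∃ C', LipschitzOnWith C' Φ K := by
    refine LocallyLipschitzOn.exists_lipschitzOnWith_of_compact hK fun x hx => ?_
    obtain ⟨C', s, hs, hL⟩ :=
      (hΦ.contDiffAt (hU.mem_nhds (hKU hx))).exists_lipschitzOnWith
    exact ⟨C', s, mem_nhdsWithin_of_mem_nhds hs, hL⟩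
  have : SecondCountableTopology G := by
    have := FiniteDimensional.proper ℝ G
    infer_instance
  have : SecondCountableTopology G' := by
    have := FiniteDimensional.proper ℝ G'
    infer_instance
  have : SecondCountableTopology (G →L[ℝ] G') := by
    have := FiniteDimensional.proper ℝ (G →L[ℝ] G')
    infer_instance
  have hC0 : 0 ≤ |C| := abs_nonneg C
  have hCK : ∀ x ∈ K, ‖fderiv ℝ Φ x‖ ≤ |C| := fun x hx => (hC x hx).trans (le_abs_self C)
  have hmD : ∀ t ∈ I, AEStronglyMeasurable (fun x => fderiv ℝ Φ (F t x)) μ := fun t ht =>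
    aestronglyMeasurable_comp_of_continuousOn hK.isClosed hDc (h.meas t ht) (hFK t ht)
  have hmeas : ∀ t ∈ I, AEStronglyMeasurable (fun x => Φ (F t x)) μ := fun t ht =>
    aestronglyMeasurable_comp_of_continuousOn hK.isClosed (hΦ.continuousOn.mono hKU) (h.meas t ht)
      (hFK t ht)
  have hmDF : ∀ s ∈ I, ∀ g : α → G, AEStronglyMeasurable g μ →
      AEStronglyMeasurable (fun x => fderiv ℝ Φ (F s x) (g x)) μ := fun s hs g hg =>
    (ContinuousLinearMap.apply ℝ G' : G →L[ℝ] (G →L[ℝ] G') →L[ℝ] G').aestronglyMeasurable_comp₂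
      hg (hmD s hs)
  have hcm : ∀ (c : ℝ), 0 ≤ c → eLpNorm (fun _ : α => c) 2 μ
      = ENNReal.ofReal c * eLpNorm (fun _ : α => (1 : ℝ)) 2 μ := by
    intro c hc
    have := eLpNorm_const_smul c (fun _ : α => (1 : ℝ)) 2 μ
    rw [Real.enorm_eq_ofReal hc] at this
    rw [← this]
    congr 1
    ext
    simp
  have hone : eLpNorm (fun _ : α => (1 : ℝ)) 2 μ ≠ ⊤ :=
    (memLp_const (1 : ℝ)).eLpNorm_ne_top
  -- it suffices to bound by an arbitrarily small constant plus a null family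
  have key : ∀ (l : Filter ℝ) (N : ℝ → ℝ≥0∞) (Q : ℝ → ℝ≥0∞), Tendsto Q l (𝓝 0) →
      (∀ η > 0, ∀ᶠ s in l, N s ≤ eLpNorm (fun _ : α => (η : ℝ)) 2 μ + ENNReal.ofReal |C| * Q s) →
      Tendsto N l (𝓝 0) := by
    intro l N Q hQ hN
    rw [ENNReal.tendsto_nhds_zero]
    intro ξ hξ
    have h1 : Tendsto (fun η : ℝ => eLpNorm (fun _ : α => η) 2 μ) (𝓝[>] 0) (𝓝 0) := by
      have : Tendsto (fun η : ℝ => ENNReal.ofReal η * eLpNorm (fun _ : α => (1 : ℝ)) 2 μ) (𝓝[>] 0)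
          (𝓝 (ENNReal.ofReal 0 * eLpNorm (fun _ : α => (1 : ℝ)) 2 μ)) :=
        ENNReal.Tendsto.mul_const
          ((ENNReal.continuous_ofReal.tendsto 0).mono_left nhdsWithin_le_nhds) (Or.inr hone)
      rw [ENNReal.ofReal_zero, zero_mul] at this
      refine this.congr' ?_
      filter_upwards [self_mem_nhdsWithin] with η hη
      rw [hcm η (le_of_lt hη)]
    have hξ2 : 0 < ξ / 2 := ENNReal.half_pos hξ.ne'
    obtain ⟨η, hη1, hη2⟩ := ((ENNReal.tendsto_nhds_zero.1 h1 (ξ / 2) hξ2).and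
      self_mem_nhdsWithin).exists
    have h2 : Tendsto (fun s => ENNReal.ofReal |C| * Q s) l (𝓝 0) := by
      have := ENNReal.Tendsto.const_mul hQ (Or.inr (ENNReal.ofReal_ne_top (r := |C|)))
      simpa using this
    filter_upwards [hN η hη2, ENNReal.tendsto_nhds_zero.1 h2 _ hξ2] with s hs1 hs2
    calc N s ≤ _ := hs1
      _ ≤ ξ / 2 + ξ / 2 := add_le_add hη1 hs2
      _ = ξ := ENNReal.add_halves ξ
  have habs : ∀ (t : ℝ) (δ : ℝ), 0 < δ → ∀ᶠ s in 𝓝 t, M * |s - t| < δ := by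
    intro t δ hδ
    have : Tendsto (fun s : ℝ => M * |s - t|) (𝓝 t) (𝓝 (M * |t - t|)) :=
      ((continuous_id.sub continuous_const).abs.const_mul M).tendsto t
    rw [sub_self, abs_zero, mul_zero] at this
    exact this.eventually_lt_const hδ
  refine ⟨max (|C| * M) (C' * M), le_max_of_le_left (by positivity), hmeas,
    fun t ht => hmDF t ht _ (h.meas_deriv t ht), fun t ht => ?_, fun s hs t ht => ?_,
    fun t ht => ?_, fun t ht => ?_⟩
  · filter_upwards [h.bound t ht, hFK t ht] with x h1 h2
    refine le_max_of_le_left (((fderiv ℝ Φ (F t x)).le_opNorm _).trans ?_)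
    gcongr
    exact hCK _ h2
  · filter_upwards [h.lip s hs t ht, hFK t ht, hFK s hs] with x h1 h2 h3
    calc ‖Φ (F s x) - Φ (F t x)‖ ≤ C' * ‖F s x - F t x‖ := by
          rw [← dist_eq_norm, ← dist_eq_norm]
          exact hC'.dist_le_mul _ h3 _ h2
      _ ≤ C' * (M * |s - t|) := by gcongr
      _ = C' * M * |s - t| := by ring
      _ ≤ _ := by gcongr; exact le_max_right _ _
  -- `Φ` is replaced by its linearization at `F t x`, uniformly in `x`, which is possible because `F
  -- s` is close to `F t` in the sup norm
  · refine key _ _ _ (h.deriv t ht) fun η hη => ?_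
    obtain ⟨δ, hδ, hδ2⟩ := exists_uniform_fderiv_bound hU hK hKU hΦ (η := η / (M + 1))
      (by positivity)
    filter_upwards [eventually_mem_punctured hI ht,
      mem_nhdsWithin_of_mem_nhds (habs t δ hδ)] with s hs hs2
    have hst : 0 < |s - t| := abs_pos.2 (sub_ne_zero.2 hs.2)
    have hmq : AEStronglyMeasurable (fun x => (s - t)⁻¹ • (F s x - F t x) - F' t x) μ :=
      (((h.meas s hs.1).sub (h.meas t ht)).const_smul (s - t)⁻¹).sub (h.meas_deriv t ht)
    calc _ ≤ eLpNorm (fun x => η + |C| * ‖(s - t)⁻¹ • (F s x - F t x) - F' t x‖) 2 μ := by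
          refine eLpNorm_mono_ae_real ?_
          filter_upwards [hFK t ht, hFK s hs.1, h.lip s hs.1 t ht] with x h1 h2 h3
          have h4 := hδ2 _ h1 (F s x) (by rw [dist_eq_norm]; exact h3.trans_lt hs2)
          have h5 : (s - t)⁻¹ • (Φ (F s x) - Φ (F t x)) - fderiv ℝ Φ (F t x) (F' t x)
              = (s - t)⁻¹ • (Φ (F s x) - Φ (F t x) - fderiv ℝ Φ (F t x) (F s x - F t x))
              + fderiv ℝ Φ (F t x) ((s - t)⁻¹ • (F s x - F t x) - F' t x) := by
            rw [map_sub _ ((s - t)⁻¹ • (F s x - F t x)), map_smul,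
              smul_sub _ (Φ (F s x) - Φ (F t x))]
            abel
          rw [h5]
          refine (norm_add_le _ _).trans (add_le_add ?_ ?_)
          · rw [norm_smul, norm_inv, Real.norm_eq_abs, inv_mul_le_iff₀ hst]
            calc _ ≤ η / (M + 1) * ‖F s x - F t x‖ := h4
              _ ≤ η / (M + 1) * (M * |s - t|) := by gcongr
              _ = |s - t| * (η * (M / (M + 1))) := by ring
              _ ≤ |s - t| * η := by
                gcongr
                refine mul_le_of_le_one_right hη.le ?_
                rw [div_le_one (by positivity)]
                linarith
          · refine ((fderiv ℝ Φ (F t x)).le_opNorm _).trans ?_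
            gcongr
            exact hCK _ h1
      _ ≤ _ := by
          refine (eLpNorm_add_le aestronglyMeasurable_const (hmq.norm.const_mul _)
            (by norm_num)).trans (le_of_eq ?_)
          congr 1
          have := eLpNorm_const_smul |C| (fun x => ‖(s - t)⁻¹ • (F s x - F t x) - F' t x‖) 2 μ
          rw [Real.enorm_eq_ofReal hC0, eLpNorm_norm] at this
          exact this
  · refine key _ _ _ (h.cont t ht) fun η hη => ?_
    have hu := hK.uniformContinuousOn_of_continuous hDc
    rw [Metric.uniformContinuousOn_iff] at hu
    obtain ⟨δ, hδ, hδ2⟩ := hu (η / (M + 1)) (by positivity)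
    filter_upwards [hI.mem_nhds ht, habs t δ hδ] with s hs hs2
    calc _ ≤ eLpNorm (fun x => η + |C| * ‖F' s x - F' t x‖) 2 μ := by
          refine eLpNorm_mono_ae_real ?_
          filter_upwards [hFK t ht, hFK s hs, h.lip s hs t ht, h.bound s hs] with x h1 h2 h3 h6
          have h4 := hδ2 _ h2 _ h1 (by rw [dist_eq_norm]; exact h3.trans_lt hs2)
          have h5 : fderiv ℝ Φ (F s x) (F' s x) - fderiv ℝ Φ (F t x) (F' t x)
              = (fderiv ℝ Φ (F s x) - fderiv ℝ Φ (F t x)) (F' s x)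
              + fderiv ℝ Φ (F t x) (F' s x - F' t x) := by
            rw [map_sub, _root_.sub_apply]
            abel
          rw [h5]
          refine (norm_add_le _ _).trans (add_le_add ?_ ?_)
          · refine ((fderiv ℝ Φ (F s x) - fderiv ℝ Φ (F t x)).le_opNorm _).trans ?_
            rw [← dist_eq_norm]
            calc _ ≤ η / (M + 1) * M := by gcongr
              _ = η * (M / (M + 1)) := by ring
              _ ≤ η := by
                refine mul_le_of_le_one_right hη.le ?_
                rw [div_le_one (by positivity)]
                linarith
          · refine ((fderiv ℝ Φ (F t x)).le_opNorm _).trans ?_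
            gcongr
            exact hCK _ h1
      _ ≤ _ := by
          refine (eLpNorm_add_le aestronglyMeasurable_const
            (((h.meas_deriv s hs).sub (h.meas_deriv t ht)).norm.const_mul _)
            (by norm_num)).trans (le_of_eq ?_)
          congr 1
          have := eLpNorm_const_smul |C| (fun x => ‖F' s x - F' t x‖) 2 μ
          rw [Real.enorm_eq_ofReal hC0, eLpNorm_norm] at this
          exact this

/-- If operators `q i x`, bounded uniformly, tend to `0` in `L²`, then they tend to `0` strongly as
multiplication operators of `L²`: this is clear on bounded functions, which are dense. -/
theorem tendsto_eLpNorm_apply {ι : Type*} {l : Filter ι} {q : ι → α → (G →L[ℝ] G')} {C : ℝ}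
    (hq : ∀ᶠ i in l, AEStronglyMeasurable (q i) μ ∧ ∀ᵐ x ∂μ, ‖q i x‖ ≤ C)
    (hlim : Tendsto (fun i => eLpNorm (q i) 2 μ) l (𝓝 0)) {g : α → G} (hg : MemLp g 2 μ) :
    Tendsto (fun i => eLpNorm (fun x => q i x (g x)) 2 μ) l (𝓝 0) := by
  rw [ENNReal.tendsto_nhds_zero]
  intro ξ hξ
  have hξ2 : ξ / 2 ≠ 0 := (ENNReal.half_pos hξ.ne').ne'
  have hC1 : ENNReal.ofReal (|C| + 1) ≠ 0 := by
    simp only [ne_eq, ENNReal.ofReal_eq_zero, not_le]; positivity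
  obtain ⟨s, hs, hsm⟩ := hg.exists_simpleFunc_eLpNorm_sub_lt (by norm_num)
    (ENNReal.div_ne_zero.2 ⟨hξ2, ENNReal.ofReal_ne_top (r := |C| + 1)⟩)
  obtain ⟨R, hR⟩ := s.exists_forall_norm_le
  set k : α → G := g - ⇑s with hk
  have h1 : Tendsto (fun i => ENNReal.ofReal |R| * eLpNorm (q i) 2 μ) l (𝓝 0) := by
    have := ENNReal.Tendsto.const_mul hlim (Or.inr (ENNReal.ofReal_ne_top (r := |R|)))
    simpa using this
  filter_upwards [hq, ENNReal.tendsto_nhds_zero.1 h1 _ (ENNReal.half_pos hξ.ne')] with i hi hi2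
  have hm1 : AEStronglyMeasurable (fun x => |R| * ‖q i x‖) μ := hi.1.norm.const_mul _
  have hm2 : AEStronglyMeasurable (fun x => (|C| + 1) * ‖k x‖) μ :=
    (hg.1.sub hsm.1).norm.const_mul _
  calc eLpNorm (fun x => q i x (g x)) 2 μ
      ≤ eLpNorm (fun x => |R| * ‖q i x‖ + (|C| + 1) * ‖k x‖) 2 μ := by
        refine eLpNorm_mono_ae_real ?_
        filter_upwards [hi.2] with x hx
        have : q i x (g x) = q i x (s x) + q i x (k x) := by
          rw [← map_add, hk, Pi.sub_apply, add_sub_cancel]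
        rw [this]
        refine (norm_add_le _ _).trans (add_le_add ?_ ?_)
        · refine ((q i x).le_opNorm _).trans ?_
          rw [mul_comm]
          gcongr
          exact (hR x).trans (le_abs_self R)
        · refine ((q i x).le_opNorm _).trans ?_
          gcongr
          linarith [le_abs_self C]
    _ ≤ ENNReal.ofReal |R| * eLpNorm (q i) 2 μ
        + ENNReal.ofReal (|C| + 1) * eLpNorm k 2 μ := by
        refine (eLpNorm_add_le hm1 hm2 (by norm_num)).trans (le_of_eq ?_)
        have e1 := eLpNorm_const_smul |R| (fun x => ‖q i x‖) 2 μ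
        rw [Real.enorm_eq_ofReal (abs_nonneg R), eLpNorm_norm] at e1
        have e2 := eLpNorm_const_smul (|C| + 1) (fun x => ‖k x‖) 2 μ
        rw [Real.enorm_eq_ofReal (by positivity), eLpNorm_norm] at e2
        exact congrArg₂ (· + ·) e1 e2
    _ ≤ ξ / 2 + ξ / 2 := by
        refine add_le_add hi2 ?_
        calc _ ≤ ENNReal.ofReal (|C| + 1) * (ξ / 2 / ENNReal.ofReal (|C| + 1)) :=
              mul_le_mul_right hs.le _
          _ ≤ ξ / 2 := ENNReal.mul_div_le
    _ = ξ := ENNReal.add_halves ξ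

/-- Multiplication by a bounded operator-valued function, as an operator between `L²` spaces. -/
def mulOp (a : Lp (G →L[ℝ] G') ∞ μ) : Lp G 2 μ →L[ℝ] Lp G' 2 μ :=
  (ContinuousLinearMap.id ℝ (G →L[ℝ] G')).holderL μ ∞ 2 2 a

theorem coeFn_mulOp (a : Lp (G →L[ℝ] G') ∞ μ) (g : Lp G 2 μ) :
    mulOp a g =ᵐ[μ] fun x => a x (g x) :=
  ContinuousLinearMap.coeFn_holder (ContinuousLinearMap.id ℝ (G →L[ℝ] G')) a g

theorem norm_mulOp_le (a : Lp (G →L[ℝ] G') ∞ μ) {C : ℝ} (hC : 0 ≤ C)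
    (ha : ∀ᵐ x ∂μ, ‖a x‖ ≤ C) : ‖mulOp a‖ ≤ C := by
  refine ContinuousLinearMap.opNorm_le_bound _ hC fun g => ?_
  refine Lp.norm_le_mul_norm_of_ae_le_mul ?_
  filter_upwards [coeFn_mulOp a g, ha] with x h1 h2
  rw [h1]
  exact (a x).le_of_opNorm_le h2 _

/-- Multiplication by a family of class `C¹` is strongly differentiable. It need not be
differentiable in the operator norm, as the difference quotients converge in `L²` and are bounded,
but need not converge in `L^∞`. -/
theorem IsBddC1.hasDerivAt_mulOp {I : Set ℝ} (hI : IsOpen I) {M : ℝ}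
    {a a' : ℝ → Lp (G →L[ℝ] G') ∞ μ} (h : IsBddC1 μ I M (fun t => a t) (fun t => a' t)) {t : ℝ}
    (ht : t ∈ I) (g : Lp G 2 μ) : HasDerivAt (fun s => mulOp (a s) g) (mulOp (a' t) g) t := by
  rw [hasDerivAt_iff_tendsto_slope, Lp.tendsto_Lp_iff_tendsto_eLpNorm']
  have key := tendsto_eLpNorm_apply (l := 𝓝[≠] t)
    (q := fun s x => (s - t)⁻¹ • (a s x - a t x) - a' t x) (C := M + M) ?_ (h.deriv t ht)
    (Lp.memLp g)
  · refine key.congr fun s => eLpNorm_congr_ae ?_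
    filter_upwards [Lp.coeFn_sub (slope (fun s => mulOp (a s) g) t s) (mulOp (a' t) g),
      Lp.coeFn_smul (s - t)⁻¹ (mulOp (a s) g - mulOp (a t) g),
      Lp.coeFn_sub (mulOp (a s) g) (mulOp (a t) g), coeFn_mulOp (a s) g, coeFn_mulOp (a t) g,
      coeFn_mulOp (a' t) g] with x h1 h2 h3 h4 h5 h6
    rw [Pi.sub_apply, slope_def_module, h2, Pi.smul_apply, h3, Pi.sub_apply, h4, h5, h6]
    simp
  · filter_upwards [eventually_mem_punctured hI ht] with s hs
    refine ⟨(((h.meas s hs.1).sub (h.meas t ht)).const_smul (s - t)⁻¹).sub (h.meas_deriv t ht), ?_⟩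
    have hst : 0 < |s - t| := abs_pos.2 (sub_ne_zero.2 hs.2)
    filter_upwards [h.lip s hs.1 t ht, h.bound t ht] with x h1 h2
    refine (norm_sub_le _ _).trans (add_le_add ?_ h2)
    rw [norm_smul, norm_inv, Real.norm_eq_abs, inv_mul_le_iff₀ hst, mul_comm]
    exact h1

theorem IsBddC1.continuousOn_mulOp {I : Set ℝ} (hI : IsOpen I) {M : ℝ}
    {a a' : ℝ → Lp (G →L[ℝ] G') ∞ μ} (h : IsBddC1 μ I M (fun t => a t) (fun t => a' t))
    (g : Lp G 2 μ) : ContinuousOn (fun s => mulOp (a' s) g) I := by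
  intro t ht
  refine ContinuousAt.continuousWithinAt ?_
  unfold ContinuousAt
  rw [Lp.tendsto_Lp_iff_tendsto_eLpNorm']
  have key := tendsto_eLpNorm_apply (l := 𝓝 t)
    (q := fun s x => a' s x - a' t x) (C := M + M) ?_ (h.cont t ht) (Lp.memLp g)
  · refine key.congr fun s => eLpNorm_congr_ae ?_
    filter_upwards [coeFn_mulOp (a' s) g, coeFn_mulOp (a' t) g] with x h1 h2
    rw [Pi.sub_apply, h1, h2, _root_.sub_apply]
  · filter_upwards [hI.mem_nhds ht] with s hs
    refine ⟨(h.meas_deriv s hs).sub (h.meas_deriv t ht), ?_⟩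
    filter_upwards [h.bound s hs, h.bound t ht] with x h1 h2
    exact (norm_sub_le _ _).trans (add_le_add h1 h2)

/-! ### Lipschitz functions and segments -/

theorem LipschitzOnWith.ae_differentiableAt_of_isOpen {F : Type*} [NormedAddCommGroup F]
    [NormedSpace ℝ F] [FiniteDimensional ℝ F] {Ω : Set (Euc d)} (hΩ : IsOpen Ω) {f : Euc d → F}
    {K : ℝ≥0} (hf : LipschitzOnWith K f Ω) :
    ∀ᵐ x ∂(volume.restrict Ω), DifferentiableAt ℝ f x := by
  rw [ae_restrict_iff' hΩ.measurableSet]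
  filter_upwards [hf.ae_differentiableWithinAt_of_mem (μ := volume)] with x hx hxΩ
  exact (hx hxΩ).differentiableAt (hΩ.mem_nhds hxΩ)

theorem LipschitzOnWith.ae_norm_fderiv_le {F : Type*} [NormedAddCommGroup F]
    [NormedSpace ℝ F] {Ω : Set (Euc d)} (hΩ : IsOpen Ω) {f : Euc d → F}
    {K : ℝ≥0} (hf : LipschitzOnWith K f Ω) :
    ∀ᵐ x ∂(volume.restrict Ω), ‖fderiv ℝ f x‖ ≤ K := by
  rw [ae_restrict_iff' hΩ.measurableSet]
  exact ae_of_all _ fun x hx => norm_fderiv_le_of_lipschitzOn ℝ (hΩ.mem_nhds hx) hf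

/-- For almost every translate of a line, almost every point of the translate avoids a null set. -/
theorem ae_ae_line_of_ae {P : Euc d → Prop} (hP : ∀ᵐ x, P x) (a v : Euc d) :
    ∀ᵐ z : Euc d, ∀ᵐ s : ℝ, P (a + z + s • v) := by
  obtain ⟨N, hPN, hN, hN0⟩ := exists_measurable_superset_of_null (ae_iff.1 hP)
  have hmeas : MeasurableSet {q : Euc d × ℝ | a + q.1 + q.2 • v ∉ N} := by
    have : Measurable fun q : Euc d × ℝ => a + q.1 + q.2 • v := by fun_prop
    exact (this hN).compl
  have h1 : ∀ᵐ z : Euc d, ∀ᵐ s : ℝ, a + z + s • v ∉ N := by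
    refine (Measure.ae_ae_comm hmeas).2 (ae_of_all _ fun s => ?_)
    have h2 : ∀ᵐ x : Euc d, x ∉ N := by rw [ae_iff]; simpa using hN0
    have := (measurePreserving_add_right (volume : Measure (Euc d))
      (a + s • v)).quasiMeasurePreserving.ae h2
    filter_upwards [this] with z hz
    rwa [show a + z + s • v = z + (a + s • v) by abel]
  filter_upwards [h1] with z hz
  filter_upwards [hz] with s hs
  by_contra hc
  exact hs (hPN hc)

/-- A Lipschitz function on an open set whose derivative is bounded by `c` almost everywhere is
`c`-Lipschitz along segments: almost all nearby parallel segments meet the exceptional null set in a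
null set. -/
theorem LipschitzOnWith.norm_sub_le_of_ae_norm_fderiv_le {F : Type*} [NormedAddCommGroup F]
    [NormedSpace ℝ F] {Ω : Set (Euc d)} (hΩ : IsOpen Ω) {f : Euc d → F} {K : ℝ≥0}
    [FiniteDimensional ℝ F]
    (hf : LipschitzOnWith K f Ω) {c : ℝ} (hc : ∀ᵐ x ∂(volume.restrict Ω), ‖fderiv ℝ f x‖ ≤ c)
    {a b : Euc d} (hab : segment ℝ a b ⊆ Ω) : ‖f b - f a‖ ≤ c * ‖b - a‖ := by
  -- a norming functional reduces the claim to a scalar function, which extends to the whole space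
  obtain ⟨e, he1, he2⟩ := exists_dual_vector'' ℝ (f b - f a)
  obtain ⟨g, hg, hgf⟩ : ∃ g : Euc d → ℝ, LipschitzWith (‖e‖₊ * K) g ∧ EqOn (fun x => e (f x)) g Ω :=
    (e.lipschitz.comp_lipschitzOnWith hf).extend_real
  set v := b - a with hv
  obtain ⟨δ, hδ, hδΩ⟩ : ∃ δ > 0, Metric.thickening δ (segment ℝ a b) ⊆ Ω := by
    refine IsCompact.exists_thickening_subset_open ?_ hΩ hab
    rw [segment_eq_image_lineMap]
    exact isCompact_Icc.image AffineMap.lineMap_continuous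
  have hin : ∀ z ∈ Metric.ball (0 : Euc d) δ, ∀ s ∈ Icc (0 : ℝ) 1, a + z + s • v ∈ Ω := by
    intro z hz s hs
    refine hδΩ (Metric.mem_thickening_iff.2 ⟨a + s • v, ?_, ?_⟩)
    · rw [segment_eq_image']
      exact ⟨s, hs, rfl⟩
    · rw [dist_eq_norm]
      simpa [add_sub_add_right_eq_sub] using hz
  have hP : ∀ᵐ x : Euc d, x ∈ Ω → DifferentiableAt ℝ f x ∧ ‖fderiv ℝ f x‖ ≤ c := by
    have h1 := hf.ae_differentiableAt_of_isOpen hΩ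
    rw [ae_restrict_iff' hΩ.measurableSet] at h1 hc
    filter_upwards [h1, hc] with x h1 h2 hx using ⟨h1 hx, h2 hx⟩
  -- almost every parallel segment nearby meets the exceptional null set in a null set, so the
  -- fundamental theorem of calculus applies there; the segment itself is reached by continuity
  have hz : ∀ᵐ z : Euc d, z ∈ Metric.ball (0 : Euc d) δ →
      ‖g (a + z + v) - g (a + z)‖ ≤ c * ‖v‖ := by
    filter_upwards [ae_ae_line_of_ae hP a v] with z hz hzδ
    have hLip : LipschitzWith (‖e‖₊ * K * ‖v‖₊) (fun s : ℝ => g (a + z + s • v)) := by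
      refine hg.comp (LipschitzWith.of_dist_le_mul fun s s' => ?_)
      rw [dist_eq_norm, add_sub_add_left_eq_sub, ← sub_smul, norm_smul, mul_comm, dist_eq_norm]
      rfl
    have hAC : AbsolutelyContinuousOnInterval (fun s : ℝ => g (a + z + s • v)) 0 1 :=
      (hLip.lipschitzOnWith (s := uIcc 0 1)).absolutelyContinuousOnInterval
    have hft := hAC.integral_deriv_eq_sub
    simp only [one_smul, zero_smul, add_zero] at hft
    rw [← hft]
    have := intervalIntegral.norm_integral_le_of_norm_le_const_ae
      (f := deriv (fun s : ℝ => g (a + z + s • v))) (C := c * ‖v‖) (a := 0) (b := 1) ?_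
    · simpa using this
    · have hne : ∀ᵐ s : ℝ, s ≠ 0 ∧ s ≠ 1 := by
        filter_upwards [Measure.ae_ne (volume : Measure ℝ) 0, Measure.ae_ne (volume : Measure ℝ) 1]
          with s h1 h2 using ⟨h1, h2⟩
      filter_upwards [hz] with s hs hs01
      rw [uIoc_of_le zero_le_one] at hs01
      have hmem := hin z hzδ s ⟨hs01.1.le, hs01.2⟩
      obtain ⟨hd, hle⟩ := hs hmem
      have hfd : HasFDerivAt g (e.comp (fderiv ℝ f (a + z + s • v))) (a + z + s • v) := by
        refine (e.hasFDerivAt.comp _ hd.hasFDerivAt).congr_of_eventuallyEq ?_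
        filter_upwards [hΩ.mem_nhds hmem] with x hx using (hgf hx).symm
      have hline : HasDerivAt (fun s : ℝ => a + z + s • v) v s := by
        simpa using ((hasDerivAt_id s).smul_const v).const_add (a + z)
      have hder := hfd.comp_hasDerivAt s hline
      rw [show deriv (fun s : ℝ => g (a + z + s • v)) s = _ from hder.deriv]
      calc ‖e (fderiv ℝ f (a + z + s • v) v)‖ ≤ 1 * ‖fderiv ℝ f (a + z + s • v) v‖ :=
            e.le_of_opNorm_le he1 _
        _ ≤ c * ‖v‖ := by
            rw [one_mul]
            exact (fderiv ℝ f (a + z + s • v)).le_of_opNorm_le hle _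
  have hclosed : IsClosed {z : Euc d | ‖g (a + z + v) - g (a + z)‖ ≤ c * ‖v‖} := by
    have := hg.continuous
    exact isClosed_le (by fun_prop) continuous_const
  have h0 : (0 : Euc d) ∈ {z : Euc d | ‖g (a + z + v) - g (a + z)‖ ≤ c * ‖v‖} := by
    have h1 := mem_closure_iff_frequently.1 (Measure.dense_of_ae hz (0 : Euc d))
    refine hclosed.mem_of_frequently_of_tendsto ?_ tendsto_id
    refine (h1.and_eventually (Metric.ball_mem_nhds (0 : Euc d) hδ)).mono fun z hz => hz.1 hz.2
  have ha : a ∈ Ω := hab (left_mem_segment ℝ a b)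
  have hb : b ∈ Ω := hab (right_mem_segment ℝ a b)
  simp only [mem_ofPred_eq, add_zero] at h0
  rw [hv, add_sub_cancel, ← hgf ha, ← hgf hb, ← map_sub, he2] at h0
  simpa [hv] using h0

/-! ### Local quasiconvexity of Lipschitz domains -/

theorem norm_sub_inner_smul_le {E : Type*} [NormedAddCommGroup E] [InnerProductSpace ℝ E] {e : E}
    (he : ‖e‖ = 1) (u : E) : ‖u - inner ℝ e u • e‖ ≤ ‖u‖ := by
  have h : ‖u - inner ℝ e u • e‖ ^ 2 = ‖u‖ ^ 2 - (inner ℝ e u) ^ 2 := by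
    rw [norm_sub_sq_real, inner_smul_right, norm_smul, he, real_inner_comm, Real.norm_eq_abs,
      mul_one, sq_abs]
    ring
  refine le_of_sq_le_sq ?_ (norm_nonneg _)
  nlinarith [sq_nonneg (inner ℝ e u)]

/-- Points of `closure Ω` lie on or above the graph. -/
theorem graph_le_of_mem_closure {Ω : Set (Euc d)} {p e : Euc d} {g : Euc d → ℝ} {r : ℝ}
    (hg : Continuous g)
    (h : ∀ x ∈ Metric.ball p r, x ∈ Ω ↔ g (x - inner ℝ e x • e) < inner ℝ e x) {x : Euc d}
    (hx : x ∈ closure Ω) (hxr : x ∈ Metric.ball p r) : g (x - inner ℝ e x • e) ≤ inner ℝ e x := by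
  have hclosed : IsClosed {x : Euc d | g (x - inner ℝ e x • e) ≤ inner ℝ e x} :=
    isClosed_le (by fun_prop) (by fun_prop)
  have : x ∈ {x : Euc d | g (x - inner ℝ e x • e) ≤ inner ℝ e x} := by
    refine hclosed.mem_of_frequently_of_tendsto ?_ (tendsto_id (x := 𝓝 x))
    refine ((mem_closure_iff_frequently.1 hx).and_eventually
      (Metric.isOpen_ball.mem_nhds hxr)).mono fun z hz => ?_
    exact ((h z hz.2).1 hz.1).le
  exact this

/-- The points above the graph, over a point whose projection is close to that of a point of `Ω`. -/
theorem above_graph {e : Euc d} (he : ‖e‖ = 1) {g : Euc d → ℝ} {K : ℝ≥0} (hg : LipschitzWith K g)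
    {x u : Euc d} {h : ℝ} (hx : g (x - inner ℝ e x • e) ≤ inner ℝ e x)
    (hh : (K + 1) * ‖u‖ < h) :
    g ((x + u + h • e) - inner ℝ e (x + u + h • e) • e) < inner ℝ e (x + u + h • e) := by
  have h1 : inner ℝ e (x + u + h • e) = inner ℝ e x + inner ℝ e u + h := by
    rw [inner_add_right, inner_add_right, inner_smul_right, real_inner_self_eq_norm_sq, he]
    ring
  have h2 : (x + u + h • e) - inner ℝ e (x + u + h • e) • e
      = (x - inner ℝ e x • e) + (u - inner ℝ e u • e) := by
    rw [h1, add_smul, add_smul]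
    abel
  have h3 := hg.dist_le_mul ((x - inner ℝ e x • e) + (u - inner ℝ e u • e)) (x - inner ℝ e x • e)
  rw [dist_eq_norm, dist_eq_norm, add_sub_cancel_left] at h3
  have h4 := norm_sub_inner_smul_le he u
  have h5 := abs_real_inner_le_norm e u
  rw [he, one_mul] at h5
  rw [h2, h1]
  have h6 := (le_abs_self _).trans h3
  have h7 : (K : ℝ) * ‖u - inner ℝ e u • e‖ ≤ K * ‖u‖ := by gcongr
  linarith [neg_abs_le (inner ℝ e u)]

/-- Lipschitz domains are locally quasiconvex. Near a boundary point, two points of the domain are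
lifted over the graph by a fixed multiple of their distance, and the lifted points are joined by a
segment. -/
theorem IsBoundedLipschitzDomain.exists_polygonal_path {Ω : Set (Euc d)}
    (hΩ : IsBoundedLipschitzDomain Ω) {p : Euc d} (hp : p ∈ closure Ω) :
    ∃ ρ > 0, ∃ C, 0 ≤ C ∧ ∀ x ∈ Ω ∩ Metric.ball p ρ, ∀ x' ∈ Ω ∩ Metric.ball p ρ, ∃ y z : Euc d,
      segment ℝ x y ⊆ Ω ∧ segment ℝ y z ⊆ Ω ∧ segment ℝ z x' ⊆ Ω ∧
      ‖y - x‖ + ‖z - y‖ + ‖x' - z‖ ≤ C * ‖x' - x‖ := by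
  by_cases hpΩ : p ∈ Ω
  · obtain ⟨ρ, hρ, hball⟩ := Metric.isOpen_iff.1 hΩ.isOpen p hpΩ
    refine ⟨ρ, hρ, 1, zero_le_one, fun x hx x' hx' => ⟨x', x', ?_, ?_, ?_, ?_⟩⟩
    · exact ((convex_ball p ρ).segment_subset hx.2 hx'.2).trans hball
    · rw [segment_same]; exact singleton_subset_iff.2 hx'.1
    · rw [segment_same]; exact singleton_subset_iff.2 hx'.1
    · simp
  · have hpf : p ∈ frontier Ω := by
      rw [hΩ.isOpen.frontier_eq]
      exact ⟨hp, hpΩ⟩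
    obtain ⟨e, g, K, r, he, hg, hr, hgr⟩ := hΩ.locally_graph p hpf
    -- lifted by `k ‖x' - x‖`, the segment from `x` to `x'` lies above the graph
    set k : ℝ := 2 * (K + 1) with hk
    have hk0 : 0 < k := by positivity
    refine ⟨r / (2 * k + 1), by positivity, 2 * k + 1, by positivity, ?_⟩
    rintro x ⟨hxΩ, hx⟩ x' ⟨hxΩ', hx'⟩
    set ρ := r / (2 * k + 1) with hρ
    have hρr : (2 * k + 1) * ρ = r := by rw [hρ]; field_simp
    have hρ0 : 0 < ρ := by positivity
    rcases eq_or_ne x x' with rfl | hne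
    · refine ⟨x, x, ?_, ?_, ?_, by simp⟩ <;>
      · rw [segment_same]; exact singleton_subset_iff.2 hxΩ
    have hpos : 0 < ‖x' - x‖ := norm_pos_iff.2 (sub_ne_zero.2 hne.symm)
    have hdist : ‖x' - x‖ < 2 * ρ := by
      rw [← dist_eq_norm]
      have := dist_triangle_right x' x p
      rw [Metric.mem_ball] at hx hx'
      linarith
    have hball : ∀ w ∈ Metric.ball p ρ, ∀ s, 0 ≤ s → s ≤ k * ‖x' - x‖ →
        w + s • e ∈ Metric.ball p r := by
      intro w hw s hs hs'
      rw [Metric.mem_ball, dist_eq_norm] at hw ⊢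
      calc ‖w + s • e - p‖ = ‖(w - p) + s • e‖ := by congr 1; abel
        _ ≤ ‖w - p‖ + ‖s • e‖ := norm_add_le _ _
        _ < ρ + k * (2 * ρ) := by
          rw [norm_smul, he, mul_one, Real.norm_of_nonneg hs]
          have : k * ‖x' - x‖ ≤ k * (2 * ρ) := by gcongr
          linarith
        _ = r := by linarith
    have hup : ∀ w ∈ Ω ∩ Metric.ball p ρ, ∀ s, 0 ≤ s → s ≤ k * ‖x' - x‖ → w + s • e ∈ Ω := by
      rintro w ⟨hwΩ, hw⟩ s hs hs'
      rcases hs.eq_or_lt with rfl | hs0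
      · simpa using hwΩ
      have hwr : w ∈ Metric.ball p r := by
        have := hball w hw 0 le_rfl (by positivity)
        simpa using this
      rw [hgr _ (hball w hw s hs hs')]
      have := above_graph he hg (x := w) (u := 0) (h := s) ((hgr w hwr).1 hwΩ).le
        (by simpa using hs0)
      simpa using this
    have hxr : x ∈ Metric.ball p r := by
      have := hball x hx 0 le_rfl (by positivity)
      simpa using this
    refine ⟨x + (k * ‖x' - x‖) • e, x' + (k * ‖x' - x‖) • e, ?_, ?_, ?_, ?_⟩
    · rw [segment_eq_image']
      rintro _ ⟨s, hs, rfl⟩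
      have := hup x ⟨hxΩ, hx⟩ (s * (k * ‖x' - x‖)) (mul_nonneg hs.1 (by positivity))
        (mul_le_of_le_one_left (by positivity) hs.2)
      simpa [mul_smul] using this
    · rw [segment_eq_image']
      rintro _ ⟨s, hs, rfl⟩
      have hmem : x + s • (x' - x) ∈ Metric.ball p ρ :=
        (convex_ball p ρ).add_smul_sub_mem hx hx' hs
      have hmem2 := hball _ hmem (k * ‖x' - x‖) (by positivity) le_rfl
      have hgoal : x + s • (x' - x) + (k * ‖x' - x‖) • e ∈ Ω := by
        rw [hgr _ hmem2]
        refine above_graph he hg ((hgr x hxr).1 hxΩ).le ?_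
        rw [norm_smul, Real.norm_of_nonneg hs.1]
        have h1 : s * ‖x' - x‖ ≤ ‖x' - x‖ := mul_le_of_le_one_left hpos.le hs.2
        calc ((K : ℝ) + 1) * (s * ‖x' - x‖) ≤ (K + 1) * ‖x' - x‖ := by gcongr
          _ < k * ‖x' - x‖ := by rw [hk]; nlinarith [K.coe_nonneg]
      convert hgoal using 1
      simp only [add_sub_add_right_eq_sub]
      abel
    · rw [segment_symm, segment_eq_image']
      rintro _ ⟨s, hs, rfl⟩
      have := hup x' ⟨hxΩ', hx'⟩ (s * (k * ‖x' - x‖)) (mul_nonneg hs.1 (by positivity))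
        (mul_le_of_le_one_left (by positivity) hs.2)
      simpa [mul_smul] using this
    · simp only [add_sub_cancel_left, add_sub_add_right_eq_sub, sub_add_cancel_left, norm_neg,
        norm_smul, he, mul_one, Real.norm_eq_abs, abs_mul, abs_norm, abs_of_pos hk0]
      linarith

/-- The geometric property of Lipschitz domains in the form used below: a bound along segments in
`Ω` is a Lipschitz bound near every point of the closure, with the same constant for all functions.
-/
theorem IsBoundedLipschitzDomain.exists_local_lipschitz {Ω : Set (Euc d)}
    (hΩ : IsBoundedLipschitzDomain Ω) {p : Euc d} (hp : p ∈ closure Ω) :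
    ∃ ρ > 0, ∃ C, 0 ≤ C ∧ ∀ (f : Euc d → Euc d) (c : ℝ), 0 ≤ c → ContinuousOn f (closure Ω) →
      (∀ a b, segment ℝ a b ⊆ Ω → ‖f b - f a‖ ≤ c * ‖b - a‖) →
      ∀ x ∈ closure Ω ∩ Metric.ball p ρ, ∀ x' ∈ closure Ω ∩ Metric.ball p ρ,
        ‖f x' - f x‖ ≤ c * C * ‖x' - x‖ := by
  obtain ⟨ρ, hρ, C, hC, h⟩ := hΩ.exists_polygonal_path hp
  refine ⟨ρ, hρ, C, hC, fun f c hc hf hseg => ?_⟩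
  have h1 : ∀ x ∈ Ω ∩ Metric.ball p ρ, ∀ x' ∈ Ω ∩ Metric.ball p ρ,
      ‖f x' - f x‖ ≤ c * C * ‖x' - x‖ := by
    intro x hx x' hx'
    obtain ⟨y, z, hxy, hyz, hzx, hle⟩ := h x hx x' hx'
    calc ‖f x' - f x‖ = ‖(f y - f x) + (f z - f y) + (f x' - f z)‖ := by congr 1; abel
      _ ≤ ‖f y - f x‖ + ‖f z - f y‖ + ‖f x' - f z‖ := norm_add₃_le
      _ ≤ c * ‖y - x‖ + c * ‖z - y‖ + c * ‖x' - z‖ :=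
        add_le_add (add_le_add (hseg _ _ hxy) (hseg _ _ hyz)) (hseg _ _ hzx)
      _ = c * (‖y - x‖ + ‖z - y‖ + ‖x' - z‖) := by ring
      _ ≤ c * (C * ‖x' - x‖) := by gcongr
      _ = c * C * ‖x' - x‖ := by ring
  have hcl : closure Ω ∩ Metric.ball p ρ ⊆ closure (Ω ∩ Metric.ball p ρ) := by
    rw [inter_comm, inter_comm Ω]
    exact Metric.isOpen_ball.inter_closure
  intro x hx x' hx'
  have hx2 := hcl hx
  have hx2' := hcl hx'
  have hne : (𝓝[Ω ∩ Metric.ball p ρ] x).NeBot := mem_closure_iff_nhdsWithin_neBot.1 hx2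
  have hne' : (𝓝[Ω ∩ Metric.ball p ρ] x').NeBot := mem_closure_iff_nhdsWithin_neBot.1 hx2'
  have hsub : Ω ∩ Metric.ball p ρ ⊆ closure Ω := inter_subset_left.trans subset_closure
  have hl : Tendsto f (𝓝[Ω ∩ Metric.ball p ρ] x) (𝓝 (f x)) :=
    (hf x hx.1).mono_left (nhdsWithin_mono _ hsub)
  have hl' : Tendsto f (𝓝[Ω ∩ Metric.ball p ρ] x') (𝓝 (f x')) :=
    (hf x' hx'.1).mono_left (nhdsWithin_mono _ hsub)
  have hid : ∀ w : Euc d, Tendsto (fun w => w) (𝓝[Ω ∩ Metric.ball p ρ] w) (𝓝 w) := fun w =>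
    tendsto_id.mono_left nhdsWithin_le_nhds
  have step : ∀ w ∈ Ω ∩ Metric.ball p ρ, ‖f x' - f w‖ ≤ c * C * ‖x' - w‖ := by
    intro w hw
    refine le_of_tendsto_of_tendsto (hl'.sub_const (f w)).norm
      (((hid x').sub_const w).norm.const_mul (c * C)) ?_
    filter_upwards [self_mem_nhdsWithin] with z hz using h1 w hw z hz
  refine le_of_tendsto_of_tendsto (hl.const_sub (f x')).norm
    (((hid x).const_sub x').norm.const_mul (c * C)) ?_
  filter_upwards [self_mem_nhdsWithin] with z hz using step z hz

/-! ### Regularity in time of the deformation -/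

theorem tendsto_eLpNorm_of_bounded {α ι G : Type*} [MeasurableSpace α] {μ : Measure α}
    [IsFiniteMeasure μ] [NormedAddCommGroup G] {l : Filter ι} [l.IsCountablyGenerated]
    {q : ι → α → G} {C : ℝ} (hm : ∀ᶠ i in l, AEStronglyMeasurable (q i) μ)
    (hb : ∀ᶠ i in l, ∀ᵐ x ∂μ, ‖q i x‖ ≤ C)
    (hlim : ∀ᵐ x ∂μ, Tendsto (fun i => q i x) l (𝓝 0)) :
    Tendsto (fun i => eLpNorm (q i) 2 μ) l (𝓝 0) := by
  have h1 : Tendsto (fun i => ∫ x, ‖q i x‖ ^ (2 : ℝ) ∂μ) l (𝓝 (∫ _, 0 ∂μ)) := by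
    refine tendsto_integral_filter_of_dominated_convergence (fun _ => |C| ^ (2 : ℝ)) ?_ ?_
      (integrable_const _) ?_
    · filter_upwards [hm] with i hi
      exact (hi.norm.aemeasurable.pow_const _).aestronglyMeasurable
    · filter_upwards [hb] with i hi
      filter_upwards [hi] with x hx
      rw [Real.norm_of_nonneg (by positivity)]
      gcongr
      exact hx.trans (le_abs_self C)
    · filter_upwards [hlim] with x hx
      have := (hx.norm.rpow_const (p := 2) (Or.inr (by norm_num)))
      simpa using this
  rw [integral_zero] at h1
  have h2 := ENNReal.tendsto_ofReal (h1.rpow_const (p := (2 : ℝ)⁻¹) (Or.inr (by norm_num)))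
  rw [Real.zero_rpow (by norm_num), ENNReal.ofReal_zero] at h2
  refine h2.congr' ?_
  filter_upwards [hm, hb] with i hi hi2
  rw [(MemLp.of_bound hi C hi2).eLpNorm_eq_integral_rpow_norm (by norm_num) (by norm_num)]
  simp

/-- A family that is `C¹` in `t` for each `x` and Lipschitz in `t` uniformly in `x` is of class
`C¹` in `L²`. -/
theorem isBddC1_of_hasDerivAt {α G : Type*} [MeasurableSpace α] {μ : Measure α} [IsFiniteMeasure μ]
    [NormedAddCommGroup G] [NormedSpace ℝ G] {I : Set ℝ} (hI : IsOpen I) {C : ℝ}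
    {F F' : ℝ → α → G} (hm : ∀ t ∈ I, AEStronglyMeasurable (F t) μ)
    (hlip : ∀ᵐ x ∂μ, ∀ s ∈ I, ∀ t ∈ I, ‖F s x - F t x‖ ≤ C * |s - t|)
    (hd : ∀ᵐ x ∂μ, ∀ t ∈ I, HasDerivAt (fun t => F t x) (F' t x) t)
    (hc : ∀ᵐ x ∂μ, ContinuousOn (fun t => F' t x) I) : IsBddC1 μ I C F F' := by
  have hslope : ∀ᵐ x ∂μ, ∀ s ∈ I, ∀ t ∈ I, s ≠ t → ‖(s - t)⁻¹ • (F s x - F t x)‖ ≤ C := by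
    filter_upwards [hlip] with x hx s hs t ht hst
    have hst : 0 < |s - t| := abs_pos.2 (sub_ne_zero.2 hst)
    rw [norm_smul, norm_inv, Real.norm_eq_abs, inv_mul_le_iff₀ hst, mul_comm]
    exact hx s hs t ht
  have hb : ∀ᵐ x ∂μ, ∀ t ∈ I, ‖F' t x‖ ≤ C := by
    filter_upwards [hslope, hd] with x h1 h2 t ht
    refine le_of_tendsto (hasDerivAt_iff_tendsto_slope.1 (h2 t ht)).norm ?_
    filter_upwards [eventually_mem_punctured hI ht] with s hs
    rw [slope_def_module]
    exact h1 s hs.1 t ht hs.2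
  -- the derivative is a limit of a sequence of difference quotients, hence measurable
  have hm' : ∀ t ∈ I, AEStronglyMeasurable (F' t) μ := by
    intro t ht
    obtain ⟨u, hu⟩ := exists_seq_tendsto (𝓝[≠] t)
    have hu2 := hu.eventually (eventually_mem_punctured hI ht)
    obtain ⟨N, hN⟩ := eventually_atTop.1 hu2
    refine aestronglyMeasurable_of_tendsto_ae atTop
      (f := fun n x => slope (fun t => F t x) t (u (n + N))) (fun n => ?_) ?_
    · simp only [slope_def_module]
      exact ((hm _ (hN _ (Nat.le_add_left _ _)).1).sub (hm t ht)).const_smul _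
    · filter_upwards [hd] with x hx
      exact (hasDerivAt_iff_tendsto_slope.1 (hx t ht)).comp (hu.comp (tendsto_add_atTop_nat N))
  refine ⟨hm, hm', fun t ht => hb.mono fun x hx => hx t ht,
    fun s hs t ht => hlip.mono fun x hx => hx s hs t ht, fun t ht => ?_, fun t ht => ?_⟩
  · refine tendsto_eLpNorm_of_bounded (C := C + C) ?_ ?_ ?_
    · filter_upwards [eventually_mem_punctured hI ht] with s hs
      exact (((hm s hs.1).sub (hm t ht)).const_smul _).sub (hm' t ht)
    · filter_upwards [eventually_mem_punctured hI ht] with s hs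
      filter_upwards [hslope, hb] with x h1 h2
      exact (norm_sub_le _ _).trans (add_le_add (h1 s hs.1 t ht hs.2) (h2 t ht))
    · filter_upwards [hd] with x hx
      have := hasDerivAt_iff_tendsto_slope.1 (hx t ht)
      rw [← tendsto_sub_nhds_zero_iff] at this
      exact this.congr fun s => by rw [slope_def_module]
  · refine tendsto_eLpNorm_of_bounded (C := C + C) ?_ ?_ ?_
    · filter_upwards [hI.mem_nhds ht] with s hs
      exact (hm' s hs).sub (hm' t ht)
    · filter_upwards [hI.mem_nhds ht] with s hs
      filter_upwards [hb] with x h2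
      exact (norm_sub_le _ _).trans (add_le_add (h2 s hs) (h2 t ht))
    · filter_upwards [hc] with x hx
      rw [tendsto_sub_nhds_zero_iff]
      exact hx.continuousAt (hI.mem_nhds ht)

namespace IsDeformation

variable {Ω : Set (Euc d)} {ε : ℝ} {T : ℝ → Euc d → Euc d}

theorem continuousOn (hT : IsDeformation Ω ε T) {t : ℝ} (ht : t ∈ Ioo (-ε) ε) :
    ContinuousOn (T t) (closure Ω) := by
  obtain ⟨K, hK⟩ := hT.lipschitz t ht
  exact hK.continuousOn

theorem ae_differentiableAt (hT : IsDeformation Ω ε T) (hΩ : IsOpen Ω) {t : ℝ}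
    (ht : t ∈ Ioo (-ε) ε) : ∀ᵐ x ∂(volume.restrict Ω), DifferentiableAt ℝ (T t) x := by
  obtain ⟨K, hK⟩ := hT.lipschitz t ht
  exact (hK.mono subset_closure).ae_differentiableAt_of_isOpen hΩ

end IsDeformation

/-- A map that expands distances near `x` by a factor at least `c` has derivative bounded below. -/
theorem le_norm_fderiv_apply {f : Euc d → Euc d} {Ω : Set (Euc d)} (hΩ : IsOpen Ω) {c : ℝ}
    (h : ∀ x ∈ Ω, ∀ x' ∈ Ω, c * dist x x' ≤ dist (f x) (f x')) {x : Euc d} (hx : x ∈ Ω)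
    (hd : DifferentiableAt ℝ f x) (v : Euc d) : c * ‖v‖ ≤ ‖fderiv ℝ f x v‖ := by
  have h1 := (hd.hasFDerivAt.hasLineDerivAt v).tendsto_slope_zero_right.norm
  refine ge_of_tendsto h1 ?_
  have h2 : ∀ᶠ s : ℝ in 𝓝[>] 0, x + s • v ∈ Ω := by
    have : Tendsto (fun s : ℝ => x + s • v) (𝓝[>] 0) (𝓝 (x + (0 : ℝ) • v)) :=
      Tendsto.mono_left (Continuous.tendsto (by fun_prop) _) nhdsWithin_le_nhds
    rw [zero_smul, add_zero] at this
    exact this.eventually (hΩ.mem_nhds hx)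
  filter_upwards [h2, self_mem_nhdsWithin] with s hs hs0
  have hs0 : 0 < s := hs0
  have h3 := h _ hs x hx
  rw [dist_eq_norm, dist_eq_norm, add_sub_cancel_left, norm_smul, Real.norm_of_nonneg hs0.le] at h3
  rw [norm_smul, norm_inv, Real.norm_of_nonneg hs0.le, le_inv_mul_iff₀ hs0]
  linarith

/-- For a continuous injection of the compact closure of `Ω` onto an open image, the boundary of the
image is the image of the boundary. -/
theorem frontier_image_eq {Ω : Set (Euc d)} (hΩ : IsOpen Ω) (hb : Bornology.IsBounded Ω)
    {f : Euc d → Euc d} (hf : ContinuousOn f (closure Ω)) (hinj : InjOn f (closure Ω))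
    (ho : IsOpen (f '' Ω)) :
    closure (f '' Ω) = f '' closure Ω ∧ frontier (f '' Ω) = f '' frontier Ω := by
  have hcl : closure (f '' Ω) = f '' closure Ω := by
    refine subset_antisymm ?_ hf.image_closure
    refine closure_minimal (image_mono subset_closure) ?_
    exact (hb.isCompact_closure.image_of_continuousOn hf).isClosed
  refine ⟨hcl, ?_⟩
  rw [ho.frontier_eq, hcl, hΩ.frontier_eq, hinj.image_sdiff_subset subset_closure]

/-- An open set whose boundary stays away from a connected set contains it as soon as it meets it.
-/
theorem IsPreconnected.subset_of_disjoint_frontier {X : Type*} [TopologicalSpace X] {A O : Set X}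
    (hA : IsPreconnected A)
    (hO : IsOpen O) (hne : (A ∩ O).Nonempty) (hd : Disjoint A (frontier O)) : A ⊆ O := by
  refine hA.subset_left_of_subset_union hO (isClosed_closure (s := O)).isOpen_compl
    (disjoint_compl_right_iff_subset.2 subset_closure) (fun x hx => ?_) hne
  by_cases h : x ∈ closure O
  · left
    by_contra h2
    exact Set.disjoint_left.1 hd hx (by rw [hO.frontier_eq]; exact ⟨h, h2⟩)
  · exact Or.inr h

namespace IsDifferentiableDeformation

variable {Ω : Set (Euc d)} {ε : ℝ} {T : ℝ → Euc d → Euc d}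

/-- The Jacobi matrices form a family of class `C¹`; their Lipschitz continuity in time in the sup
norm follows from the bound of their derivative in `L²`. -/
theorem exists_isBddC1_fderiv (hT : IsDifferentiableDeformation Ω ε T)
    (hΩ : IsBoundedLipschitzDomain Ω) : ∃ M, 0 ≤ M ∧ ∃ D' : ℝ → Euc d → Euc d →L[ℝ] Euc d,
      IsBddC1 (volume.restrict Ω) (Ioo (-ε) ε) M (fun t x => fderiv ℝ (T t) x) D' := by
  obtain ⟨D', M, h⟩ := hT.deriv_jacobian
  have hfin : IsFiniteMeasure (volume.restrict Ω) :=
    ⟨by rw [Measure.restrict_apply_univ]; exact hΩ.isBounded.measure_lt_top⟩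
  have hb : ∀ t ∈ Ioo (-ε) ε, ∀ᵐ x ∂(volume.restrict Ω), ‖D' t x‖ ≤ |M| := fun t ht =>
    (h t ht).2.1.mono fun x hx => hx.trans (le_abs_self M)
  have hmeas : ∀ t : ℝ, AEStronglyMeasurable (fun x => fderiv ℝ (T t) x) (volume.restrict Ω) :=
    fun t => (measurable_fderiv ℝ (T t)).aestronglyMeasurable
  have hd : ∀ t ∈ Ioo (-ε) ε, Tendsto (fun s => eLpNorm
      (fun x => (s - t)⁻¹ • (fderiv ℝ (T s) x - fderiv ℝ (T t) x) - D' t x) 2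
        (volume.restrict Ω)) (𝓝[≠] t) (𝓝 0) := by
    intro t ht
    have hs : Tendsto (fun s : ℝ => s - t) (𝓝[≠] t) (𝓝[≠] 0) := by
      refine tendsto_nhdsWithin_iff.2 ⟨?_, ?_⟩
      · have : Tendsto (fun s : ℝ => s - t) (𝓝 t) (𝓝 (t - t)) := Continuous.tendsto (by fun_prop) t
        rw [sub_self] at this
        exact this.mono_left nhdsWithin_le_nhds
      · filter_upwards [self_mem_nhdsWithin] with s hs using sub_ne_zero.2 hs
    refine ((h t ht).2.2.1.comp hs).congr fun s => ?_
    simp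
  refine ⟨|M|, abs_nonneg M, D', fun t _ => hmeas t, fun t ht => (h t ht).1, hb,
    fun s hs t ht => ?_, hd, fun t ht => (h t ht).2.2.2⟩
  refine ae_norm_sub_le_of_tendsto isOpen_Ioo (convex_Ioo _ _) (abs_nonneg M) (fun t ht => ?_)
    (fun t ht => (h t ht).1) hb hd hs ht
  obtain ⟨K, hK⟩ := hT.lipschitz t ht
  exact MemLp.of_bound (hmeas t) K ((hK.mono subset_closure).ae_norm_fderiv_le hΩ.isOpen)

/-- The displacement `T_t - T_s` is Lipschitz near every point of `closure Ω`, with a constant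
proportional to `|t - s|`. -/
theorem exists_local_lipschitz (hT : IsDifferentiableDeformation Ω ε T)
    (hΩ : IsBoundedLipschitzDomain Ω) {p : Euc d} (hp : p ∈ closure Ω) :
    ∃ ρ > 0, ∃ C, 0 ≤ C ∧ ∀ s ∈ Ioo (-ε) ε, ∀ t ∈ Ioo (-ε) ε,
      ∀ x ∈ closure Ω ∩ Metric.ball p ρ, ∀ x' ∈ closure Ω ∩ Metric.ball p ρ,
        ‖(T s x' - T t x') - (T s x - T t x)‖ ≤ C * |s - t| * ‖x' - x‖ := by
  obtain ⟨M, hM, D', h⟩ := hT.exists_isBddC1_fderiv hΩ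
  obtain ⟨ρ, hρ, C, hC, hloc⟩ := hΩ.exists_local_lipschitz hp
  refine ⟨ρ, hρ, M * C, by positivity, fun s hs t ht x hx x' hx' => ?_⟩
  have hseg : ∀ a b, segment ℝ a b ⊆ Ω →
      ‖(T s b - T t b) - (T s a - T t a)‖ ≤ M * |s - t| * ‖b - a‖ := by
    intro a b hab
    obtain ⟨K, hK⟩ := hT.lipschitz s hs
    obtain ⟨K', hK'⟩ := hT.lipschitz t ht
    have hL : LipschitzOnWith (K + K') (fun x => T s x - T t x) Ω :=
      (hK.mono subset_closure).sub (hK'.mono subset_closure)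
    refine hL.norm_sub_le_of_ae_norm_fderiv_le hΩ.isOpen ?_ hab
    filter_upwards [h.lip s hs t ht, hT.ae_differentiableAt hΩ.isOpen hs,
      hT.ae_differentiableAt hΩ.isOpen ht] with x h1 h2 h3
    rw [fderiv_fun_sub h2 h3]
    exact h1
  have := hloc (fun x => T s x - T t x) (M * |s - t|) (by positivity)
    ((hT.continuousOn hs).sub (hT.continuousOn ht)) hseg x hx x' hx'
  calc _ ≤ _ := this
    _ = _ := by ring

/-- Differentiability in time, which is assumed at the points of `Ω` only, extends to the closure:
the difference quotients at nearby points differ little, uniformly in time, so those at a boundary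
point satisfy the Cauchy criterion. -/
theorem differentiableAt (hT : IsDifferentiableDeformation Ω ε T)
    (hΩ : IsBoundedLipschitzDomain Ω) {x : Euc d} (hx : x ∈ closure Ω) {t : ℝ}
    (ht : t ∈ Ioo (-ε) ε) : DifferentiableAt ℝ (fun t => T t x) t := by
  have hint : ∀ x' ∈ Ω, DifferentiableAt ℝ (fun t => T t x') t := fun x' hx' =>
    ((hT.contDiffOn x' hx').differentiableOn (by norm_num)).differentiableAt
      (Ioo_mem_nhds ht.1 ht.2)
  obtain ⟨ρ, hρ, C, hC, h⟩ := hT.exists_local_lipschitz hΩ hx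
  suffices H : ∃ V, Tendsto (slope (fun t => T t x) t) (𝓝[≠] t) (𝓝 V) by
    obtain ⟨V, hV⟩ := H
    exact (hasDerivAt_iff_tendsto_slope.2 hV).differentiableAt
  rw [← cauchy_map_iff_exists_tendsto, Metric.cauchy_iff]
  refine ⟨inferInstance, fun η hη => ?_⟩
  obtain ⟨x', hx', hxx'⟩ := Metric.mem_closure_iff.1 hx (min ρ (η / (4 * (C + 1)))) (by positivity)
  have hball : x' ∈ closure Ω ∩ Metric.ball x ρ :=
    ⟨subset_closure hx', by rw [Metric.mem_ball, dist_comm]; exact hxx'.trans_le (min_le_left _ _)⟩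
  have hself : x ∈ closure Ω ∩ Metric.ball x ρ := ⟨hx, Metric.mem_ball_self hρ⟩
  have hclose : ‖x' - x‖ ≤ η / (4 * (C + 1)) := by
    rw [← dist_eq_norm, dist_comm]
    exact hxx'.le.trans (min_le_right _ _)
  have hlim := hasDerivAt_iff_tendsto_slope.1 (hint x' hx').hasDerivAt
  have hev := hlim.eventually (Metric.ball_mem_nhds _ (show 0 < η / 4 by positivity))
  have hdiff : ∀ᶠ s in 𝓝[≠] t,
      ‖slope (fun t => T t x) t s - slope (fun t => T t x') t s‖ < η / 4 := by
    filter_upwards [eventually_mem_punctured isOpen_Ioo ht] with s hs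
    have hst : 0 < |s - t| := abs_pos.2 (sub_ne_zero.2 hs.2)
    rw [slope_def_module, slope_def_module, ← smul_sub, norm_smul, norm_inv, Real.norm_eq_abs,
      inv_mul_lt_iff₀ hst, norm_sub_rev]
    calc _ ≤ C * |s - t| * ‖x' - x‖ := h s hs.1 t ht x hself x' hball
      _ ≤ C * |s - t| * (η / (4 * (C + 1))) := by gcongr
      _ = |s - t| * (η / 4 * (C / (C + 1))) := by field_simp
      _ < |s - t| * (η / 4) := by
        gcongr
        refine mul_lt_of_lt_one_right (by positivity) ?_
        rw [div_lt_one (by positivity)]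
        linarith
  refine ⟨_, Filter.image_mem_map (hev.and hdiff), ?_⟩
  rintro _ ⟨s, ⟨h1, h2⟩, rfl⟩ _ ⟨s', ⟨h3, h4⟩, rfl⟩
  have h1 := Metric.mem_ball.1 h1
  have h3 := Metric.mem_ball.1 h3
  rw [← dist_eq_norm] at h2 h4
  have e1 := dist_triangle (slope (fun t => T t x) t s) (slope (fun t => T t x') t s)
    (slope (fun t => T t x) t s')
  have e2 := dist_triangle (slope (fun t => T t x') t s) (slope (fun t => T t x') t s')
    (slope (fun t => T t x) t s')
  have e3 := dist_triangle_right (slope (fun t => T t x') t s) (slope (fun t => T t x') t s')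
    (deriv (fun t => T t x') t)
  rw [dist_comm] at h4
  linarith

/-- The field `S` is the limit of the difference quotients `(T_s - T_0) / s`, which are Lipschitz
with a constant independent of `s`. -/
theorem lipschitzOnWith_deformationField (hT : IsDifferentiableDeformation Ω ε T) (hε : 0 < ε)
    (hΩ : IsBoundedLipschitzDomain Ω) :
    ∃ K : ℝ≥0, LipschitzOnWith K (deformationField T) (closure Ω) := by
  have h0 : (0 : ℝ) ∈ Ioo (-ε) ε := ⟨by linarith, hε⟩
  refine LocallyLipschitzOn.exists_lipschitzOnWith_of_compact hΩ.isBounded.isCompact_closure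
    fun p hp => ?_
  obtain ⟨ρ, hρ, C, hC, h⟩ := hT.exists_local_lipschitz hΩ hp
  refine ⟨C.toNNReal, closure Ω ∩ Metric.ball p ρ,
    inter_mem_nhdsWithin _ (Metric.ball_mem_nhds p hρ),
    LipschitzOnWith.of_dist_le_mul fun x hx x' hx' => ?_⟩
  rw [Real.coe_toNNReal _ hC, dist_eq_norm, dist_eq_norm]
  have hl := hasDerivAt_iff_tendsto_slope.1 (hT.differentiableAt hΩ hx.1 h0).hasDerivAt
  have hl' := hasDerivAt_iff_tendsto_slope.1 (hT.differentiableAt hΩ hx'.1 h0).hasDerivAt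
  refine le_of_tendsto (hl.sub hl').norm ?_
  filter_upwards [eventually_mem_punctured isOpen_Ioo h0] with s hs
  have hst : 0 < |s - 0| := abs_pos.2 (sub_ne_zero.2 hs.2)
  rw [slope_def_module, slope_def_module, ← smul_sub, norm_smul, norm_inv, Real.norm_eq_abs,
    inv_mul_le_iff₀ hst]
  calc _ ≤ _ := h s hs.1 0 h0 x' hx' x hx
    _ = _ := by ring

/-- Locally in time, `T_t x` is Lipschitz in `t` uniformly in `x`. Near a point of the closure, this
is inferred from a single point `x₀` of `Ω`, where the velocity is continuous, by means of the
estimate of the displacement. -/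
theorem exists_time_lipschitz (hT : IsDifferentiableDeformation Ω ε T)
    (hΩ : IsBoundedLipschitzDomain Ω) {t₀ : ℝ} (ht₀ : t₀ ∈ Ioo (-ε) ε) :
    ∃ δ > 0, Metric.ball t₀ δ ⊆ Ioo (-ε) ε ∧ ∃ C, 0 ≤ C ∧ ∀ x ∈ closure Ω,
      ∀ s ∈ Metric.ball t₀ δ, ∀ t ∈ Metric.ball t₀ δ, ‖T s x - T t x‖ ≤ C * |s - t| := by
  obtain ⟨δ, hδ, hsub⟩ := Metric.nhds_basis_closedBall.mem_iff.1 (Ioo_mem_nhds ht₀.1 ht₀.2)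
  refine ⟨δ, hδ, Metric.ball_subset_closedBall.trans hsub, ?_⟩
  have := hΩ.isBounded.isCompact_closure.induction_on (p := fun S => ∃ C, 0 ≤ C ∧
    ∀ x ∈ S ∩ closure Ω, ∀ s ∈ Metric.ball t₀ δ, ∀ t ∈ Metric.ball t₀ δ,
      ‖T s x - T t x‖ ≤ C * |s - t|) ⟨0, le_rfl, by simp⟩ ?_ ?_ ?_
  · obtain ⟨C, hC, h⟩ := this
    exact ⟨C, hC, fun x hx => h x ⟨hx, hx⟩⟩
  · rintro S S' hS ⟨C, hC, h⟩
    exact ⟨C, hC, fun x hx => h x ⟨hS hx.1, hx.2⟩⟩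
  · rintro S S' ⟨C, hC, h⟩ ⟨C', hC', h'⟩
    refine ⟨max C C', le_max_of_le_left hC, fun x hx s hs t ht => ?_⟩
    rcases hx with ⟨hx | hx, hxΩ⟩
    · exact (h x ⟨hx, hxΩ⟩ s hs t ht).trans (by gcongr; exact le_max_left _ _)
    · exact (h' x ⟨hx, hxΩ⟩ s hs t ht).trans (by gcongr; exact le_max_right _ _)
  · intro p hp
    obtain ⟨ρ, hρ, C, hC, h⟩ := hT.exists_local_lipschitz hΩ hp
    obtain ⟨x₀, hx₀, hx₀p⟩ := Metric.mem_closure_iff.1 hp ρ hρ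
    rw [dist_comm] at hx₀p
    have hder : ContinuousOn (deriv fun t => T t x₀) (Ioo (-ε) ε) :=
      (hT.contDiffOn x₀ hx₀).continuousOn_deriv_of_isOpen isOpen_Ioo le_rfl
    obtain ⟨C₀, hC₀⟩ := (isCompact_closedBall t₀ δ).exists_bound_of_continuousOn (hder.mono hsub)
    have hC₀0 : 0 ≤ C₀ := (norm_nonneg _).trans (hC₀ t₀ (Metric.mem_closedBall_self hδ.le))
    refine ⟨closure Ω ∩ Metric.ball p ρ, inter_mem_nhdsWithin _ (Metric.ball_mem_nhds p hρ),
      C₀ + C * (2 * ρ), by positivity, fun x hx s hs t ht => ?_⟩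
    have hs' := hsub (Metric.ball_subset_closedBall hs)
    have ht' := hsub (Metric.ball_subset_closedBall ht)
    have h1 : ‖T s x₀ - T t x₀‖ ≤ C₀ * ‖s - t‖ :=
      (convex_closedBall t₀ δ).norm_image_sub_le_of_norm_hasDerivWithin_le
        (f := fun t => T t x₀) (f' := deriv fun t => T t x₀)
        (fun r hr => (((hT.contDiffOn x₀ hx₀).differentiableOn (by norm_num)).differentiableAt
          (Ioo_mem_nhds (hsub hr).1 (hsub hr).2)).hasDerivAt.hasDerivWithinAt) hC₀
        (Metric.ball_subset_closedBall ht) (Metric.ball_subset_closedBall hs)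
    have h2 := h s hs' t ht' x₀ ⟨subset_closure hx₀, hx₀p⟩ x hx.1
    have h3 : ‖x - x₀‖ ≤ 2 * ρ := by
      rw [← dist_eq_norm]
      have := dist_triangle_right x x₀ p
      have h4 := hx.1.2
      rw [Metric.mem_ball] at h4
      linarith
    calc ‖T s x - T t x‖ = ‖(T s x₀ - T t x₀) + ((T s x - T t x) - (T s x₀ - T t x₀))‖ := by
          congr 1; abel
      _ ≤ C₀ * |s - t| + C * |s - t| * ‖x - x₀‖ := (norm_add_le _ _).trans (add_le_add h1 h2)
      _ ≤ C₀ * |s - t| + C * |s - t| * (2 * ρ) := by gcongr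
      _ = (C₀ + C * (2 * ρ)) * |s - t| := by ring

end IsDifferentiableDeformation

/-- The pairs of a point in a ball and a matrix with prescribed bounds from above and below. -/
def boundedPairs (d : ℕ) (R c : ℝ) : Set (Euc d × (Euc d →L[ℝ] Euc d)) :=
  Metric.closedBall 0 R ×ˢ {A | ‖A‖ ≤ R ∧ ∀ v, c * ‖v‖ ≤ ‖A v‖}

theorem isCompact_boundedPairs (d : ℕ) (R c : ℝ) : IsCompact (boundedPairs d R c) := by
  refine (isCompact_closedBall _ _).prod ?_
  have : ProperSpace (Euc d →L[ℝ] Euc d) := FiniteDimensional.proper ℝ _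
  refine Metric.isCompact_of_isClosed_isBounded ?_ ?_
  · rw [ofPred_and]
    refine (isClosed_le continuous_norm continuous_const).inter ?_
    rw [ofPred_forall]
    refine isClosed_iInter fun v => isClosed_le continuous_const ?_
    exact ((ContinuousLinearMap.apply ℝ (Euc d) v).continuous).norm
  · refine (Metric.isBounded_closedBall (x := (0 : Euc d →L[ℝ] Euc d)) (r := R)).subset ?_
    rintro A ⟨hA, -⟩
    simpa using hA

/-- The pairs of a point and an invertible matrix. -/
def invertiblePairs (d : ℕ) : Set (Euc d × (Euc d →L[ℝ] Euc d)) := {q | q.2.det ≠ 0}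

theorem isOpen_invertiblePairs (d : ℕ) : IsOpen (invertiblePairs d) :=
  isOpen_ne_fun (ContinuousLinearMap.continuous_det.comp continuous_snd) continuous_const

theorem det_ne_zero_of_le {A : Euc d →L[ℝ] Euc d} {c : ℝ} (hc : 0 < c)
    (h : ∀ v, c * ‖v‖ ≤ ‖A v‖) : A.det ≠ 0 := by
  intro h0
  have h1 : LinearMap.ker (A : Euc d →ₗ[ℝ] Euc d) ≠ ⊥ := fun hbot => by
    have h2 : IsUnit (A : Euc d →ₗ[ℝ] Euc d) :=
      (LinearMap.isUnit_iff_ker_eq_bot _).2 hbot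
    have h3 := LinearMap.isUnit_det _ h2
    exact h3.ne_zero h0
  obtain ⟨v, hv, hv0⟩ := (Submodule.ne_bot_iff _).1 h1
  have h4 := h v
  rw [show A v = 0 from hv, norm_zero] at h4
  exact hv0 (norm_le_zero_iff.1 (nonpos_of_mul_nonpos_right h4 hc))

theorem boundedPairs_subset_invertiblePairs {R c : ℝ} (hc : 0 < c) :
    boundedPairs d R c ⊆ invertiblePairs d := fun _ hq => det_ne_zero_of_le hc hq.2.2

theorem exists_pos_le_abs_det (R : ℝ) {c : ℝ} (hc : 0 < c) :
    ∃ κ > 0, ∀ q ∈ boundedPairs d R c, κ ≤ |q.2.det| := by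
  rcases (boundedPairs d R c).eq_empty_or_nonempty with he | hne
  · exact ⟨1, one_pos, by simp [he]⟩
  · obtain ⟨q, hq, hmin⟩ := (isCompact_boundedPairs d R c).exists_isMinOn hne
      (ContinuousLinearMap.continuous_det.comp continuous_snd).abs.continuousOn
    exact ⟨|q.2.det|, abs_pos.2 (boundedPairs_subset_invertiblePairs hc hq),
      fun q' hq' => hmin hq'⟩

namespace IsDifferentiableDeformation

variable {Ω : Set (Euc d)} {ε : ℝ} {T : ℝ → Euc d → Euc d}

/-- Near each time, the family of pairs `(T_t, DT_t)` is of class `C¹` and takes values in a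
compact set of pairs of a point and an invertible matrix. -/
theorem exists_isBddC1_pair (hT : IsDifferentiableDeformation Ω ε T)
    (hΩ : IsBoundedLipschitzDomain Ω) {t₀ : ℝ} (ht₀ : t₀ ∈ Ioo (-ε) ε) :
    ∃ δ > 0, Metric.ball t₀ δ ⊆ Ioo (-ε) ε ∧ ∃ M R c, 0 ≤ M ∧ 0 < c ∧
      (∀ x ∈ closure Ω, ∀ s ∈ Metric.ball t₀ δ, ∀ t ∈ Metric.ball t₀ δ,
        ‖T s x - T t x‖ ≤ M * |s - t|) ∧
      (∀ x ∈ closure Ω, ∀ t ∈ Metric.ball t₀ δ, ‖T t x‖ ≤ R) ∧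
      (∃ D' : ℝ → Euc d → Euc d →L[ℝ] Euc d, IsBddC1 (volume.restrict Ω) (Metric.ball t₀ δ) M
        (fun t x => (T t x, fderiv ℝ (T t) x)) (fun t x => (deriv (fun t => T t x) t, D' t x))) ∧
      ∀ t ∈ Metric.ball t₀ δ, ∀ᵐ x ∂(volume.restrict Ω),
        DifferentiableAt ℝ (T t) x ∧ (T t x, fderiv ℝ (T t) x) ∈ boundedPairs d R c := by
  have hfin : IsFiniteMeasure (volume.restrict Ω) :=
    ⟨by rw [Measure.restrict_apply_univ]; exact hΩ.isBounded.measure_lt_top⟩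
  obtain ⟨M, hM, D', hD⟩ := hT.exists_isBddC1_fderiv hΩ
  obtain ⟨δ₁, hδ₁, hsub₁, C, hC, hlip⟩ := hT.exists_time_lipschitz hΩ ht₀
  obtain ⟨K, hK⟩ := hT.lipschitz t₀ ht₀
  obtain ⟨c, hc, hanti⟩ := hT.antilipschitz t₀ ht₀
  obtain ⟨R, hR⟩ := (hΩ.isBounded.isCompact_closure.image_of_continuousOn
    (hT.continuousOn ht₀)).isBounded.exists_norm_le
  -- for `|t - t₀| < c / (2 (M + 1))`, the matrix `DT_t` differs from `DT_{t₀}` by at most `c / 2`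
  set δ := min δ₁ (c / (2 * (M + 1))) with hδ
  have hδ0 : 0 < δ := by positivity
  have hsubδ : Metric.ball t₀ δ ⊆ Metric.ball t₀ δ₁ := Metric.ball_subset_ball (min_le_left _ _)
  have hsub : Metric.ball t₀ δ ⊆ Ioo (-ε) ε := hsubδ.trans hsub₁
  have hmem₀ : t₀ ∈ Metric.ball t₀ δ := Metric.mem_ball_self hδ0
  have hΩm : ∀ᵐ x ∂(volume.restrict Ω), x ∈ Ω := ae_restrict_mem hΩ.isOpen.measurableSet
  have hR' : ∀ x ∈ closure Ω, ∀ t ∈ Metric.ball t₀ δ, ‖T t x‖ ≤ R + C * δ := by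
    intro x hx t ht
    have h1 := hlip x hx t (hsubδ ht) t₀ (hsubδ hmem₀)
    have h2 := hR _ (mem_image_of_mem (T t₀) hx)
    have h3 : |t - t₀| ≤ δ := (Metric.mem_ball.1 ht).le
    calc ‖T t x‖ = ‖T t₀ x + (T t x - T t₀ x)‖ := by congr 1; abel
      _ ≤ R + C * δ := (norm_add_le _ _).trans
        (add_le_add h2 (h1.trans (by gcongr)))
  have hmeasT : ∀ t ∈ Metric.ball t₀ δ, AEStronglyMeasurable (T t) (volume.restrict Ω) :=
    fun t ht => ((hT.continuousOn (hsub ht)).mono subset_closure).aestronglyMeasurable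
      hΩ.isOpen.measurableSet
  have hderiv : ∀ t ∈ Metric.ball t₀ δ, ∀ x ∈ Ω,
      HasDerivAt (fun t => T t x) (deriv (fun t => T t x) t) t := fun t ht x hx =>
    (hT.differentiableAt hΩ (subset_closure hx) (hsub ht)).hasDerivAt
  have hTC1 : IsBddC1 (volume.restrict Ω) (Metric.ball t₀ δ) C T
      (fun t x => deriv (fun t => T t x) t) := by
    refine isBddC1_of_hasDerivAt Metric.isOpen_ball hmeasT ?_ ?_ ?_
    · filter_upwards [hΩm] with x hx s hs t ht using
        hlip x (subset_closure hx) s (hsubδ hs) t (hsubδ ht)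
    · filter_upwards [hΩm] with x hx t ht using hderiv t ht x hx
    · filter_upwards [hΩm] with x hx
      exact ((hT.contDiffOn x hx).continuousOn_deriv_of_isOpen isOpen_Ioo le_rfl).mono hsub
  refine ⟨δ, hδ0, hsub, max C M, max (R + C * δ) (K + M * δ), c / 2, le_max_of_le_left hC,
    by positivity, ?_, ?_, ⟨D', ?_⟩, ?_⟩
  · intro x hx s hs t ht
    refine (hlip x hx s (hsubδ hs) t (hsubδ ht)).trans ?_
    gcongr
    exact le_max_left _ _
  · exact fun x hx t ht => (hR' x hx t ht).trans (le_max_left _ _)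
  · exact (hTC1.mono subset_rfl (le_max_left _ _)).prodMk Metric.isOpen_ball
      (hD.mono hsub (le_max_right _ _))
  · intro t ht
    filter_upwards [hΩm, hD.lip t (hsub ht) t₀ ht₀, hT.ae_differentiableAt hΩ.isOpen ht₀,
      hT.ae_differentiableAt hΩ.isOpen (hsub ht),
      (hK.mono subset_closure).ae_norm_fderiv_le hΩ.isOpen] with x hx h1 h2 h3 h4
    have h5 : |t - t₀| ≤ δ := (Metric.mem_ball.1 ht).le
    have h6 : ‖fderiv ℝ (T t) x - fderiv ℝ (T t₀) x‖ ≤ M * δ := h1.trans (by gcongr)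
    refine ⟨h3, ?_, ?_, fun v => ?_⟩
    · rw [mem_closedBall_zero_iff]
      exact (hR' x (subset_closure hx) t ht).trans (le_max_left _ _)
    · refine le_trans ?_ (le_max_right _ _)
      calc ‖fderiv ℝ (T t) x‖
          = ‖fderiv ℝ (T t₀) x + (fderiv ℝ (T t) x - fderiv ℝ (T t₀) x)‖ := by
            rw [add_sub_cancel]
        _ ≤ K + M * δ := (norm_add_le _ _).trans (add_le_add h4 h6)
    · have h7 := le_norm_fderiv_apply hΩ.isOpen
        (fun x hx x' hx' => hanti x (subset_closure hx) x' (subset_closure hx')) hx h2 v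
      have h8 : M * δ ≤ c / 2 := by
        calc M * δ ≤ M * (c / (2 * (M + 1))) := by gcongr; exact min_le_right _ _
          _ = c / 2 * (M / (M + 1)) := by field_simp
          _ ≤ c / 2 := by
            refine mul_le_of_le_one_right (by positivity) ?_
            rw [div_le_one (by positivity)]
            linarith
      have h9 := (fderiv ℝ (T t) x - fderiv ℝ (T t₀) x).le_of_opNorm_le (h6.trans h8) v
      have h10 := norm_sub_norm_le (fderiv ℝ (T t₀) x v) (fderiv ℝ (T t) x v)
      rw [norm_sub_rev (fderiv ℝ (T t₀) x v), ← _root_.sub_apply] at h10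
      change c / 2 * ‖v‖ ≤ ‖fderiv ℝ (T t) x v‖
      linarith

end IsDifferentiableDeformation

/-! ### The space `H¹` -/

namespace H1

variable {Ω γ : Set (Euc d)}

theorem memLp_fn (w : H1 Ω) : MemLp (H1.fn w) 2 (volume.restrict Ω) := Lp.memLp _

theorem memLp_grad (w : H1 Ω) : MemLp (H1.grad w) 2 (volume.restrict Ω) := Lp.memLp _

theorem hasWeakGradient (w : H1 Ω) : HasWeakGradient Ω (H1.fn w) (H1.grad w) := w.2

/-- The embedding of `H¹` into `L²`. -/
def fnL (Ω : Set (Euc d)) : H1 Ω →L[ℝ] Lp ℝ 2 (volume.restrict Ω) :=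
  (WithLp.fstL 2 ℝ _ _).comp (H1 Ω).subtypeL

/-- The gradient, as an operator from `H¹` to `L²`. -/
def gradL (Ω : Set (Euc d)) : H1 Ω →L[ℝ] Lp (Euc d) 2 (volume.restrict Ω) :=
  (WithLp.sndL 2 ℝ _ _).comp (H1 Ω).subtypeL

theorem coe_fnL (w : H1 Ω) : ⇑(fnL Ω w) = H1.fn w := rfl

theorem coe_gradL (w : H1 Ω) : ⇑(gradL Ω w) = H1.grad w := rfl

theorem norm_sq_eq (w : H1 Ω) : ‖w‖ ^ 2 = ‖fnL Ω w‖ ^ 2 + ‖gradL Ω w‖ ^ 2 :=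
  WithLp.prod_norm_sq_eq_of_L2 w.1

theorem fn_add (w w' : H1 Ω) : H1.fn (w + w') =ᵐ[volume.restrict Ω] H1.fn w + H1.fn w' :=
  Lp.coeFn_add (fnL Ω w) (fnL Ω w')

theorem fn_sub (w w' : H1 Ω) : H1.fn (w - w') =ᵐ[volume.restrict Ω] H1.fn w - H1.fn w' :=
  Lp.coeFn_sub (fnL Ω w) (fnL Ω w')

theorem fn_smul (c : ℝ) (w : H1 Ω) : H1.fn (c • w) =ᵐ[volume.restrict Ω] c • H1.fn w :=
  Lp.coeFn_smul c (fnL Ω w)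

theorem grad_add (w w' : H1 Ω) : H1.grad (w + w') =ᵐ[volume.restrict Ω] H1.grad w + H1.grad w' :=
  Lp.coeFn_add (gradL Ω w) (gradL Ω w')

end H1

theorem HasWeakGradient.congr {Ω : Set (Euc d)} {f f' : Euc d → ℝ} {g g' : Euc d → Euc d}
    (h : HasWeakGradient Ω f g) (hf : f =ᵐ[volume.restrict Ω] f')
    (hg : g =ᵐ[volume.restrict Ω] g') : HasWeakGradient Ω f' g' := by
  intro φ hφ
  have h1 : ∫ x in Ω, f' x • ∇ φ x = ∫ x in Ω, f x • ∇ φ x :=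
    integral_congr_ae (hf.mono fun x hx => by simp only [hx])
  have h2 : ∫ x in Ω, φ x • g' x = ∫ x in Ω, φ x • g x :=
    integral_congr_ae (hg.mono fun x hx => by simp only [hx])
  rw [h1, h2, h φ hφ]

/-- The weak gradient is determined by the function. -/
theorem HasWeakGradient.ae_eq {Ω : Set (Euc d)} (hΩ : IsOpen Ω) {f f' : Euc d → ℝ}
    {g g' : Euc d → Euc d} (h : HasWeakGradient Ω f g) (h' : HasWeakGradient Ω f' g')
    (hf : f =ᵐ[volume.restrict Ω] f') (hg : MemLp g 2 (volume.restrict Ω))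
    (hg' : MemLp g' 2 (volume.restrict Ω)) : g =ᵐ[volume.restrict Ω] g' := by
  have hloc : LocallyIntegrableOn (g - g') Ω volume := by
    rw [locallyIntegrableOn_iff hΩ.isLocallyClosed]
    intro k hk hkc
    have h1 : MemLp (g - g') 2 (volume.restrict k) :=
      (hg.sub hg').mono_measure (Measure.restrict_mono hk le_rfl)
    have : IsFiniteMeasure (volume.restrict k) :=
      ⟨by rw [Measure.restrict_apply_univ]; exact hkc.measure_lt_top⟩
    exact h1.integrable (by norm_num)
  have key := hΩ.ae_eq_zero_of_integral_contDiff_smul_eq_zero hloc fun φ h1 h2 h3 => ?_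
  · rw [EventuallyEq, ae_restrict_iff' hΩ.measurableSet]
    filter_upwards [key] with x hx hxΩ
    exact sub_eq_zero.1 (hx hxΩ)
  · have hφ : IsTestFunction Ω φ := ⟨h1, h2, h3⟩
    have h4 : ∫ x, φ x • (g - g') x = ∫ x in Ω, φ x • (g - g') x := by
      refine (setIntegral_eq_integral_of_forall_compl_eq_zero fun x hx => ?_).symm
      rw [image_eq_zero_of_notMem_tsupport fun hc => hx (h3 hc), zero_smul]
    rw [h4]
    simp only [Pi.sub_apply, smul_sub]
    rw [integral_sub (integrable_test_smul hφ hg) (integrable_test_smul hφ hg'),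
      ← neg_eq_iff_eq_neg.2 (h φ hφ), ← neg_eq_iff_eq_neg.2 (h' φ hφ),
      integral_congr_ae (g := fun x => f' x • ∇ φ x) (hf.mono fun x hx => by simp only [hx]),
      sub_self]

namespace H1

variable {Ω γ : Set (Euc d)}

theorem grad_ae_eq (hΩ : IsOpen Ω) {w w' : H1 Ω} (h : H1.fn w =ᵐ[volume.restrict Ω] H1.fn w') :
    H1.grad w =ᵐ[volume.restrict Ω] H1.grad w' :=
  (hasWeakGradient w).ae_eq hΩ (hasWeakGradient w') h (memLp_grad w) (memLp_grad w')

theorem ext_fn (hΩ : IsOpen Ω) {w w' : H1 Ω} (h : H1.fn w =ᵐ[volume.restrict Ω] H1.fn w') :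
    w = w' := by
  have h1 : fnL Ω w = fnL Ω w' := Lp.ext h
  have h2 : gradL Ω w = gradL Ω w' := Lp.ext (grad_ae_eq hΩ h)
  refine Subtype.ext (WithLp.ofLp_injective 2 (Prod.ext h1 h2))

/-- The element of `H¹` given by a square integrable function and its weak gradient. -/
theorem exists_of_hasWeakGradient {f : Euc d → ℝ} {g : Euc d → Euc d}
    (hf : MemLp f 2 (volume.restrict Ω)) (hg : MemLp g 2 (volume.restrict Ω))
    (h : HasWeakGradient Ω f g) :
    ∃ w : H1 Ω, H1.fn w =ᵐ[volume.restrict Ω] f ∧ H1.grad w =ᵐ[volume.restrict Ω] g :=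
  ⟨⟨WithLp.toLp 2 (hf.toLp, hg.toLp), h.congr hf.coeFn_toLp.symm hg.coeFn_toLp.symm⟩,
    hf.coeFn_toLp, hg.coeFn_toLp⟩

theorem isClosed (Ω : Set (Euc d)) : IsClosed (H1 Ω : Set
    (WithLp 2 (Lp ℝ 2 (volume.restrict Ω) × Lp (Euc d) 2 (volume.restrict Ω)))) := by
  have : (H1 Ω : Set (WithLp 2 (Lp ℝ 2 (volume.restrict Ω) × Lp (Euc d) 2 (volume.restrict Ω))))
      = ⋂ φ : {φ : Euc d → ℝ // IsTestFunction Ω φ}, {p | ∫ x in Ω, p.fst x • ∇ φ.1 x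
        = - ∫ x in Ω, φ.1 x • p.snd x} := by
    ext p
    simp only [mem_iInter, mem_ofPred_eq, Subtype.forall]
    rfl
  rw [this]
  refine isClosed_iInter fun ⟨φ, hφ⟩ => ?_
  have hg : MemLp (∇ φ) 2 (volume.restrict Ω) :=
    hφ.continuous_gradient.memLp_of_hasCompactSupport hφ.hasCompactSupport_gradient
  have hf : MemLp φ 2 (volume.restrict Ω) :=
    hφ.contDiff.continuous.memLp_of_hasCompactSupport hφ.hasCompactSupport
  let B : ℝ →L[ℝ] Euc d →L[ℝ] Euc d := ContinuousLinearMap.lsmul ℝ ℝ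
  have e1 : ∀ p : Lp ℝ 2 (volume.restrict Ω), ∫ x in Ω, p x • ∇ φ x
      = B.lpPairing (volume.restrict Ω) 2 2 p hg.toLp := by
    intro p
    rw [ContinuousLinearMap.lpPairing_eq_integral]
    refine integral_congr_ae (hg.coeFn_toLp.mono fun x hx => ?_)
    simp only [hx]
    rfl
  have e2 : ∀ p : Lp (Euc d) 2 (volume.restrict Ω), ∫ x in Ω, φ x • p x
      = B.lpPairing (volume.restrict Ω) 2 2 hf.toLp p := by
    intro p
    rw [ContinuousLinearMap.lpPairing_eq_integral]
    refine integral_congr_ae (hf.coeFn_toLp.mono fun x hx => ?_)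
    simp only [hx]
    rfl
  simp only [e1, e2]
  refine isClosed_eq ?_ ?_
  · exact ((B.lpPairing (volume.restrict Ω) 2 2).flip hg.toLp).continuous.comp
      (WithLp.fstL 2 ℝ _ _).continuous
  · exact ((B.lpPairing (volume.restrict Ω) 2 2 hf.toLp).continuous.comp
      (WithLp.sndL 2 ℝ _ _).continuous).neg

instance instCompleteSpace (Ω : Set (Euc d)) : CompleteSpace (H1 Ω) :=
  (H1.isClosed Ω).completeSpace_coe

theorem norm_sub_sq_eq (w w₀ : H1 Ω) :
    ‖w - w₀‖ ^ 2 = ‖fnL Ω w - fnL Ω w₀‖ ^ 2 + ‖gradL Ω w - gradL Ω w₀‖ ^ 2 := by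
  have e1 := map_sub (fnL Ω) w w₀
  have e2 := map_sub (gradL Ω) w w₀
  rw [← e1, ← e2]
  exact norm_sq_eq (w - w₀)

theorem norm_sub_le_add (w w₀ : H1 Ω) :
    ‖w - w₀‖ ≤ ‖fnL Ω w - fnL Ω w₀‖ + ‖gradL Ω w - gradL Ω w₀‖ := by
  refine abs_le_of_sq_le_sq' ?_ (by positivity) |>.2
  rw [norm_sub_sq_eq]
  nlinarith [norm_nonneg (fnL Ω w - fnL Ω w₀), norm_nonneg (gradL Ω w - gradL Ω w₀)]

theorem tendsto_iff_L {ι : Type*} {l : Filter ι} {w : ι → H1 Ω} {w₀ : H1 Ω} :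
    Tendsto w l (𝓝 w₀) ↔ Tendsto (fun i => fnL Ω (w i)) l (𝓝 (fnL Ω w₀)) ∧
      Tendsto (fun i => gradL Ω (w i)) l (𝓝 (gradL Ω w₀)) := by
  constructor
  · intro h
    exact ⟨((fnL Ω).continuous.tendsto w₀).comp h, ((gradL Ω).continuous.tendsto w₀).comp h⟩
  rintro ⟨h1, h2⟩
  rw [tendsto_iff_norm_sub_tendsto_zero] at h1 h2 ⊢
  have h3 := h1.add h2
  rw [add_zero] at h3
  exact squeeze_zero (fun i => norm_nonneg _) (fun i => norm_sub_le_add (w i) w₀) h3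

theorem tendsto_iff {ι : Type*} {l : Filter ι} {w : ι → H1 Ω} {w₀ : H1 Ω} :
    Tendsto w l (𝓝 w₀) ↔
      Tendsto (fun i => eLpNorm (H1.fn (w i) - H1.fn w₀) 2 (volume.restrict Ω)) l (𝓝 0) ∧
      Tendsto (fun i => eLpNorm (H1.grad (w i) - H1.grad w₀) 2 (volume.restrict Ω)) l (𝓝 0) :=
  tendsto_iff_L.trans (and_congr
    (Lp.tendsto_Lp_iff_tendsto_eLpNorm' (fi := l) (fun i => fnL Ω (w i)) (fnL Ω w₀))
    (Lp.tendsto_Lp_iff_tendsto_eLpNorm' (fi := l) (fun i => gradL Ω (w i)) (gradL Ω w₀)))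

/-- A closed subset of `H¹` contains the `L²`-limits of its elements whose gradients converge. -/
theorem exists_mem_of_tendsto {Z : Set (H1 Ω)} (hZ : IsClosed Z) {w : ℕ → H1 Ω}
    (hw : ∀ n, w n ∈ Z) {f : Euc d → ℝ} {g : Euc d → Euc d} (hf : MemLp f 2 (volume.restrict Ω))
    (hg : MemLp g 2 (volume.restrict Ω))
    (h1 : Tendsto (fun n => eLpNorm (H1.fn (w n) - f) 2 (volume.restrict Ω)) atTop (𝓝 0))
    (h2 : Tendsto (fun n => eLpNorm (H1.grad (w n) - g) 2 (volume.restrict Ω)) atTop (𝓝 0)) :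
    ∃ w' ∈ Z, H1.fn w' =ᵐ[volume.restrict Ω] f ∧ H1.grad w' =ᵐ[volume.restrict Ω] g := by
  have h1' : Tendsto (fun n => fnL Ω (w n)) atTop (𝓝 hf.toLp) := by
    rw [Lp.tendsto_Lp_iff_tendsto_eLpNorm']
    refine h1.congr fun n => eLpNorm_congr_ae ?_
    filter_upwards [hf.coeFn_toLp] with x hx
    simp [hx, coe_fnL]
  have h2' : Tendsto (fun n => gradL Ω (w n)) atTop (𝓝 hg.toLp) := by
    rw [Lp.tendsto_Lp_iff_tendsto_eLpNorm']
    refine h2.congr fun n => eLpNorm_congr_ae ?_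
    filter_upwards [hg.coeFn_toLp] with x hx
    simp [hx, coe_gradL]
  have h3 : Tendsto (fun n => (w n).1) atTop (𝓝 (WithLp.toLp 2 (hf.toLp, hg.toLp))) :=
    ((WithLp.prod_continuous_toLp 2 _ _).tendsto _).comp (h1'.prodMk_nhds h2')
  have h4 : WithLp.toLp 2 (hf.toLp, hg.toLp) ∈ H1 Ω :=
    (H1.isClosed Ω).mem_of_tendsto h3 (Eventually.of_forall fun n => (w n).2)
  refine ⟨⟨_, h4⟩, hZ.mem_of_tendsto (tendsto_subtype_rng.2 h3) (Eventually.of_forall hw), ?_, ?_⟩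
  · exact hf.coeFn_toLp
  · exact hg.coeFn_toLp

/-- The `φ ∈ C_c^∞(ℝ^d)` that vanish in a neighbourhood of `γ`, restricted to `Ω`. -/
def smoothVanishing (Ω γ : Set (Euc d)) : Submodule ℝ (H1 Ω) where
  carrier := {w : H1 Ω | ∃ φ : Euc d → ℝ, ContDiff ℝ ∞ φ ∧ HasCompactSupport φ ∧
    (∀ᶠ x in 𝓝ˢ γ, φ x = 0) ∧ H1.fn w =ᵐ[volume.restrict Ω] φ}
  zero_mem' := ⟨0, contDiff_const, HasCompactSupport.zero, Eventually.of_forall fun _ => rfl,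
    Lp.coeFn_zero ℝ 2 (volume.restrict Ω)⟩
  add_mem' := by
    rintro w w' ⟨φ, h1, h2, h3, h4⟩ ⟨φ', h1', h2', h3', h4'⟩
    refine ⟨φ + φ', h1.add h1', h2.add h2', ?_, (fn_add w w').trans (h4.add h4')⟩
    filter_upwards [h3, h3'] with x hx hx'
    rw [Pi.add_apply, hx, hx', add_zero]
  smul_mem' := by
    rintro c w ⟨φ, h1, h2, h3, h4⟩
    refine ⟨c • φ, contDiff_const.smul h1, h2.smul_left (f := fun _ => c), ?_,
      (fn_smul c w).trans (h4.const_smul c)⟩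
    filter_upwards [h3] with x hx
    rw [Pi.smul_apply, hx, smul_zero]

/-- The space `H1.vanishingOn` as a closed subspace of `H¹`. -/
def V (Ω γ : Set (Euc d)) : Submodule ℝ (H1 Ω) := (smoothVanishing Ω γ).topologicalClosure

theorem isClosed_V (Ω γ : Set (Euc d)) : IsClosed (V Ω γ : Set (H1 Ω)) :=
  Submodule.isClosed_topologicalClosure _

instance instCompleteSpaceV (Ω γ : Set (Euc d)) : CompleteSpace (V Ω γ) :=
  (isClosed_V Ω γ).completeSpace_coe

end H1

/-! ### Lipschitz functions belong to `H¹` -/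

theorem measurable_gradient (f : Euc d → ℝ) : Measurable (∇ f) :=
  (InnerProductSpace.toDual ℝ (Euc d)).symm.continuous.measurable.comp (measurable_fderiv ℝ f)

theorem norm_gradient (f : Euc d → ℝ) (x : Euc d) : ‖∇ f x‖ = ‖fderiv ℝ f x‖ :=
  (InnerProductSpace.toDual ℝ (Euc d)).symm.norm_map _

theorem LipschitzWith.norm_gradient_le {f : Euc d → ℝ} {K : ℝ≥0} (hf : LipschitzWith K f)
    (x : Euc d) : ‖∇ f x‖ ≤ K := by
  rw [norm_gradient]
  exact norm_fderiv_le_of_lipschitz ℝ hf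

theorem integral_inner_const {α : Type*} [MeasurableSpace α] {μ : Measure α} {f : α → Euc d}
    (hf : Integrable f μ) (v : Euc d) : ∫ x, inner ℝ (f x) v ∂μ = inner ℝ (∫ x, f x ∂μ) v := by
  rw [real_inner_comm, ← integral_inner hf]
  simp only [real_inner_comm]

/-- Integration by parts for Lipschitz functions, one of which has compact support. -/
theorem LipschitzWith.integral_gradient_inner {f g : Euc d → ℝ} {K K' : ℝ≥0}
    (hf : LipschitzWith K f) (hg : LipschitzWith K' g) (hc : HasCompactSupport g) (v : Euc d) :
    ∫ x, inner ℝ (∇ f x) v * g x = - ∫ x, inner ℝ (∇ g x) v * f x := by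
  have h1 := hf.integral_lineDeriv_mul_eq hg hc (μ := volume) v
  have hd : ∀ {f : Euc d → ℝ} {K : ℝ≥0}, LipschitzWith K f →
      ∀ᵐ x, ∀ v, lineDeriv ℝ f x v = inner ℝ (∇ f x) v := by
    intro f K hf
    filter_upwards [hf.ae_differentiableAt (μ := volume)] with x hx v
    rw [hx.lineDeriv_eq_fderiv, inner_gradient_left]
  rw [← integral_neg]
  refine Eq.trans (integral_congr_ae ?_) (h1.trans (integral_congr_ae ?_))
  · filter_upwards [hd hf] with x hx
    rw [hx]
  · filter_upwards [hd hg] with x hx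
    rw [hx, inner_neg_right]
    ring

theorem IsTestFunction.exists_lipschitzWith {Ω : Set (Euc d)} {φ : Euc d → ℝ}
    (h : IsTestFunction Ω φ) : ∃ K, LipschitzWith K φ :=
  h.contDiff.lipschitzWith_of_hasCompactSupport h.hasCompactSupport (by simp)

theorem LipschitzWith.hasWeakGradient {Ω : Set (Euc d)} {f : Euc d → ℝ}
    {K : ℝ≥0} (hf : LipschitzWith K f) : HasWeakGradient Ω f (∇ f) := by
  intro φ hφ
  obtain ⟨K', hK'⟩ := hφ.exists_lipschitzWith
  have h0 : ∀ x ∉ Ω, φ x = 0 := fun x hx =>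
    image_eq_zero_of_notMem_tsupport fun hc => hx (hφ.tsupport_subset hc)
  have h0' : ∀ x ∉ Ω, ∇ φ x = 0 := fun x hx => by
    have : fderiv ℝ φ x = 0 :=
      image_eq_zero_of_notMem_tsupport fun hc =>
        hx (hφ.tsupport_subset (tsupport_fderiv_subset ℝ hc))
    rw [gradient, this, map_zero]
  rw [setIntegral_eq_integral_of_forall_compl_eq_zero fun x hx => by rw [h0' x hx, smul_zero],
    setIntegral_eq_integral_of_forall_compl_eq_zero fun x hx => by rw [h0 x hx, zero_smul]]
  have hi1 : Integrable (fun x => f x • ∇ φ x) :=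
    (hf.continuous.smul hφ.continuous_gradient).integrable_of_hasCompactSupport
      (hφ.hasCompactSupport_gradient.smul_left)
  have hi2 : Integrable (fun x => φ x • ∇ f x) := by
    refine (hφ.contDiff.continuous.integrable_of_hasCompactSupport hφ.hasCompactSupport).smul_bdd
      (C := K) ?_ ?_
    · exact (measurable_gradient f).aestronglyMeasurable
    · exact ae_of_all _ fun x => hf.norm_gradient_le x
  refine ext_inner_right ℝ fun v => ?_
  rw [inner_neg_left, ← integral_inner_const hi1, ← integral_inner_const hi2]
  have := hf.integral_gradient_inner hK' hφ.hasCompactSupport v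
  simp only [real_inner_smul_left]
  simp only [mul_comm (f _), mul_comm (φ _)]
  rw [this, neg_neg]

theorem isFiniteMeasure_restrict_of_isBounded {Ω : Set (Euc d)} (hb : Bornology.IsBounded Ω) :
    IsFiniteMeasure (volume.restrict Ω) :=
  ⟨by rw [Measure.restrict_apply_univ]; exact hb.measure_lt_top⟩

theorem gradient_congr_of_isOpen {Ω : Set (Euc d)} (hΩ : IsOpen Ω) {f g : Euc d → ℝ}
    (h : EqOn f g Ω) {x : Euc d} (hx : x ∈ Ω) : ∇ f x = ∇ g x := by
  have : f =ᶠ[𝓝 x] g := by filter_upwards [hΩ.mem_nhds hx] with z hz using h hz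
  rw [gradient, gradient, this.fderiv_eq]

theorem H1.exists_of_lipschitzOnWith {Ω : Set (Euc d)} (hΩ : IsOpen Ω)
    (hb : Bornology.IsBounded Ω) {f : Euc d → ℝ} {K : ℝ≥0} (hf : LipschitzOnWith K f Ω) :
    ∃ w : H1 Ω, H1.fn w =ᵐ[volume.restrict Ω] f ∧ H1.grad w =ᵐ[volume.restrict Ω] ∇ f := by
  have := isFiniteMeasure_restrict_of_isBounded hb
  obtain ⟨g, hg, hgf⟩ := hf.extend_real
  obtain ⟨C, hC⟩ := hb.isCompact_closure.exists_bound_of_continuousOn hg.continuous.continuousOn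
  have hm : ∀ᵐ x ∂(volume.restrict Ω), x ∈ Ω := ae_restrict_mem hΩ.measurableSet
  obtain ⟨w, h1, h2⟩ := H1.exists_of_hasWeakGradient (Ω := Ω) (f := g) (g := ∇ g)
    (MemLp.of_bound hg.continuous.aestronglyMeasurable C
      (hm.mono fun x hx => hC x (subset_closure hx)))
    (MemLp.of_bound (measurable_gradient g).aestronglyMeasurable K
      (ae_of_all _ hg.norm_gradient_le)) hg.hasWeakGradient
  refine ⟨w, h1.trans ?_, h2.trans ?_⟩
  · filter_upwards [hm] with x hx using (hgf hx).symm
  · filter_upwards [hm] with x hx using (gradient_congr_of_isOpen hΩ hgf hx).symm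

theorem H1.grad_ae_eq_gradient {Ω : Set (Euc d)} (hΩ : IsOpen Ω) (hb : Bornology.IsBounded Ω)
    {f : Euc d → ℝ} {K : ℝ≥0} (hf : LipschitzOnWith K f Ω) {w : H1 Ω}
    (hw : H1.fn w =ᵐ[volume.restrict Ω] f) : H1.grad w =ᵐ[volume.restrict Ω] ∇ f := by
  obtain ⟨w', h1, h2⟩ := H1.exists_of_lipschitzOnWith hΩ hb hf
  exact (H1.grad_ae_eq hΩ (hw.trans h1.symm)).trans h2

/-! ### Mollification -/

section Mollification

open scoped Convolution

/-- The convolution of a bump function with `f`. -/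
def mollify (ρ : ContDiffBump (0 : Euc d)) (f : Euc d → ℝ) : Euc d → ℝ :=
  ρ.normed volume ⋆[ContinuousLinearMap.lsmul ℝ ℝ, volume] f

theorem mollify_apply (ρ : ContDiffBump (0 : Euc d)) (f : Euc d → ℝ) (x : Euc d) :
    mollify ρ f x = ∫ z, ρ.normed volume z * f (x - z) := rfl

variable {ρ : ContDiffBump (0 : Euc d)} {f : Euc d → ℝ} {K : ℝ≥0}

theorem contDiff_mollify (hf : Continuous f) : ContDiff ℝ ∞ (mollify ρ f) :=
  ρ.hasCompactSupport_normed.contDiff_convolution_left (ContinuousLinearMap.lsmul ℝ ℝ)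
    ρ.contDiff_normed hf.locallyIntegrable

theorem lipschitzWith_mollify (hf : LipschitzWith K f) : LipschitzWith K (mollify ρ f) := by
  refine LipschitzWith.of_dist_le_mul fun x x' => ?_
  have hi : ∀ x, Integrable (fun z => ρ.normed volume z * f (x - z)) := fun x => by
    have := hf.continuous
    have h2 := ρ.continuous_normed (μ := volume)
    exact Continuous.integrable_of_hasCompactSupport (by fun_prop)
      (ρ.hasCompactSupport_normed.mul_right)
  rw [dist_eq_norm, mollify_apply, mollify_apply, ← integral_sub (hi x) (hi x')]
  calc _ ≤ ∫ z, ρ.normed volume z * (K * dist x x') := by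
        refine norm_integral_le_of_norm_le ?_ (ae_of_all _ fun z => ?_)
        · exact ((ρ.continuous_normed (μ := volume)).integrable_of_hasCompactSupport
            ρ.hasCompactSupport_normed).mul_const _
        · rw [← mul_sub, norm_mul, Real.norm_of_nonneg (ρ.nonneg_normed z)]
          refine mul_le_mul_of_nonneg_left ?_ (ρ.nonneg_normed z)
          rw [← dist_eq_norm]
          refine (hf.dist_le_mul _ _).trans (le_of_eq ?_)
          rw [dist_sub_right]
    _ = K * dist x x' := by
        rw [integral_mul_const, ρ.integral_normed, one_mul]

theorem dist_mollify_le (hf : LipschitzWith K f) (x : Euc d) :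
    dist (mollify ρ f x) (f x) ≤ K * ρ.rOut := by
  refine ρ.dist_normed_convolution_le hf.continuous.aestronglyMeasurable fun z hz => ?_
  refine (hf.dist_le_mul z x).trans ?_
  gcongr
  exact (Metric.mem_ball.1 hz).le

theorem mollify_eq_zero {x : Euc d} (h : ∀ z ∈ Metric.ball x ρ.rOut, f z = 0) :
    mollify ρ f x = 0 := by
  rw [mollify_apply]
  refine integral_eq_zero_of_ae (ae_of_all _ fun z => ?_)
  by_cases hz : z ∈ Metric.ball (0 : Euc d) ρ.rOut
  · have h1 := h (x - z) (by simpa [dist_eq_norm] using hz)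
    simp [h1]
  · have : z ∉ Function.support (ρ.normed volume) := by rwa [ρ.support_normed_eq]
    simp [Function.notMem_support.1 this]

theorem lipschitzWith_normed (ρ : ContDiffBump (0 : Euc d)) :
    ∃ K, LipschitzWith K (ρ.normed volume) :=
  (ρ.contDiff_normed (n := 1)).lipschitzWith_of_hasCompactSupport ρ.hasCompactSupport_normed
    (by simp)

/-- The gradient commutes with mollification. -/
theorem gradient_mollify (hf : LipschitzWith K f) (x : Euc d) :
    ∇ (mollify ρ f) x
      = (ρ.normed volume ⋆[ContinuousLinearMap.lsmul ℝ ℝ, volume] (∇ f)) x := by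
  obtain ⟨K', hK'⟩ := lipschitzWith_normed ρ
  have hfx : LipschitzWith K (fun z => f (x - z)) := by
    refine LipschitzWith.of_dist_le_mul fun z z' => (hf.dist_le_mul _ _).trans (le_of_eq ?_)
    rw [dist_sub_left]
  have hint : Integrable (fun z => ρ.normed volume z • ∇ f (x - z)) := by
    refine ((ρ.continuous_normed (μ := volume)).integrable_of_hasCompactSupport
      ρ.hasCompactSupport_normed).smul_bdd (C := K) ?_ ?_
    · exact ((measurable_gradient f).comp (measurable_const.sub measurable_id)).aestronglyMeasurable
    · exact ae_of_all _ fun z => hf.norm_gradient_le _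
  have hfd := (ρ.hasCompactSupport_normed (μ := volume)).hasFDerivAt_convolution_left
    (ContinuousLinearMap.lsmul ℝ ℝ) (ρ.contDiff_normed (n := 1)) (g := f) (μ := volume)
    hf.continuous.locallyIntegrable x
  refine ext_inner_right ℝ fun v => ?_
  rw [inner_gradient_left, show fderiv ℝ (mollify ρ f) x = _ from hfd.fderiv]
  have hint2 : Integrable (fun z => (ContinuousLinearMap.precompL (Euc d)
      (ContinuousLinearMap.lsmul ℝ ℝ) (fderiv ℝ (ρ.normed volume) z) : ℝ →L[ℝ] (Euc d →L[ℝ] ℝ))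
      (f (x - z))) :=
    ((ρ.hasCompactSupport_normed (μ := volume)).fderiv ℝ).convolutionExists_left _
      ((ρ.contDiff_normed (n := 1)).continuous_fderiv one_ne_zero) hf.continuous.locallyIntegrable x
  rw [convolution_def, ContinuousLinearMap.integral_apply hint2]
  change _ = inner ℝ (∫ z, ρ.normed volume z • ∇ f (x - z)) v
  rw [← integral_inner_const hint]
  -- integration by parts moves the derivative from the bump function to `f`
  have h1 := hfx.integral_gradient_inner hK' ρ.hasCompactSupport_normed v
  have h2 : ∀ z, ∇ (fun z => f (x - z)) z = - ∇ f (x - z) := by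
    intro z
    have h3 : fderiv ℝ ((fun w => f (x + w)) ∘ LinearIsometryEquiv.neg ℝ) z
        = (fderiv ℝ (fun w => f (x + w)) (-z)).comp
          ((LinearIsometryEquiv.neg ℝ : Euc d ≃ₗᵢ[ℝ] Euc d) : Euc d →L[ℝ] Euc d) :=
      (LinearIsometryEquiv.neg ℝ : Euc d ≃ₗᵢ[ℝ] Euc d).toContinuousLinearEquiv.comp_right_fderiv
    have h4 : ((fun w => f (x + w)) ∘ LinearIsometryEquiv.neg ℝ) = fun z => f (x - z) := by
      ext w
      simp [sub_eq_add_neg]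
    rw [h4, fderiv_comp_add_left, ← sub_eq_add_neg] at h3
    rw [gradient, gradient, h3, ← map_neg]
    congr 1
    ext v
    simp
  simp only [h2, inner_neg_left, neg_mul, integral_neg, neg_inj, inner_gradient_left] at h1
  simp only [real_inner_smul_left, inner_gradient_left]
  refine Eq.trans ?_ (h1.symm.trans ?_)
  · refine integral_congr_ae (ae_of_all _ fun z => ?_)
    simp [ContinuousLinearMap.precompL_apply]
  · refine integral_congr_ae (ae_of_all _ fun z => ?_)
    simp only
    ring

/-- A bump function of radius `δ / (n + 1)`. -/
def bumpSeq (d : ℕ) {δ : ℝ} (hδ : 0 < δ) (n : ℕ) : ContDiffBump (0 : Euc d) where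
  rIn := δ / (n + 1) / 2
  rOut := δ / (n + 1)
  rIn_pos := by positivity
  rIn_lt_rOut := half_lt_self (by positivity)

theorem tendsto_bumpSeq {δ : ℝ} (hδ : 0 < δ) :
    Tendsto (fun n => (bumpSeq d hδ n).rOut) atTop (𝓝 0) := by
  have := (tendsto_one_div_add_atTop_nhds_zero_nat (𝕜 := ℝ)).const_mul δ
  rw [mul_zero] at this
  refine this.congr fun n => ?_
  simp only [bumpSeq]
  ring

end Mollification

theorem exists_cutoff (s : Set (Euc d)) (hs : Bornology.IsBounded s) :
    ∃ χ : Euc d → ℝ, ContDiff ℝ ∞ χ ∧ HasCompactSupport χ ∧ ∃ U, IsOpen U ∧ s ⊆ U ∧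
      ∀ x ∈ U, χ x = 1 := by
  obtain ⟨R, hR⟩ := hs.subset_ball 0
  let χ : ContDiffBump (0 : Euc d) := ⟨max R 1, max R 1 + 1, by positivity, by linarith⟩
  refine ⟨χ, χ.contDiff, χ.hasCompactSupport, Metric.ball 0 R, Metric.isOpen_ball, hR,
    fun x hx => ?_⟩
  exact χ.one_of_mem_closedBall (Metric.mem_closedBall.2
    ((Metric.mem_ball.1 hx).le.trans (le_max_left _ _)))

/-- A Lipschitz function that vanishes near the compact set `γ` is approximated in `H¹` by its
mollifications, which are smooth and vanish near `γ`. -/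
theorem LipschitzWith.mem_vanishingOn {Ω γ : Set (Euc d)} (hΩ : IsOpen Ω)
    (hb : Bornology.IsBounded Ω) (hγ : IsCompact γ) {ψ : Euc d → ℝ} {K : ℝ≥0}
    (hψ : LipschitzWith K ψ) (hψγ : ∀ᶠ x in 𝓝ˢ γ, ψ x = 0) {w : H1 Ω}
    (hw : H1.fn w =ᵐ[volume.restrict Ω] ψ) : w ∈ H1.vanishingOn Ω γ := by
  have := isFiniteMeasure_restrict_of_isBounded hb
  obtain ⟨U, hU, hγU, hUψ⟩ := mem_nhdsSet_iff_exists.1 hψγ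
  obtain ⟨δ, hδ, hδU⟩ := hγ.exists_thickening_subset_open hU hγU
  have hδ2 : 0 < δ / 2 := half_pos hδ
  -- a cutoff function equal to `1` on `Ω` makes the supports of the approximations compact
  obtain ⟨χ, hχ, hχc, W, hW, hΩW, hχW⟩ := exists_cutoff Ω hb
  set ρ := bumpSeq d hδ2 with hρ
  have hρδ : ∀ n, (ρ n).rOut ≤ δ / 2 := fun n => by
    simp only [hρ, bumpSeq]
    exact div_le_self hδ2.le (by linarith [(Nat.cast_nonneg n : (0 : ℝ) ≤ n)])
  have hex : ∀ n, ∃ w' : H1 Ω, H1.fn w' =ᵐ[volume.restrict Ω] mollify (ρ n) ψ ∧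
      H1.grad w' =ᵐ[volume.restrict Ω] ∇ (mollify (ρ n) ψ) := fun n =>
    H1.exists_of_lipschitzOnWith hΩ hb ((lipschitzWith_mollify hψ).lipschitzOnWith)
  choose w' hw1 hw2 using hex
  have hmem : ∀ n, w' n ∈ H1.vanishingOn Ω γ := by
    intro n
    refine subset_closure ⟨fun x => χ x * mollify (ρ n) ψ x,
      hχ.mul (contDiff_mollify hψ.continuous),
      hχc.mul_right, ?_, ?_⟩
    · rw [eventually_nhdsSet_iff_exists]
      refine ⟨Metric.thickening (δ / 2) γ, Metric.isOpen_thickening,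
        Metric.self_subset_thickening hδ2 γ, fun x hx => ?_⟩
      change χ x * mollify (ρ n) ψ x = 0
      rw [mollify_eq_zero, mul_zero]
      intro z hz
      refine hUψ (hδU ?_)
      obtain ⟨p, hp, hpx⟩ := Metric.mem_thickening_iff.1 hx
      refine Metric.mem_thickening_iff.2 ⟨p, hp, ?_⟩
      have h1 := Metric.mem_ball.1 hz
      linarith [dist_triangle z x p, hρδ n]
    · refine (hw1 n).trans ?_
      filter_upwards [ae_restrict_mem hΩ.measurableSet] with x hx
      rw [hχW x (hΩW hx), one_mul]
  have hgrad : H1.grad w =ᵐ[volume.restrict Ω] ∇ ψ :=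
    H1.grad_ae_eq_gradient hΩ hb hψ.lipschitzOnWith hw
  -- functions and gradients converge pointwise and are bounded, so dominated convergence applies
  have hlim : Tendsto w' atTop (𝓝 w) := by
    rw [H1.tendsto_iff]
    constructor
    · refine tendsto_eLpNorm_of_bounded (C := K * (δ / 2)) (Eventually.of_forall fun n =>
        ((H1.memLp_fn (w' n)).sub (H1.memLp_fn w)).1) (Eventually.of_forall fun n => ?_) ?_
      · filter_upwards [hw1 n, hw] with x h1 h2
        rw [Pi.sub_apply, h1, h2, ← dist_eq_norm]
        refine (dist_mollify_le hψ x).trans ?_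
        gcongr
        exact hρδ n
      · filter_upwards [ae_all_iff.2 hw1, hw] with x h1 h2
        have h3 := (tendsto_bumpSeq (d := d) hδ2).const_mul (K : ℝ)
        rw [mul_zero] at h3
        refine squeeze_zero_norm (fun n => ?_) h3
        rw [Pi.sub_apply, h1, h2, ← dist_eq_norm]
        exact dist_mollify_le hψ x
    · refine tendsto_eLpNorm_of_bounded (C := K + K) (Eventually.of_forall fun n =>
        ((H1.memLp_grad (w' n)).sub (H1.memLp_grad w)).1) (Eventually.of_forall fun n => ?_) ?_
      · filter_upwards [hw2 n, hgrad] with x h1 h2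
        rw [Pi.sub_apply, h1, h2]
        exact (_root_.norm_sub_le _ _).trans (add_le_add
          ((lipschitzWith_mollify hψ).norm_gradient_le x)
          (hψ.norm_gradient_le x))
      · have hloc : LocallyIntegrable (∇ ψ) (volume : Measure (Euc d)) := by
          have h1 : MemLp (∇ ψ) ∞ (volume : Measure (Euc d)) :=
            memLp_top_of_bound (measurable_gradient ψ).aestronglyMeasurable K
              (ae_of_all _ hψ.norm_gradient_le)
          exact h1.locallyIntegrable le_top
        have h1 := ContDiffBump.ae_convolution_tendsto_right_of_locallyIntegrable
          (tendsto_bumpSeq (d := d) hδ2) (K := 2)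
          (Eventually.of_forall fun n => by simp only [bumpSeq]; linarith) hloc
        filter_upwards [ae_restrict_of_ae h1, ae_all_iff.2 hw2, hgrad] with x h2 h3 h4
        rw [← tendsto_sub_nhds_zero_iff] at h2
        refine h2.congr fun n => ?_
        rw [Pi.sub_apply, h3, h4, gradient_mollify hψ]
  exact isClosed_closure.mem_of_tendsto hlim (Eventually.of_forall hmem)

/-! ### Bi-Lipschitz changes of variables -/

/-- A bi-Lipschitz map of the closure of the bounded open set `Ω` that maps `Ω` onto an open set. -/
structure IsBiLip (Ω : Set (Euc d)) (T : Euc d → Euc d) : Prop where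
  isOpen : IsOpen Ω
  isBounded : Bornology.IsBounded Ω
  lipschitz : ∃ K : ℝ≥0, LipschitzOnWith K T (closure Ω)
  antilipschitz : ∃ c : ℝ, 0 < c ∧
    ∀ x ∈ closure Ω, ∀ x' ∈ closure Ω, c * dist x x' ≤ dist (T x) (T x')
  isOpen_image : IsOpen (T '' Ω)

theorem IsDeformation.isBiLip {Ω : Set (Euc d)} {ε : ℝ} {T : ℝ → Euc d → Euc d}
    (hT : IsDeformation Ω ε T) (hΩ : IsOpen Ω) (hb : Bornology.IsBounded Ω) {t : ℝ}
    (ht : t ∈ Ioo (-ε) ε) : IsBiLip Ω (T t) :=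
  ⟨hΩ, hb, hT.lipschitz t ht, hT.antilipschitz t ht, hT.isOpen_image t ht⟩

/-- Lipschitz maps send null sets to null sets. -/
theorem LipschitzOnWith.volume_image_eq_zero {f : Euc d → Euc d} {s : Set (Euc d)} {K : ℝ≥0}
    (hf : LipschitzOnWith K f s) (hs : volume s = 0) : volume (f '' s) = 0 := by
  have h1 : (volume : Measure (Euc d)) ≪ μH[(Module.finrank ℝ (Euc d) : ℝ)] :=
    Measure.absolutelyContinuous_isAddHaarMeasure _ _
  have h2 : μH[(Module.finrank ℝ (Euc d) : ℝ)] ≪ (volume : Measure (Euc d)) :=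
    Measure.absolutelyContinuous_isAddHaarMeasure _ _
  refine h1 (le_antisymm ?_ zero_le)
  refine (hf.hausdorffMeasure_image_le (Nat.cast_nonneg _)).trans (le_of_eq ?_)
  rw [h2 hs, mul_zero]

namespace IsBiLip

variable {Ω γ : Set (Euc d)} {T : Euc d → Euc d}

theorem continuousOn (h : IsBiLip Ω T) : ContinuousOn T (closure Ω) := by
  obtain ⟨K, hK⟩ := h.lipschitz
  exact hK.continuousOn

theorem injOn (h : IsBiLip Ω T) : InjOn T (closure Ω) := by
  obtain ⟨c, hc, hanti⟩ := h.antilipschitz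
  intro x hx x' hx' he
  have := hanti x hx x' hx'
  rw [he, dist_self] at this
  rw [← dist_le_zero]
  exact nonpos_of_mul_nonpos_right this hc

theorem ae_differentiableAt (h : IsBiLip Ω T) :
    ∀ᵐ x ∂(volume.restrict Ω), DifferentiableAt ℝ T x := by
  obtain ⟨K, hK⟩ := h.lipschitz
  exact (hK.mono subset_closure).ae_differentiableAt_of_isOpen h.isOpen

theorem closure_image (h : IsBiLip Ω T) : closure (T '' Ω) = T '' closure Ω :=
  (frontier_image_eq h.isOpen h.isBounded h.continuousOn h.injOn h.isOpen_image).1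

theorem frontier_image (h : IsBiLip Ω T) : frontier (T '' Ω) = T '' frontier Ω :=
  (frontier_image_eq h.isOpen h.isBounded h.continuousOn h.injOn h.isOpen_image).2

theorem isBounded_image (h : IsBiLip Ω T) : Bornology.IsBounded (T '' Ω) :=
  (h.isBounded.isCompact_closure.image_of_continuousOn h.continuousOn).isBounded.subset
    (image_mono subset_closure)

theorem aemeasurable (h : IsBiLip Ω T) : AEMeasurable T (volume.restrict Ω) :=
  (h.continuousOn.mono subset_closure).aemeasurable h.isOpen.measurableSet

/-- The Jacobian matrix and its determinant are bounded from above and below. -/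
theorem exists_det_bounds (h : IsBiLip Ω T) : ∃ K c κ κ', 0 < c ∧ 0 < κ ∧
    ∀ᵐ x ∂(volume.restrict Ω), DifferentiableAt ℝ T x ∧ ‖fderiv ℝ T x‖ ≤ K ∧
      (∀ v, c * ‖v‖ ≤ ‖fderiv ℝ T x v‖) ∧ κ ≤ |(fderiv ℝ T x).det| ∧
      |(fderiv ℝ T x).det| ≤ κ' := by
  obtain ⟨K, hK⟩ := h.lipschitz
  obtain ⟨c, hc, hanti⟩ := h.antilipschitz
  have hcont : ContinuousOn (fun q : Euc d × (Euc d →L[ℝ] Euc d) => |q.2.det|)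
      (boundedPairs d K c) :=
    (ContinuousLinearMap.continuous_det.comp continuous_snd).abs.continuousOn
  obtain ⟨κ', hκ'⟩ := (isCompact_boundedPairs d K c).exists_bound_of_continuousOn hcont
  obtain ⟨κ, hκ, hκb⟩ := exists_pos_le_abs_det (d := d) K hc
  refine ⟨K, c, κ, κ', hc, hκ, ?_⟩
  filter_upwards [h.ae_differentiableAt, (hK.mono subset_closure).ae_norm_fderiv_le h.isOpen,
    ae_restrict_mem h.isOpen.measurableSet] with x h1 h2 h3
  have h4 : ∀ v, c * ‖v‖ ≤ ‖fderiv ℝ T x v‖ := le_norm_fderiv_apply h.isOpen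
    (fun x hx x' hx' => hanti x (subset_closure hx) x' (subset_closure hx')) h3 h1
  have hq : ((0 : Euc d), fderiv ℝ T x) ∈ boundedPairs d K c :=
    ⟨by simp, h2, h4⟩
  refine ⟨h1, h2, h4, hκb _ hq, ?_⟩
  have := hκ' _ hq
  rwa [Real.norm_eq_abs, abs_abs] at this

/-- Up to a null set, whose image is again a null set, `T` is differentiable at every point of `Ω`.
-/
theorem exists_good_set (h : IsBiLip Ω T) : ∃ s, MeasurableSet s ∧ s ⊆ Ω ∧
    (∀ x ∈ s, HasFDerivWithinAt T (fderiv ℝ T x) s x) ∧ InjOn T s ∧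
    volume.restrict s = volume.restrict Ω ∧
    volume.restrict (T '' s) = volume.restrict (T '' Ω) := by
  obtain ⟨K, hK⟩ := h.lipschitz
  have h1 := h.ae_differentiableAt
  rw [ae_restrict_iff' h.isOpen.measurableSet] at h1
  obtain ⟨N, hPN, hN, hN0⟩ := exists_measurable_superset_of_null (ae_iff.1 h1)
  have hs : ∀ x ∈ Ω \ N, DifferentiableAt ℝ T x := by
    intro x hx
    by_contra hc
    exact hx.2 (hPN (fun hcc => hc (hcc hx.1)))
  refine ⟨Ω \ N, h.isOpen.measurableSet.diff hN, sdiff_subset,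
    fun x hx => (hs x hx).hasFDerivAt.hasFDerivWithinAt, h.injOn.mono
      (sdiff_subset.trans subset_closure), ?_, ?_⟩
  · exact Measure.restrict_congr_set (sdiff_null_ae_eq_self hN0)
  · refine Measure.restrict_congr_set ?_
    have h2 : volume (T '' (Ω ∩ N)) = 0 :=
      (hK.mono (inter_subset_left.trans subset_closure)).volume_image_eq_zero
        (measure_mono_null inter_subset_right hN0)
    refine (ae_le_set.2 ?_).antisymm (ae_le_set.2 ?_)
    · rw [sdiff_eq_empty.2 (image_mono sdiff_subset), measure_empty]
    · refine measure_mono_null ?_ h2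
      rintro _ ⟨⟨x, hx, rfl⟩, hx2⟩
      refine ⟨x, ⟨hx, ?_⟩, rfl⟩
      by_contra hc
      exact hx2 ⟨x, ⟨hx, hc⟩, rfl⟩

theorem lintegral_image (h : IsBiLip Ω T) (g : Euc d → ℝ≥0∞) :
    ∫⁻ x in T '' Ω, g x = ∫⁻ x in Ω, ENNReal.ofReal |(fderiv ℝ T x).det| * g (T x) := by
  obtain ⟨s, hs, -, hd, hinj, e1, e2⟩ := h.exists_good_set
  rw [← e1, ← e2]
  exact lintegral_image_eq_lintegral_abs_det_fderiv_mul volume hs hd hinj g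

/-- The change of variables formula. -/
theorem integral_image (h : IsBiLip Ω T) (g : Euc d → ℝ) :
    ∫ x in T '' Ω, g x = ∫ x in Ω, |(fderiv ℝ T x).det| * g (T x) := by
  obtain ⟨s, hs, -, hd, hinj, e1, e2⟩ := h.exists_good_set
  rw [← e1, ← e2]
  exact integral_image_eq_integral_abs_det_fderiv_smul volume hs hd hinj g

/-- The image of Lebesgue measure under `T` has a bounded density, as the Jacobian determinant is
bounded away from `0`. -/
theorem exists_map_le (h : IsBiLip Ω T) : ∃ C : ℝ≥0∞, C ≠ ⊤ ∧
    Measure.map T (volume.restrict Ω) ≤ C • volume.restrict (T '' Ω) := by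
  obtain ⟨K, c, κ, κ', -, hκ, hae⟩ := h.exists_det_bounds
  refine ⟨ENNReal.ofReal κ⁻¹, ENNReal.ofReal_ne_top, Measure.le_iff.2 fun s hs => ?_⟩
  rw [Measure.map_apply_of_aemeasurable h.aemeasurable hs, Measure.smul_apply, smul_eq_mul,
    ← lintegral_indicator_one hs, h.lintegral_image,
    ← lintegral_const_mul' _ _ ENNReal.ofReal_ne_top]
  have hpre : NullMeasurableSet (T ⁻¹' s) (volume.restrict Ω) := h.aemeasurable.nullMeasurable hs
  rw [← lintegral_indicator_one₀ hpre]
  refine lintegral_mono_ae ?_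
  filter_upwards [hae] with x hx
  by_cases hxs : T x ∈ s
  · have hx' : x ∈ T ⁻¹' s := hxs
    rw [indicator_of_mem hx', indicator_of_mem hxs, Pi.one_apply, Pi.one_apply, mul_one,
      ← ENNReal.ofReal_mul (by positivity), ← ENNReal.ofReal_one]
    refine ENNReal.ofReal_le_ofReal ?_
    rw [le_inv_mul_iff₀ hκ, mul_one]
    exact hx.2.2.2.1
  · have hx' : x ∉ T ⁻¹' s := hxs
    rw [indicator_of_notMem hx']
    exact zero_le

theorem map_absolutelyContinuous (h : IsBiLip Ω T) :
    Measure.map T (volume.restrict Ω) ≪ volume.restrict (T '' Ω) := by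
  obtain ⟨C, -, hle⟩ := h.exists_map_le
  exact (Measure.absolutelyContinuous_of_le hle).trans (Measure.smul_absolutelyContinuous)

theorem ae_comp (h : IsBiLip Ω T) {p : Euc d → Prop} (hp : ∀ᵐ y ∂(volume.restrict (T '' Ω)), p y) :
    ∀ᵐ x ∂(volume.restrict Ω), p (T x) :=
  ae_of_ae_map h.aemeasurable (h.map_absolutelyContinuous hp)

theorem exists_eLpNorm_comp_le (h : IsBiLip Ω T) : ∃ C : ℝ≥0∞, C ≠ ⊤ ∧
    ∀ {F : Type} [NormedAddCommGroup F] (f : Euc d → F),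
      AEStronglyMeasurable f (volume.restrict (T '' Ω)) →
      AEStronglyMeasurable (fun x => f (T x)) (volume.restrict Ω) ∧
      eLpNorm (fun x => f (T x)) 2 (volume.restrict Ω)
        ≤ C * eLpNorm f 2 (volume.restrict (T '' Ω)) := by
  obtain ⟨C, hC, hle⟩ := h.exists_map_le
  refine ⟨C ^ (1 / 2 : ℝ≥0∞).toReal, ENNReal.rpow_ne_top_of_nonneg ENNReal.toReal_nonneg hC,
    fun f hf => ?_⟩
  have hf' : AEStronglyMeasurable f (Measure.map T (volume.restrict Ω)) :=
    hf.mono_ac h.map_absolutelyContinuous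
  refine ⟨hf'.comp_aemeasurable h.aemeasurable, ?_⟩
  calc eLpNorm (f ∘ T) 2 (volume.restrict Ω)
      = eLpNorm f 2 (Measure.map T (volume.restrict Ω)) :=
        (eLpNorm_map_measure hf' h.aemeasurable).symm
    _ ≤ eLpNorm f 2 (C • volume.restrict (T '' Ω)) := eLpNorm_mono_measure f hle
    _ = _ := by
      rw [eLpNorm_smul_measure_of_ne_top (by norm_num), smul_eq_mul]

theorem memLp_comp (h : IsBiLip Ω T) {F : Type} [NormedAddCommGroup F] {f : Euc d → F}
    (hf : MemLp f 2 (volume.restrict (T '' Ω))) :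
    MemLp (fun x => f (T x)) 2 (volume.restrict Ω) := by
  obtain ⟨C, hC, hle⟩ := h.exists_eLpNorm_comp_le
  obtain ⟨h1, h2⟩ := hle f hf.1
  exact ⟨h1, h2.trans_lt (ENNReal.mul_lt_top hC.lt_top hf.2)⟩

/-- The inverse of `T` on `T(closure Ω)` is again bi-Lipschitz, and maps `T(Ω)` onto `Ω`. -/
theorem inverse (h : IsBiLip Ω T) : IsBiLip (T '' Ω) (Function.invFunOn T (closure Ω)) ∧
    (∀ x ∈ closure Ω, Function.invFunOn T (closure Ω) (T x) = x) ∧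
    Function.invFunOn T (closure Ω) '' (T '' Ω) = Ω := by
  have hinv : ∀ x ∈ closure Ω, Function.invFunOn T (closure Ω) (T x) = x := fun x hx =>
    h.injOn.leftInvOn_invFunOn hx
  have him : Function.invFunOn T (closure Ω) '' (T '' Ω) = Ω := by
    rw [image_image]
    ext z
    constructor
    · rintro ⟨x, hx, rfl⟩
      simpa only [hinv x (subset_closure hx)] using hx
    · intro hz
      exact ⟨z, hz, hinv z (subset_closure hz)⟩
  refine ⟨⟨h.isOpen_image, h.isBounded_image, ?_, ?_, by rw [him]; exact h.isOpen⟩, hinv, him⟩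
  · obtain ⟨c, hc, hanti⟩ := h.antilipschitz
    refine ⟨(c⁻¹).toNNReal, LipschitzOnWith.of_dist_le_mul ?_⟩
    rw [h.closure_image]
    rintro _ ⟨x, hx, rfl⟩ _ ⟨x', hx', rfl⟩
    rw [hinv x hx, hinv x' hx', Real.coe_toNNReal _ (by positivity), le_inv_mul_iff₀ hc]
    exact hanti x hx x' hx'
  · obtain ⟨K, hK⟩ := h.lipschitz
    refine ⟨((K : ℝ) + 1)⁻¹, by positivity, ?_⟩
    rw [h.closure_image]
    rintro _ ⟨x, hx, rfl⟩ _ ⟨x', hx', rfl⟩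
    rw [hinv x hx, hinv x' hx', inv_mul_le_iff₀ (by positivity)]
    refine (hK.dist_le_mul x hx x' hx').trans ?_
    gcongr
    linarith

/-- The gradient of `w ∘ T`, in terms of the gradient of `w`. -/
def pullGrad (T : Euc d → Euc d) (G : Euc d → Euc d) (x : Euc d) : Euc d :=
  ContinuousLinearMap.adjoint (fderiv ℝ T x) (G (T x))

theorem gradient_comp {f : Euc d → ℝ} {x : Euc d} (hf : DifferentiableAt ℝ f (T x))
    (hT : DifferentiableAt ℝ T x) : ∇ (fun x => f (T x)) x = pullGrad T (∇ f) x := by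
  refine ext_inner_right ℝ fun v => ?_
  rw [inner_gradient_left, pullGrad, ContinuousLinearMap.adjoint_inner_left, inner_gradient_left]
  have := (hf.hasFDerivAt.comp x hT.hasFDerivAt).fderiv
  rw [show (fun x => f (T x)) = f ∘ T from rfl, this]
  rfl

theorem exists_eLpNorm_pullGrad_le (h : IsBiLip Ω T) : ∃ C : ℝ≥0∞, C ≠ ⊤ ∧
    ∀ G : Euc d → Euc d, AEStronglyMeasurable G (volume.restrict (T '' Ω)) →
      AEStronglyMeasurable (pullGrad T G) (volume.restrict Ω) ∧
      eLpNorm (pullGrad T G) 2 (volume.restrict Ω)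
        ≤ C * eLpNorm G 2 (volume.restrict (T '' Ω)) := by
  obtain ⟨K, c, κ, κ', -, -, hae⟩ := h.exists_det_bounds
  obtain ⟨C, hC, hle⟩ := h.exists_eLpNorm_comp_le
  refine ⟨ENNReal.ofReal |K| * C, ENNReal.mul_ne_top ENNReal.ofReal_ne_top hC, fun G hG => ?_⟩
  obtain ⟨h1, h2⟩ := hle G hG
  have hmeas : AEStronglyMeasurable (fun x => ContinuousLinearMap.adjoint (fderiv ℝ T x))
      (volume.restrict Ω) :=
    (ContinuousLinearMap.adjoint (𝕜 := ℝ) (E := Euc d) (F := Euc d)).continuous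
      |>.comp_aestronglyMeasurable
      (measurable_fderiv ℝ T).aestronglyMeasurable
  let B : Euc d →L[ℝ] (Euc d →L[ℝ] Euc d) →L[ℝ] Euc d := ContinuousLinearMap.apply ℝ (Euc d)
  refine ⟨B.aestronglyMeasurable_comp₂ h1 hmeas, ?_⟩
  calc _ ≤ ENNReal.ofReal |K| * eLpNorm (fun x => G (T x)) 2 (volume.restrict Ω) := by
        refine eLpNorm_le_mul_eLpNorm_of_ae_le_mul ?_ 2
        filter_upwards [hae] with x hx
        refine (ContinuousLinearMap.adjoint (fderiv ℝ T x)).le_of_opNorm_le ?_ _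
        rw [LinearIsometryEquiv.norm_map]
        exact hx.2.1.trans (le_abs_self K)
    _ ≤ ENNReal.ofReal |K| * (C * eLpNorm G 2 (volume.restrict (T '' Ω))) := by gcongr
    _ = _ := by rw [mul_assoc]

theorem pullGrad_ae_congr (h : IsBiLip Ω T) {G G' : Euc d → Euc d}
    (hG : G =ᵐ[volume.restrict (T '' Ω)] G') :
    pullGrad T G =ᵐ[volume.restrict Ω] pullGrad T G' := by
  filter_upwards [h.ae_comp hG] with x hx
  rw [pullGrad, pullGrad, hx]

/-- If the functions `w n ∘ T` belong to a closed subset of `H¹(Ω)` and `w n → w` in `H¹(T Ω)`, then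
`w ∘ T` belongs to it. -/
theorem exists_comp_of_tendsto (h : IsBiLip Ω T) {Z : Set (H1 Ω)} (hZ : IsClosed Z)
    {w : ℕ → H1 (T '' Ω)} {w₀ : H1 (T '' Ω)} (hw : Tendsto w atTop (𝓝 w₀))
    (hex : ∀ n, ∃ w' ∈ Z, H1.fn w' =ᵐ[volume.restrict Ω] (fun x => H1.fn (w n) (T x)) ∧
      H1.grad w' =ᵐ[volume.restrict Ω] pullGrad T (H1.grad (w n))) :
    ∃ w' ∈ Z, H1.fn w' =ᵐ[volume.restrict Ω] (fun x => H1.fn w₀ (T x)) ∧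
      H1.grad w' =ᵐ[volume.restrict Ω] pullGrad T (H1.grad w₀) := by
  obtain ⟨C, hC, hle⟩ := h.exists_eLpNorm_comp_le
  obtain ⟨C', hC', hle'⟩ := h.exists_eLpNorm_pullGrad_le
  choose w' hZ' h1 h2 using hex
  obtain ⟨hl1, hl2⟩ := H1.tendsto_iff.1 hw
  have hmg : MemLp (pullGrad T (H1.grad w₀)) 2 (volume.restrict Ω) := by
    obtain ⟨e1, e2⟩ := hle' _ (H1.memLp_grad w₀).1
    exact ⟨e1, e2.trans_lt (ENNReal.mul_lt_top hC'.lt_top (H1.memLp_grad w₀).2)⟩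
  refine H1.exists_mem_of_tendsto hZ hZ' (h.memLp_comp (H1.memLp_fn w₀)) hmg ?_ ?_
  · have hlim : Tendsto (fun n => C * eLpNorm (H1.fn (w n) - H1.fn w₀) 2
        (volume.restrict (T '' Ω))) atTop (𝓝 0) := by
      have := ENNReal.Tendsto.const_mul hl1 (Or.inr hC)
      rwa [mul_zero] at this
    refine tendsto_of_tendsto_of_tendsto_of_le_of_le tendsto_const_nhds hlim
      (fun _ => zero_le) fun n => ?_
    refine le_trans (le_of_eq (eLpNorm_congr_ae ?_))
      (hle (H1.fn (w n) - H1.fn w₀) ((H1.memLp_fn (w n)).sub (H1.memLp_fn w₀)).1).2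
    filter_upwards [h1 n] with x hx
    simp only [Pi.sub_apply, hx]
  · have hlim : Tendsto (fun n => C' * eLpNorm (H1.grad (w n) - H1.grad w₀) 2
        (volume.restrict (T '' Ω))) atTop (𝓝 0) := by
      have := ENNReal.Tendsto.const_mul hl2 (Or.inr hC')
      rwa [mul_zero] at this
    refine tendsto_of_tendsto_of_tendsto_of_le_of_le tendsto_const_nhds hlim
      (fun _ => zero_le) fun n => ?_
    refine le_trans (le_of_eq (eLpNorm_congr_ae ?_))
      (hle' (H1.grad (w n) - H1.grad w₀) ((H1.memLp_grad (w n)).sub (H1.memLp_grad w₀)).1).2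
    filter_upwards [h2 n] with x hx
    simp only [Pi.sub_apply, hx, pullGrad, map_sub]

/-- Composition with a bi-Lipschitz map preserves `H¹` functions vanishing on part of the boundary.
-/
theorem exists_comp_mem_vanishingOn (h : IsBiLip Ω T) (hγ : IsCompact γ) (hγΩ : γ ⊆ closure Ω)
    {w : H1 (T '' Ω)} (hw : w ∈ H1.vanishingOn (T '' Ω) (T '' γ)) :
    ∃ w' ∈ H1.vanishingOn Ω γ, H1.fn w' =ᵐ[volume.restrict Ω] (fun x => H1.fn w (T x)) ∧
      H1.grad w' =ᵐ[volume.restrict Ω] pullGrad T (H1.grad w) := by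
  obtain ⟨w', hw', hlim⟩ := mem_closure_iff_seq_limit.1 hw
  refine h.exists_comp_of_tendsto isClosed_closure hlim fun n => ?_
  obtain ⟨φ, hφ, hφc, hφγ, hwφ⟩ := hw' n
  obtain ⟨K, hK⟩ := hφ.lipschitzWith_of_hasCompactSupport hφc (by simp)
  obtain ⟨KT, hKT⟩ := h.lipschitz
  -- a Lipschitz extension of `T` to the whole space makes `φ ∘ T` a Lipschitz function there
  obtain ⟨S, hS, hST⟩ := hKT.extend_finite_dimension
  have hφS := hK.comp hS
  have hgrad : H1.grad (w' n) =ᵐ[volume.restrict (T '' Ω)] ∇ φ :=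
    H1.grad_ae_eq_gradient h.isOpen_image h.isBounded_image hK.lipschitzOnWith hwφ
  obtain ⟨w₁, e1, e2⟩ := H1.exists_of_lipschitzOnWith h.isOpen h.isBounded
    (hφS.lipschitzOnWith (s := Ω))
  refine ⟨w₁, ?_, ?_, ?_⟩
  · refine hφS.mem_vanishingOn h.isOpen h.isBounded hγ ?_ e1
    have hset : S '' γ = T '' γ := image_congr fun x hx => (hST (hγΩ hx)).symm
    rw [← hset] at hφγ
    have ht : Tendsto S (𝓝ˢ γ) (𝓝ˢ (S '' γ)) :=
      hS.continuous.tendsto_nhdsSet (mapsTo_image S γ)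
    exact ht.eventually hφγ
  · filter_upwards [e1, h.ae_comp hwφ, ae_restrict_mem h.isOpen.measurableSet] with x h1 h2 h3
    rw [h1, h2, Function.comp_apply, ← hST (subset_closure h3)]
  · filter_upwards [e2, h.pullGrad_ae_congr hgrad, ae_restrict_mem h.isOpen.measurableSet,
      h.ae_differentiableAt] with x h1 h2 h3 h4
    rw [h1, h2, ← gradient_comp (hφ.differentiable (by simp) _) h4]
    exact gradient_congr_of_isOpen h.isOpen
      (fun z hz => by rw [Function.comp_apply, hST (subset_closure hz)]) h3

/-- Every `H¹` function on `Ω` vanishing on `γ` is of the form `w ∘ T`. -/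
theorem exists_comp_eq (h : IsBiLip Ω T) (hγ : IsCompact γ) (hγΩ : γ ⊆ closure Ω)
    {φ : H1 Ω} (hφ : φ ∈ H1.vanishingOn Ω γ) :
    ∃ w ∈ H1.vanishingOn (T '' Ω) (T '' γ), H1.fn φ =ᵐ[volume.restrict Ω] (fun x => H1.fn w (T x)) ∧
      H1.grad φ =ᵐ[volume.restrict Ω] pullGrad T (H1.grad w) := by
  obtain ⟨hS, hinv, him⟩ := h.inverse
  set S := Function.invFunOn T (closure Ω) with hSdef
  have hSγ : S '' (T '' γ) = γ := by
    rw [image_image]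
    ext z
    constructor
    · rintro ⟨x, hx, rfl⟩
      simpa only [hinv x (hγΩ hx)] using hx
    · exact fun hz => ⟨z, hz, hinv z (hγΩ hz)⟩
  obtain ⟨w, hw, hw1⟩ : ∃ w ∈ H1.vanishingOn (T '' Ω) (T '' γ),
      H1.fn w =ᵐ[volume.restrict (T '' Ω)] (fun x => H1.fn φ (S x)) := by
    -- `Ω` equals `S(T(Ω))` only propositionally, so the claim is stated for a variable domain
    have key : ∀ (Ω' γ' : Set (Euc d)) (φ' : H1 Ω'), Ω' = S '' (T '' Ω) → γ' = S '' (T '' γ) →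
        φ' ∈ H1.vanishingOn Ω' γ' → ∃ w ∈ H1.vanishingOn (T '' Ω) (T '' γ),
          H1.fn w =ᵐ[volume.restrict (T '' Ω)] (fun x => H1.fn φ' (S x)) := by
      rintro _ _ φ' rfl rfl hφ'
      obtain ⟨w, hw, hw1, -⟩ := hS.exists_comp_mem_vanishingOn
        (hγ.image_of_continuousOn (h.continuousOn.mono hγΩ))
        (by rw [h.closure_image]; exact image_mono hγΩ) hφ'
      exact ⟨w, hw, hw1⟩
    exact key Ω γ φ him.symm hSγ.symm hφ
  obtain ⟨w', hw', h1, h2⟩ := h.exists_comp_mem_vanishingOn hγ hγΩ hw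
  have h3 : H1.fn φ =ᵐ[volume.restrict Ω] fun x => H1.fn w (T x) := by
    filter_upwards [h.ae_comp hw1, ae_restrict_mem h.isOpen.measurableSet] with x hx hxΩ
    rw [hx, hinv x (subset_closure hxΩ)]
  exact ⟨w, hw, h3, (H1.grad_ae_eq h.isOpen (h3.trans h1.symm)).trans h2⟩

end IsBiLip

/-! ### The Poincaré inequality -/

theorem eLpNorm_two_sq {α F : Type*} [MeasurableSpace α] [NormedAddCommGroup F] (f : α → F)
    (μ : Measure α) : eLpNorm f 2 μ ^ 2 = ∫⁻ x, ‖f x‖ₑ ^ 2 ∂μ := by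
  have := eLpNorm_nnreal_pow_eq_lintegral (f := f) (μ := μ) (p := 2) (by norm_num)
  simpa using this

theorem lintegral_enorm_sq_le {α F : Type*} [MeasurableSpace α] [NormedAddCommGroup F] {f : α → F}
    {μ : Measure α} [IsProbabilityMeasure μ] (hf : AEStronglyMeasurable f μ) :
    (∫⁻ x, ‖f x‖ₑ ∂μ) ^ 2 ≤ ∫⁻ x, ‖f x‖ₑ ^ 2 ∂μ := by
  rw [← eLpNorm_two_sq, ← eLpNorm_one_eq_lintegral_enorm]
  gcongr
  exact eLpNorm_le_eLpNorm_of_exponent_le (by norm_num) hf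

theorem enorm_sq_le_two_mul (a b : ℝ) : ‖a‖ₑ ^ 2 ≤ 2 * ‖b‖ₑ ^ 2 + 2 * ‖b - a‖ₑ ^ 2 := by
  simp only [← ofReal_norm, Real.norm_eq_abs]
  rw [← ENNReal.ofReal_pow (abs_nonneg _), ← ENNReal.ofReal_pow (abs_nonneg _),
    ← ENNReal.ofReal_pow (abs_nonneg _), ← ENNReal.ofReal_ofNat 2]
  rw [← ENNReal.ofReal_mul (by norm_num), ← ENNReal.ofReal_mul (by norm_num),
    ← ENNReal.ofReal_add (by positivity) (by positivity)]
  refine ENNReal.ofReal_le_ofReal ?_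
  rw [sq_abs, sq_abs, sq_abs]
  nlinarith [sq_nonneg (2 * b - a)]

/-- The fundamental theorem of calculus along a segment, squared by the Cauchy-Schwarz inequality.
-/
theorem enorm_sq_le_of_segment {U : Set (Euc d)} (hU : IsOpen U) {f : Euc d → ℝ}
    (hf : ContDiffOn ℝ 1 f U) {x v : Euc d} (hx : ∀ s ∈ Icc (0 : ℝ) 1, x + s • v ∈ U) :
    ‖f x‖ₑ ^ 2 ≤ 2 * ‖f (x + v)‖ₑ ^ 2
      + 2 * (‖v‖ₑ ^ 2 * ∫⁻ s in Ioc (0 : ℝ) 1, ‖∇ f (x + s • v)‖ₑ ^ 2) := by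
  have hd : ∀ s ∈ uIcc (0 : ℝ) 1, HasDerivAt (fun s : ℝ => f (x + s • v))
      (fderiv ℝ f (x + s • v) v) s := by
    intro s hs
    rw [uIcc_of_le zero_le_one] at hs
    have h1 : HasFDerivAt f (fderiv ℝ f (x + s • v)) (x + s • v) :=
      ((hf.differentiableOn (by norm_num)).differentiableAt (hU.mem_nhds (hx s hs))).hasFDerivAt
    have h2 : HasDerivAt (fun s : ℝ => x + s • v) v s := by
      simpa using ((hasDerivAt_id s).smul_const v).const_add x
    exact h1.comp_hasDerivAt s h2
  have hc : ContinuousOn (fun s : ℝ => fderiv ℝ f (x + s • v) v) (uIcc 0 1) := by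
    rw [uIcc_of_le zero_le_one]
    have h1 : ContinuousOn (fun s : ℝ => fderiv ℝ f (x + s • v)) (Icc 0 1) :=
      (hf.continuousOn_fderiv_of_isOpen hU le_rfl).comp (by fun_prop) hx
    exact h1.clm_apply continuousOn_const
  have hprob : IsProbabilityMeasure (volume.restrict (Ioc (0 : ℝ) 1)) := ⟨by simp⟩
  have hint := intervalIntegral.integral_eq_sub_of_hasDerivAt hd hc.intervalIntegrable
  rw [intervalIntegral.integral_of_le zero_le_one, one_smul, zero_smul, add_zero] at hint
  have hgm : Measurable (fun s : ℝ => ∇ f (x + s • v)) :=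
    (measurable_gradient f).comp (by fun_prop)
  have h1 : ‖f (x + v) - f x‖ₑ ^ 2
      ≤ ‖v‖ₑ ^ 2 * ∫⁻ s in Ioc (0 : ℝ) 1, ‖∇ f (x + s • v)‖ₑ ^ 2 := by
    calc ‖f (x + v) - f x‖ₑ ^ 2
        ≤ (∫⁻ s in Ioc (0 : ℝ) 1, ‖v‖ₑ * ‖∇ f (x + s • v)‖ₑ) ^ 2 := by
          rw [← hint]
          gcongr
          refine (enorm_integral_le_lintegral_enorm _).trans (lintegral_mono fun s => ?_)
          rw [← ofReal_norm, ← ofReal_norm, ← ofReal_norm,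
            ← ENNReal.ofReal_mul (norm_nonneg _), norm_gradient, mul_comm]
          exact ENNReal.ofReal_le_ofReal (ContinuousLinearMap.le_opNorm _ _)
      _ = ‖v‖ₑ ^ 2 * (∫⁻ s in Ioc (0 : ℝ) 1, ‖∇ f (x + s • v)‖ₑ) ^ 2 := by
          rw [lintegral_const_mul' _ _ enorm_ne_top, mul_pow]
      _ ≤ _ := by
          gcongr
          exact lintegral_enorm_sq_le hgm.aestronglyMeasurable
  refine le_trans ?_ (add_le_add le_rfl (mul_le_mul_right h1 2))
  exact enorm_sq_le_two_mul _ _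

/-- The `L²` norm on a set is controlled by that on a translate of the set and the gradient. -/
theorem lintegral_sq_le_of_translate {U E : Set (Euc d)} (hU : IsOpen U) (hE : MeasurableSet E)
    {f : Euc d → ℝ} (hf : ContDiffOn ℝ 1 f U) (v : Euc d)
    (hEU : ∀ x ∈ E, ∀ s ∈ Icc (0 : ℝ) 1, x + s • v ∈ U) :
    ∫⁻ x in E, ‖f x‖ₑ ^ 2 ≤ 2 * (∫⁻ x in E, ‖f (x + v)‖ₑ ^ 2)
      + 2 * (‖v‖ₑ ^ 2 * ∫⁻ x in U, ‖∇ f x‖ₑ ^ 2) := by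
  have hgm : Measurable (fun q : Euc d × ℝ => ‖∇ f (q.1 + q.2 • v)‖ₑ ^ 2) :=
    (((measurable_gradient f).comp (by fun_prop)).enorm).pow_const 2
  have hfm : AEMeasurable (fun x => ‖f (x + v)‖ₑ ^ 2) (volume.restrict E) := by
    have h1 : ContinuousOn (fun x => f (x + v)) E := hf.continuousOn.comp (by fun_prop)
      fun x hx => by simpa using hEU x hx 1 ⟨zero_le_one, le_rfl⟩
    exact (h1.aemeasurable hE).enorm.pow_const 2
  calc ∫⁻ x in E, ‖f x‖ₑ ^ 2
      ≤ ∫⁻ x in E, (2 * ‖f (x + v)‖ₑ ^ 2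
        + 2 * (‖v‖ₑ ^ 2 * ∫⁻ s in Ioc (0 : ℝ) 1, ‖∇ f (x + s • v)‖ₑ ^ 2)) :=
        setLIntegral_mono' hE fun x hx => enorm_sq_le_of_segment hU hf (hEU x hx)
    _ = 2 * (∫⁻ x in E, ‖f (x + v)‖ₑ ^ 2)
        + 2 * (‖v‖ₑ ^ 2 * ∫⁻ s in Ioc (0 : ℝ) 1, ∫⁻ x in E, ‖∇ f (x + s • v)‖ₑ ^ 2) := by
        rw [lintegral_add_left' (hfm.const_mul _), lintegral_const_mul' _ _ (by simp),
          lintegral_const_mul' _ _ (by simp), lintegral_const_mul' _ _ (by simp),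
          lintegral_lintegral_swap hgm.aemeasurable]
    _ ≤ _ := by
        gcongr
        calc _ ≤ ∫⁻ s in Ioc (0 : ℝ) 1, ∫⁻ x in U, ‖∇ f x‖ₑ ^ 2 := by
              refine setLIntegral_mono' measurableSet_Ioc fun s hs => ?_
              rw [← lintegral_indicator hE, ← lintegral_indicator hU.measurableSet,
                ← lintegral_add_right_eq_self (U.indicator fun x => ‖∇ f x‖ₑ ^ 2) (s • v)]
              refine lintegral_mono fun x => ?_
              by_cases hx : x ∈ E
              · rw [indicator_of_mem hx, indicator_of_mem (hEU x hx s ⟨hs.1.le, hs.2⟩)]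
              · rw [indicator_of_notMem hx]
                exact zero_le
          _ = _ := by simp

/-- The Poincaré inequality on `S ∩ Ω`, for functions on `Ω` that vanish near `γ`. -/
def PoincareOn (Ω γ S : Set (Euc d)) : Prop :=
  ∃ C : ℝ≥0, ∀ φ : Euc d → ℝ, ContDiff ℝ 1 φ → (∀ᶠ x in 𝓝ˢ γ, φ x = 0) →
    ∫⁻ x in S ∩ Ω, ‖φ x‖ₑ ^ 2 ≤ C * ∫⁻ x in Ω, ‖∇ φ x‖ₑ ^ 2

namespace PoincareOn

variable {Ω γ S S' : Set (Euc d)}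

theorem mono (h : PoincareOn Ω γ S) (hS : S' ⊆ S) : PoincareOn Ω γ S' := by
  obtain ⟨C, hC⟩ := h
  exact ⟨C, fun φ h1 h2 =>
    (lintegral_mono_set (inter_subset_inter_left Ω hS)).trans (hC φ h1 h2)⟩

theorem union (h : PoincareOn Ω γ S) (h' : PoincareOn Ω γ S') : PoincareOn Ω γ (S ∪ S') := by
  obtain ⟨C, hC⟩ := h
  obtain ⟨C', hC'⟩ := h'
  refine ⟨C + C', fun φ h1 h2 => ?_⟩
  rw [union_inter_distrib_right, ENNReal.coe_add, add_mul]
  exact (lintegral_union_le _ _ _).trans (add_le_add (hC φ h1 h2) (hC' φ h1 h2))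

/-- The Poincaré inequality holds on `S` if it holds on a translate of `S` within `Ω`. -/
theorem of_translate (h : PoincareOn Ω γ S') (hΩ : IsOpen Ω) (hS : MeasurableSet S) {v : Euc d}
    (h1 : ∀ x ∈ S ∩ Ω, x + v ∈ S') (h2 : ∀ x ∈ S ∩ Ω, ∀ s ∈ Icc (0 : ℝ) 1, x + s • v ∈ Ω) :
    PoincareOn Ω γ S := by
  obtain ⟨C, hC⟩ := h
  have h1' : ∀ x ∈ S ∩ Ω, x + v ∈ S' ∩ Ω := fun x hx =>
    ⟨h1 x hx, by simpa using h2 x hx 1 ⟨zero_le_one, le_rfl⟩⟩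
  have hE := hS.inter hΩ.measurableSet
  refine ⟨2 * C + 2 * ‖v‖₊ ^ 2, fun φ hφ hφγ => ?_⟩
  refine (lintegral_sq_le_of_translate hΩ hE hφ.contDiffOn v h2).trans ?_
  have h3 : ∫⁻ x in S ∩ Ω, ‖φ (x + v)‖ₑ ^ 2 ≤ ∫⁻ x in S' ∩ Ω, ‖φ x‖ₑ ^ 2 := by
    have hm : MeasurableSet ((fun x => x + (-v)) ⁻¹' (S ∩ Ω)) := hE.preimage (by fun_prop)
    have hsub : (fun x => x + (-v)) ⁻¹' (S ∩ Ω) ⊆ S' ∩ Ω := fun x hx => by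
      simpa using h1' _ hx
    refine le_trans (le_of_eq ?_) (lintegral_mono_set hsub)
    rw [← lintegral_indicator hE, ← lintegral_indicator hm,
      ← lintegral_add_right_eq_self (((fun x => x + (-v)) ⁻¹' (S ∩ Ω)).indicator _) v]
    refine lintegral_congr fun x => ?_
    have hx : x + v ∈ (fun x => x + (-v)) ⁻¹' (S ∩ Ω) ↔ x ∈ S ∩ Ω := by
      rw [mem_preimage, add_neg_cancel_right]
    by_cases h : x ∈ S ∩ Ω
    · rw [indicator_of_mem h, indicator_of_mem (hx.2 h)]
    · rw [indicator_of_notMem h, indicator_of_notMem fun hc => h (hx.1 hc)]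
  calc _ ≤ 2 * (C * ∫⁻ x in Ω, ‖∇ φ x‖ₑ ^ 2) + 2 * (‖v‖ₑ ^ 2 * ∫⁻ x in Ω, ‖∇ φ x‖ₑ ^ 2) := by
        exact add_le_add_left (mul_le_mul_right (h3.trans (hC φ hφ hφγ)) 2) _
    _ = _ := by
        push_cast
        rw [enorm_eq_nnnorm]
        ring

end PoincareOn

namespace IsBoundedLipschitzDomain

variable {Ω γ₀ γ₁ : Set (Euc d)}

/-- Near the points of `γ₀`, a function that vanishes near `γ₀` is extended by `0` outside `Ω`, and
the domain is translated to its complement. -/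
theorem poincareOn_of_mem (hΩ : IsBoundedLipschitzDomain Ω) (hγ₁ : IsClosed γ₁)
    (hunion : γ₀ ∪ γ₁ = frontier Ω) (hdisj : Disjoint γ₀ γ₁) {p : Euc d} (hp : p ∈ γ₀) :
    ∃ ρ > 0, PoincareOn Ω γ₀ (Metric.ball p ρ) := by
  have hpf : p ∈ frontier Ω := hunion ▸ Or.inl hp
  have hpΩ : p ∉ Ω := (hΩ.isOpen.frontier_eq ▸ hpf : p ∈ closure Ω \ Ω).2
  obtain ⟨e, g, K, r₁, he, hg, hr₁, hgr⟩ := hΩ.locally_graph p hpf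
  obtain ⟨r₂, hr₂, hr₂'⟩ := Metric.isOpen_iff.1 hγ₁.isOpen_compl p
    (Set.disjoint_left.1 hdisj hp)
  set r := min r₁ r₂ with hr
  have hr0 : 0 < r := lt_min hr₁ hr₂
  have hKpos : (0 : ℝ) < K + 4 := by positivity
  -- the shift by `-σ e` takes the ball of radius `ρ` below the graph, and stays in that of radius
  -- `r`
  set ρ := r / (K + 4) with hρ
  have hρ0 : 0 < ρ := div_pos hr0 hKpos
  set σ := (K + 2) * ρ with hσ
  have hσ0 : 0 < σ := by positivity
  have hsum : ρ + σ < r := by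
    have : (K + 4) * ρ = r := mul_div_cancel₀ _ hKpos.ne'
    rw [hσ]
    linarith
  have hmem : ∀ x ∈ Metric.ball p ρ, ∀ s ∈ Icc (0 : ℝ) 1, x + s • (-σ • e) ∈ Metric.ball p r := by
    intro x hx s hs
    rw [mem_ball_iff_norm] at hx ⊢
    calc ‖x + s • (-σ • e) - p‖ = ‖(x - p) + s • (-σ • e)‖ := by congr 1; abel
      _ ≤ ‖x - p‖ + ‖s • (-σ • e)‖ := norm_add_le _ _
      _ ≤ ‖x - p‖ + σ := by
        gcongr
        rw [norm_smul, norm_smul, he, mul_one, norm_neg, Real.norm_eq_abs, Real.norm_eq_abs,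
          abs_of_nonneg hs.1, abs_of_pos hσ0]
        exact mul_le_of_le_one_left hσ0.le hs.2
      _ < r := by linarith
  have hout : ∀ x ∈ Metric.ball p ρ, x + (-σ • e) ∉ Ω := by
    intro x hx hxΩ
    have hxb := hmem x hx 1 ⟨zero_le_one, le_rfl⟩
    rw [one_smul] at hxb
    have h1 := (hgr _ (Metric.ball_subset_ball (min_le_left _ _) hxb)).1 hxΩ
    refine hpΩ ((hgr p (Metric.mem_ball_self hr₁)).2 ?_)
    have h2 := above_graph he hg (x := x + (-σ • e)) (u := p - x) (h := σ) h1.le (by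
      rw [mem_ball_iff_norm'] at hx
      have : (0 : ℝ) ≤ K := K.2
      calc ((K : ℝ) + 1) * ‖p - x‖ ≤ (K + 1) * ρ := by gcongr
        _ < σ := by rw [hσ]; gcongr; norm_num)
    have h3 : x + (-σ • e) + (p - x) + σ • e = p := by rw [neg_smul]; abel
    rwa [h3] at h2
  refine ⟨ρ, hρ0, 2 * ‖-σ • e‖₊ ^ 2, fun φ hφ hφγ => ?_⟩
  -- near `p`, the extension of `φ` by `0` is smooth, as `φ` vanishes near the boundary points there
  have hloc : ∀ x ∈ Metric.ball p r, x ∉ Ω → Ω.indicator φ =ᶠ[𝓝 x] fun _ => 0 := by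
    intro x hx hxΩ
    by_cases hxf : x ∈ frontier Ω
    · have hx0 : x ∈ γ₀ := by
        rcases hunion ▸ hxf with h | h
        · exact h
        · exact absurd h (hr₂' (Metric.ball_subset_ball (min_le_right _ _) hx))
      filter_upwards [eventually_nhdsSet_iff_forall.1 hφγ x hx0] with z hz
      exact indicator_apply_eq_zero.2 fun _ => hz
    · have hxc : x ∈ (closure Ω)ᶜ := fun hc => hxf (hΩ.isOpen.frontier_eq ▸ ⟨hc, hxΩ⟩)
      filter_upwards [isClosed_closure.isOpen_compl.mem_nhds hxc] with z hz
      exact indicator_of_notMem (fun h => hz (subset_closure h)) _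
  have hloc' : ∀ x ∈ Ω, Ω.indicator φ =ᶠ[𝓝 x] φ := fun x hx => by
    filter_upwards [hΩ.isOpen.mem_nhds hx] with z hz
    rw [indicator_of_mem hz]
  have hsmooth : ContDiffOn ℝ 1 (Ω.indicator φ) (Metric.ball p r) := by
    intro x hx
    refine ContDiffAt.contDiffWithinAt ?_
    by_cases hxΩ : x ∈ Ω
    · exact hφ.contDiffAt.congr_of_eventuallyEq (hloc' x hxΩ)
    · exact (contDiffAt_const (c := (0 : ℝ))).congr_of_eventuallyEq (hloc x hx hxΩ)
  have h1 := lintegral_sq_le_of_translate Metric.isOpen_ball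
    (measurableSet_ball (x := p) (ε := ρ)) hsmooth (-σ • e) hmem
  have h2 : ∫⁻ x in Metric.ball p ρ, ‖Ω.indicator φ (x + -σ • e)‖ₑ ^ 2 = 0 := by
    rw [setLIntegral_congr_fun (g := fun _ => 0) measurableSet_ball, lintegral_zero]
    intro x hx
    simp only [indicator_of_notMem (hout x hx), enorm_zero]
    norm_num
  have h3 : ∫⁻ x in Metric.ball p ρ ∩ Ω, ‖φ x‖ₑ ^ 2
      ≤ ∫⁻ x in Metric.ball p ρ, ‖Ω.indicator φ x‖ₑ ^ 2 := by
    refine le_trans (setLIntegral_mono' (measurableSet_ball.inter hΩ.isOpen.measurableSet)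
      fun x hx => ?_) (lintegral_mono_set inter_subset_left)
    rw [indicator_of_mem hx.2]
  have h4 : ∫⁻ x in Metric.ball p r, ‖∇ (Ω.indicator φ) x‖ₑ ^ 2 ≤ ∫⁻ x in Ω, ‖∇ φ x‖ₑ ^ 2 := by
    rw [← lintegral_indicator measurableSet_ball, ← lintegral_indicator hΩ.isOpen.measurableSet]
    refine lintegral_mono fun x => ?_
    refine indicator_le' (fun x hx => ?_) (fun _ _ => zero_le) x
    by_cases hxΩ : x ∈ Ω
    · rw [indicator_of_mem hxΩ, gradient, gradient, (hloc' x hxΩ).fderiv_eq]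
    · rw [gradient, (hloc x hx hxΩ).fderiv_eq]
      simp
  rw [h2, mul_zero, zero_add] at h1
  refine (h3.trans h1).trans ?_
  push_cast
  rw [mul_assoc]
  exact mul_le_mul_right (mul_le_mul_right h4 _) _

/-- As `Ω` is connected, the inequality spreads from a neighbourhood of a point of `γ₀` to all of
`Ω`. -/
theorem poincareOn_ball_of_mem (hΩ : IsBoundedLipschitzDomain Ω) (hγ₁ : IsClosed γ₁)
    (hunion : γ₀ ∪ γ₁ = frontier Ω) (hdisj : Disjoint γ₀ γ₁) (hne : γ₀.Nonempty) {p : Euc d}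
    (hp : p ∈ Ω) : ∃ ρ > 0, PoincareOn Ω γ₀ (Metric.ball p ρ) := by
  -- the points with this property form a set that is open, nonempty, and closed relative to `Ω`
  set W : Set (Euc d) := {q | ∃ ρ > 0, PoincareOn Ω γ₀ (Metric.ball q ρ)} with hW
  have hopen : IsOpen W := by
    refine Metric.isOpen_iff.2 ?_
    rintro q ⟨ρ, hρ, h⟩
    refine ⟨ρ, hρ, fun q' hq' => ⟨ρ - dist q' q, sub_pos.2 hq', h.mono ?_⟩⟩
    exact Metric.ball_subset_ball' (by linarith)
  have hclosed : ∀ q ∈ Ω, q ∈ closure W → q ∈ W := by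
    intro q hq hqW
    obtain ⟨R, hR, hRΩ⟩ := Metric.isOpen_iff.1 hΩ.isOpen q hq
    obtain ⟨q', ⟨ρ, hρ, h⟩, hq'⟩ := Metric.mem_closure_iff.1 hqW (R / 2) (half_pos hR)
    rw [dist_eq_norm] at hq'
    refine ⟨min ρ (R / 2), lt_min hρ (half_pos hR),
      h.of_translate hΩ.isOpen measurableSet_ball (v := q' - q) ?_ ?_⟩
    · rintro x ⟨hx, -⟩
      rw [mem_ball_iff_norm] at hx ⊢
      rw [show x + (q' - q) - q' = x - q by abel]
      exact hx.trans_le (min_le_left _ _)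
    · rintro x ⟨hx, -⟩ s hs
      refine hRΩ ?_
      rw [mem_ball_iff_norm] at hx ⊢
      have h1 : ‖s • (q' - q)‖ ≤ ‖q - q'‖ := by
        rw [norm_smul, Real.norm_eq_abs, abs_of_nonneg hs.1, norm_sub_rev]
        exact mul_le_of_le_one_left (norm_nonneg _) hs.2
      calc ‖x + s • (q' - q) - q‖ = ‖(x - q) + s • (q' - q)‖ := by congr 1; abel
        _ ≤ ‖x - q‖ + ‖s • (q' - q)‖ := norm_add_le _ _
        _ < R := by linarith [min_le_right ρ (R / 2)]
  have hnonempty : (Ω ∩ W).Nonempty := by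
    obtain ⟨q, hq⟩ := hne
    obtain ⟨ρ, hρ, h⟩ := hΩ.poincareOn_of_mem hγ₁ hunion hdisj hq
    have hqc : q ∈ closure Ω := frontier_subset_closure (hunion ▸ Or.inl hq)
    obtain ⟨x, hx, hxq⟩ := Metric.mem_closure_iff.1 hqc ρ hρ
    exact ⟨x, hx, ρ - dist q x, sub_pos.2 hxq,
      h.mono (Metric.ball_subset_ball' (by rw [dist_comm]; linarith))⟩
  refine hΩ.isConnected.isPreconnected.subset_of_disjoint_frontier hopen hnonempty ?_ hp
  rw [hopen.frontier_eq]
  exact Set.disjoint_left.2 fun q hq hqW => hqW.2 (hclosed q hq hqW.1)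

theorem poincareOn_ball_of_mem_closure (hΩ : IsBoundedLipschitzDomain Ω) (hγ₁ : IsClosed γ₁)
    (hunion : γ₀ ∪ γ₁ = frontier Ω) (hdisj : Disjoint γ₀ γ₁) (hne : γ₀.Nonempty) {p : Euc d}
    (hp : p ∈ closure Ω) : ∃ ρ > 0, PoincareOn Ω γ₀ (Metric.ball p ρ) := by
  by_cases hpΩ : p ∈ Ω
  · exact hΩ.poincareOn_ball_of_mem hγ₁ hunion hdisj hne hpΩ
  -- the part of `Ω` near a boundary point is translated upwards, into the interior of `Ω`
  have hpf : p ∈ frontier Ω := hΩ.isOpen.frontier_eq ▸ ⟨hp, hpΩ⟩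
  obtain ⟨e, g, K, r, he, hg, hr, hgr⟩ := hΩ.locally_graph p hpf
  have hup : ∀ x ∈ closure Ω, x ∈ Metric.ball p r → ∀ s : ℝ, 0 < s → x + s • e ∈ Metric.ball p r →
      x + s • e ∈ Ω := by
    intro x hx hxr s hs hxs
    have := above_graph he hg (u := 0) (h := s)
      (graph_le_of_mem_closure hg.continuous hgr hx hxr) (by simpa using hs)
    rw [add_zero] at this
    exact (hgr _ hxs).2 this
  have hball : ∀ x ∈ Metric.ball p (r / 2), ∀ s ∈ Icc (0 : ℝ) 1,
      x + s • ((r / 2) • e) ∈ Metric.ball p r := by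
    intro x hx s hs
    rw [mem_ball_iff_norm] at hx ⊢
    have h1 : ‖s • ((r / 2) • e)‖ ≤ r / 2 := by
      rw [norm_smul, norm_smul, he, mul_one, Real.norm_eq_abs, Real.norm_eq_abs,
        abs_of_nonneg hs.1, abs_of_pos (half_pos hr)]
      exact mul_le_of_le_one_left (half_pos hr).le hs.2
    calc ‖x + s • ((r / 2) • e) - p‖ = ‖(x - p) + s • ((r / 2) • e)‖ := by congr 1; abel
      _ ≤ ‖x - p‖ + ‖s • ((r / 2) • e)‖ := norm_add_le _ _
      _ < r := by linarith
  have hpb := hball p (Metric.mem_ball_self (half_pos hr)) 1 ⟨zero_le_one, le_rfl⟩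
  rw [one_smul] at hpb
  obtain ⟨ρ, hρ, h⟩ := hΩ.poincareOn_ball_of_mem hγ₁ hunion hdisj hne
    (hup p hp (Metric.mem_ball_self hr) (r / 2) (half_pos hr) hpb)
  refine ⟨min ρ (r / 2), lt_min hρ (half_pos hr),
    h.of_translate hΩ.isOpen measurableSet_ball (v := (r / 2) • e) ?_ ?_⟩
  · rintro x ⟨hx, -⟩
    rw [mem_ball_iff_norm] at hx ⊢
    rw [add_sub_add_right_eq_sub]
    exact hx.trans_le (min_le_left _ _)
  · rintro x ⟨hx, hxΩ⟩ s hs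
    have hx' := Metric.ball_subset_ball (min_le_right ρ (r / 2)) hx
    rcases hs.1.eq_or_lt with h0 | h0
    · rwa [← h0, zero_smul, add_zero]
    · have h1 := hball x hx' s hs
      rw [smul_smul] at h1 ⊢
      exact hup x (subset_closure hxΩ) (Metric.ball_subset_ball (by linarith) hx') _
        (by positivity) h1

/-- The Poincaré inequality on the space of functions vanishing on `γ₀`. -/
theorem exists_poincare (hΩ : IsBoundedLipschitzDomain Ω) (hγ₁ : IsClosed γ₁)
    (hunion : γ₀ ∪ γ₁ = frontier Ω) (hdisj : Disjoint γ₀ γ₁) (hne : γ₀.Nonempty) :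
    ∃ C : ℝ, 0 ≤ C ∧ ∀ w ∈ H1.V Ω γ₀, ‖H1.fnL Ω w‖ ^ 2 ≤ C * ‖H1.gradL Ω w‖ ^ 2 := by
  have hP : PoincareOn Ω γ₀ (closure Ω) := by
    refine hΩ.isBounded.isCompact_closure.induction_on (p := PoincareOn Ω γ₀) ⟨0, by simp⟩
      (fun s t hst ht => ht.mono hst) (fun s t hs ht => hs.union ht) fun p hp => ?_
    obtain ⟨ρ, hρ, h⟩ := hΩ.poincareOn_ball_of_mem_closure hγ₁ hunion hdisj hne hp
    exact ⟨_, mem_nhdsWithin_of_mem_nhds (Metric.ball_mem_nhds p hρ), h⟩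
  obtain ⟨C, hC⟩ := hP
  rw [inter_eq_self_of_subset_right subset_closure] at hC
  refine ⟨C, C.2, fun w hw => ?_⟩
  have hclosed : IsClosed {w : H1 Ω | ‖H1.fnL Ω w‖ ^ 2 ≤ C * ‖H1.gradL Ω w‖ ^ 2} :=
    isClosed_le ((H1.fnL Ω).continuous.norm.pow 2)
      (continuous_const.mul ((H1.gradL Ω).continuous.norm.pow 2))
  refine closure_minimal (s := (H1.smoothVanishing Ω γ₀ : Set (H1 Ω))) ?_ hclosed hw
  rintro w ⟨φ, hφ, hφc, hφγ, hwφ⟩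
  obtain ⟨K, hK⟩ := hφ.lipschitzWith_of_hasCompactSupport hφc (by simp)
  have hg := H1.grad_ae_eq_gradient hΩ.isOpen hΩ.isBounded hK.lipschitzOnWith hwφ
  have h1 := hC φ (hφ.of_le (by simp)) hφγ
  rw [← eLpNorm_two_sq, ← eLpNorm_two_sq, ← eLpNorm_congr_ae hwφ, ← eLpNorm_congr_ae hg] at h1
  have e1 : eLpNorm (H1.fn w) 2 (volume.restrict Ω) = ‖H1.fnL Ω w‖ₑ := (Lp.enorm_def _).symm
  have e2 : eLpNorm (H1.grad w) 2 (volume.restrict Ω) = ‖H1.gradL Ω w‖ₑ := (Lp.enorm_def _).symm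
  rw [e1, e2] at h1
  simp only [enorm_eq_nnnorm] at h1
  simp only [mem_ofPred_eq]
  exact_mod_cast h1

end IsBoundedLipschitzDomain

/-! ### Removal of the singularity of the fundamental solution -/

theorem memLp_restrict_of_continuous {F : Type*} [NormedAddCommGroup F] {Ω : Set (Euc d)}
    (hΩ : IsOpen Ω) (hb : Bornology.IsBounded Ω) {f : Euc d → F} (hf : Continuous f) (p : ℝ≥0∞) :
    MemLp f p (volume.restrict Ω) := by
  have := isFiniteMeasure_restrict_of_isBounded hb
  obtain ⟨C, hC⟩ := hb.isCompact_closure.exists_bound_of_continuousOn hf.continuousOn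
  have hm : AEStronglyMeasurable f (volume.restrict Ω) := hf.aestronglyMeasurable
  refine (MemLp.of_bound (μ := volume.restrict Ω) hm C ?_)
  rw [ae_restrict_iff' hΩ.measurableSet]
  exact ae_of_all _ fun x hx => hC x (subset_closure hx)

theorem integrable_inner_of_memLp {α : Type*} [MeasurableSpace α] {μ : Measure α} {f g : α → Euc d}
    (hf : MemLp f 2 μ) (hg : MemLp g 2 μ) : Integrable (fun x => inner ℝ (f x) (g x)) μ := by
  refine (L2.integrable_inner (𝕜 := ℝ) (hf.toLp f) (hg.toLp g)).congr ?_
  filter_upwards [hf.coeFn_toLp, hg.coeFn_toLp] with x h1 h2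
  rw [h1, h2]

theorem contDiffAt_gradient {f : Euc d → ℝ} {x : Euc d} {n : ℕ∞} (hf : ContDiffAt ℝ ∞ f x) :
    ContDiffAt ℝ n (∇ f) x :=
  (InnerProductSpace.toDual ℝ (Euc d)).symm.toContinuousLinearEquiv.contDiff.contDiffAt.comp x
    (hf.fderiv_right (by norm_cast; exact le_top))

theorem gradient_mul' {f g : Euc d → ℝ} {x : Euc d} (hf : DifferentiableAt ℝ f x)
    (hg : DifferentiableAt ℝ g x) : ∇ (fun x => f x * g x) x = f x • ∇ g x + g x • ∇ f x := by
  rw [gradient, fderiv_fun_mul hf hg, map_add, map_smul, map_smul]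
  rfl

theorem contDiffAt_fundamentalSolution {x : Euc d} (hx : x ≠ 0) :
    ContDiffAt ℝ ∞ (fundamentalSolution d) x := by
  have hn : ContDiffAt ℝ ∞ (fun x : Euc d => ‖x‖) x := contDiffAt_norm ℝ hx
  have hx' := norm_ne_zero_iff.2 hx
  by_cases h : d = 2
  · have : fundamentalSolution d = fun x => -(2 * Real.pi)⁻¹ * Real.log ‖x‖ := by
      funext x
      rw [fundamentalSolution, if_pos h]
    rw [this]
    exact contDiffAt_const.mul (hn.log hx')
  · have : fundamentalSolution d = fun x : Euc d => ‖x‖ ^ ((2 - (d : ℤ) : ℤ) : ℝ) /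
        (((d : ℝ) - 2) * ((d : ℝ) * volume.real (Metric.ball (0 : Euc d) 1))) := by
      funext x
      rw [fundamentalSolution, if_neg h, Real.rpow_intCast]
    rw [this]
    exact (hn.rpow_const_of_ne hx').div_const _

theorem contDiffAt_fundamentalSolution_sub {x y : Euc d} (hx : x ≠ y) :
    ContDiffAt ℝ ∞ (fun x => fundamentalSolution d (x - y)) x :=
  (contDiffAt_fundamentalSolution (sub_ne_zero.2 hx)).comp x
    (contDiffAt_id.sub contDiffAt_const)

theorem contDiff_of_eventuallyEq_zero {F : Type*} [NormedAddCommGroup F] [NormedSpace ℝ F]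
    {f : Euc d → F} {y : Euc d} {n : WithTop ℕ∞} (h0 : f =ᶠ[𝓝 y] fun _ => 0)
    (h : ∀ x, x ≠ y → ContDiffAt ℝ n f x) : ContDiff ℝ n f :=
  contDiff_iff_contDiffAt.2 fun x => by
    rcases eq_or_ne x y with rfl | hx
    · exact contDiffAt_const.congr_of_eventuallyEq h0
    · exact h x hx

section Cutoff

variable {y : Euc d} (χ : ContDiffBump y)

theorem gradient_bump_eventuallyEq : ∇ χ =ᶠ[𝓝 y] fun _ => 0 := by
  filter_upwards [χ.eventuallyEq_one.eventuallyEq_nhds] with x hx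
  rw [gradient, hx.fderiv_eq]
  simp

/-- The vector field `-Γ(· - y) ∇χ`; it vanishes near `y`, where `χ = 1`. -/
def cutoffField (x : Euc d) : Euc d := -(fundamentalSolution d (x - y) • ∇ χ x)

/-- The function `∇Γ(· - y) · ∇χ`; it vanishes near `y`, where `χ = 1`. -/
def cutoffSource (x : Euc d) : ℝ :=
  inner ℝ (∇ (fun x => fundamentalSolution d (x - y)) x) (∇ χ x)

theorem contDiff_cutoffField : ContDiff ℝ 1 (cutoffField χ) := by
  refine contDiff_of_eventuallyEq_zero (y := y) ?_ fun x hx => ?_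
  · filter_upwards [gradient_bump_eventuallyEq χ] with x hx
    rw [cutoffField, hx, smul_zero, neg_zero]
  · exact (((contDiffAt_fundamentalSolution_sub hx).of_le (by simp)).smul
      (contDiffAt_gradient (n := 1) χ.contDiff.contDiffAt)).neg

theorem contDiff_cutoffSource : ContDiff ℝ 1 (cutoffSource χ) := by
  refine contDiff_of_eventuallyEq_zero (y := y) ?_ fun x hx => ?_
  · filter_upwards [gradient_bump_eventuallyEq χ] with x hx
    rw [cutoffSource, hx, inner_zero_right]
  · exact (contDiffAt_gradient (n := 1) (contDiffAt_fundamentalSolution_sub hx)).inner ℝ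
      (contDiffAt_gradient (n := 1) χ.contDiff.contDiffAt)

theorem contDiff_one_sub_mul_fundamentalSolution :
    ContDiff ℝ ∞ (fun x => (1 - χ x) * fundamentalSolution d (x - y)) := by
  refine contDiff_of_eventuallyEq_zero (y := y) ?_ fun x hx => ?_
  · filter_upwards [χ.eventuallyEq_one] with x hx
    rw [hx, Pi.one_apply, sub_self, zero_mul]
  · exact (contDiffAt_const.sub χ.contDiff.contDiffAt).mul (contDiffAt_fundamentalSolution_sub hx)

theorem gradient_one_sub_mul_fundamentalSolution (x : Euc d) :
    ∇ (fun x => (1 - χ x) * fundamentalSolution d (x - y)) x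
      = (1 - χ x) • ∇ (fun x => fundamentalSolution d (x - y)) x + cutoffField χ x := by
  rcases eq_or_ne x y with rfl | hx
  · have h1 : (fun z => (1 - χ z) * fundamentalSolution d (z - x)) =ᶠ[𝓝 x] fun _ => 0 := by
      filter_upwards [χ.eventuallyEq_one] with z hz
      rw [hz, Pi.one_apply, sub_self, zero_mul]
    rw [h1.gradient_eq, cutoffField, (gradient_bump_eventuallyEq χ).self_of_nhds,
      χ.eventuallyEq_one.self_of_nhds]
    simp
  · have hχ : DifferentiableAt ℝ χ x := χ.contDiff.differentiable (n := 1) (by simp) x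
    rw [gradient_mul' (by fun_prop)
      ((contDiffAt_fundamentalSolution_sub hx).differentiableAt (by simp)), cutoffField, gradient,
      gradient, gradient, fderiv_const_sub, map_neg, smul_neg]

end Cutoff

/-- Integration by parts against a test function. -/
theorem HasWeakGradient.integral_inner_gradient {Ω : Set (Euc d)} {f : Euc d → ℝ}
    {g : Euc d → Euc d} (h : HasWeakGradient Ω f g) (hf : MemLp f 2 (volume.restrict Ω))
    (hg : MemLp g 2 (volume.restrict Ω)) {φ : Euc d → ℝ} (hφ : IsTestFunction Ω φ) :
    ∫ x in Ω, inner ℝ (g x) (∇ φ x) = - ∫ x in Ω, f x * Δ φ x := by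
  set b := EuclideanSpace.basisFun (Fin d) ℝ with hb
  have hψ : ∀ i, IsTestFunction Ω (fun x => fderiv ℝ φ x (b i)) := fun i =>
    ⟨(hφ.contDiff.fderiv_right (m := ∞) (by simp)).clm_apply contDiff_const,
      hφ.hasCompactSupport.fderiv_apply (𝕜 := ℝ) (b i),
      (tsupport_fderiv_apply_subset ℝ (b i)).trans hφ.tsupport_subset⟩
  have key : ∀ i, ∫ x in Ω, f x * inner ℝ (∇ (fun x => fderiv ℝ φ x (b i)) x) (b i)
      = - ∫ x in Ω, inner ℝ (∇ φ x) (b i) * inner ℝ (b i) (g x) := by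
    intro i
    have := congrArg (fun v : Euc d => inner ℝ v (b i)) (h _ (hψ i))
    simp only [inner_neg_left] at this
    rw [← integral_inner_const (integrable_smul_gradient (hψ i) hf),
      ← integral_inner_const (integrable_test_smul (hψ i) hg)] at this
    simp only [inner_smul_left, conj_trivial] at this
    rw [this]
    exact congrArg Neg.neg (integral_congr_ae (ae_of_all _ fun x => by
      simp only []; rw [inner_gradient_left, real_inner_comm (b i)]))
  have e1 : ∀ x, inner ℝ (g x) (∇ φ x) = ∑ i, inner ℝ (∇ φ x) (b i) * inner ℝ (b i) (g x) := by
    intro x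
    rw [b.sum_inner_mul_inner, real_inner_comm]
  have e2 : ∀ x, f x * Δ φ x = ∑ i, f x * inner ℝ (∇ (fun x => fderiv ℝ φ x (b i)) x) (b i) := by
    intro x
    rw [InnerProductSpace.laplacian_eq_iteratedFDeriv_orthonormalBasis φ b, Finset.mul_sum]
    refine Finset.sum_congr rfl fun i _ => ?_
    rw [inner_gradient_left, iteratedFDeriv_two_apply]
    have : DifferentiableAt ℝ (fderiv ℝ φ) x :=
      ((hφ.contDiff.fderiv_right (m := ∞) (by simp)).differentiable (by simp)) x
    rw [fderiv_clm_apply this (differentiableAt_const _)]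
    simp
  simp only [e1, e2]
  rw [integral_finsetSum, integral_finsetSum, ← Finset.sum_neg_distrib]
  · refine Finset.sum_congr rfl fun i _ => ?_
    rw [key, neg_neg]
  · intro i _
    have := (integrable_smul_gradient (hψ i) hf).inner_const (𝕜 := ℝ) (b i)
    simpa only [inner_smul_left, conj_trivial] using this
  · intro i _
    have := (integrable_test_smul (hψ i) hg).inner_const (𝕜 := ℝ) (b i)
    simpa only [inner_smul_left, conj_trivial, inner_gradient_left, real_inner_comm] using this

theorem H1.inner_toLp_gradL {Ω : Set (Euc d)} {X : Euc d → Euc d}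
    (hX : MemLp X 2 (volume.restrict Ω)) (φ : H1 Ω) :
    inner ℝ (hX.toLp X) (H1.gradL Ω φ) = ∫ x in Ω, inner ℝ (X x) (H1.grad φ x) := by
  rw [L2.inner_def]
  exact integral_congr_ae (hX.coeFn_toLp.mono fun x hx => by simp only [hx]; rfl)

theorem H1.inner_toLp_fnL {Ω : Set (Euc d)} {b : Euc d → ℝ}
    (hb : MemLp b 2 (volume.restrict Ω)) (φ : H1 Ω) :
    inner ℝ (hb.toLp b) (H1.fnL Ω φ) = ∫ x in Ω, b x * H1.fn φ x := by
  rw [L2.inner_def]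
  refine integral_congr_ae (hb.coeFn_toLp.mono fun x hx => ?_)
  simp only [hx]
  exact mul_comm _ _

theorem H1.inner_gradL_gradL {Ω : Set (Euc d)} (w φ : H1 Ω) :
    inner ℝ (H1.gradL Ω w) (H1.gradL Ω φ) = ∫ x in Ω, inner ℝ (H1.grad w x) (H1.grad φ x) :=
  L2.inner_def _ _

theorem H1.grad_ae_eq_of_contDiff {Ω : Set (Euc d)} (hΩ : IsOpen Ω) (hb : Bornology.IsBounded Ω)
    {f : Euc d → ℝ} {w : H1 Ω} (hf : ContDiff ℝ ∞ f) (hfc : HasCompactSupport f)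
    (hw : H1.fn w =ᵐ[volume.restrict Ω] f) : H1.grad w =ᵐ[volume.restrict Ω] ∇ f := by
  obtain ⟨K, hK⟩ := hf.lipschitzWith_of_hasCompactSupport hfc (by simp)
  exact H1.grad_ae_eq_gradient hΩ hb hK.lipschitzOnWith hw

theorem continuous_gradient_of_contDiff {f : Euc d → ℝ} (hf : ContDiff ℝ ∞ f) : Continuous (∇ f) :=
  (contDiff_iff_contDiffAt.2 fun _ => contDiffAt_gradient (n := 0) hf.contDiffAt).continuous

theorem integrable_inner_grad {Ω : Set (Euc d)} (hΩ : IsOpen Ω) (hb : Bornology.IsBounded Ω)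
    (u : H1 Ω) {X : Euc d → Euc d} (hX : Continuous X) :
    Integrable (fun x => inner ℝ (H1.grad u x) (X x)) (volume.restrict Ω) :=
  integrable_inner_of_memLp (H1.memLp_grad u) (memLp_restrict_of_continuous hΩ hb hX 2)

/-- The weak form of the mixed problem, tested with a smooth function: the part of the test function
near the singularity is a test function on `Ω`, and the remaining part vanishes near the
singularity. -/
theorem SolvesMixedProblem.integral_inner_gradient {Ω γ : Set (Euc d)} (hΩ : IsOpen Ω)
    (hb : Bornology.IsBounded Ω) {y : Euc d} {χ : ContDiffBump y}
    (hχ : Metric.closedBall y χ.rOut ⊆ Ω) {u : H1 Ω} (hu : SolvesMixedProblem Ω γ y u)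
    {φ : Euc d → ℝ} (hφ : ContDiff ℝ ∞ φ) (hφc : HasCompactSupport φ)
    (hφγ : ∀ᶠ x in 𝓝ˢ γ, φ x = 0) :
    ∫ x in Ω, inner ℝ (H1.grad u x) (∇ φ x)
      = - ∫ x in Ω, inner ℝ (∇ (fun x => fundamentalSolution d (x - y)) x)
          (∇ (fun x => (1 - χ x) * φ x) x) := by
  have hdχ : Differentiable ℝ χ := χ.contDiff.differentiable (n := 1) (by simp)
  have hdφ : Differentiable ℝ φ := hφ.differentiable (by simp)
  have hφχ : ContDiff ℝ ∞ (fun x => χ x * φ x) := χ.contDiff.mul hφ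
  have hφθ : ContDiff ℝ ∞ (fun x => (1 - χ x) * φ x) := (contDiff_const.sub χ.contDiff).mul hφ
  -- the part of `φ` near `y` is a test function
  have h1 : ∫ x in Ω, inner ℝ (H1.grad u x) (∇ (fun x => χ x * φ x) x) = 0 := by
    have ht : IsTestFunction Ω (fun x => χ x * φ x) :=
      ⟨hφχ, χ.hasCompactSupport.mul_right,
        (tsupport_mul_subset_left.trans (by rw [χ.tsupport_eq])).trans hχ⟩
    rw [(H1.hasWeakGradient u).integral_inner_gradient (H1.memLp_fn u) (H1.memLp_grad u) ht,
      hu.harmonic _ ht, neg_zero]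
  -- the remaining part vanishes near `y`
  have h2 : ∫ x in Ω, inner ℝ (H1.grad u x) (∇ (fun x => (1 - χ x) * φ x) x)
      = - ∫ x in Ω, inner ℝ (∇ (fun x => fundamentalSolution d (x - y)) x)
          (∇ (fun x => (1 - χ x) * φ x) x) := by
    have hc : HasCompactSupport (fun x => (1 - χ x) * φ x) := hφc.mul_left
    obtain ⟨K, hK⟩ := hφθ.lipschitzWith_of_hasCompactSupport hc (by simp)
    obtain ⟨w₂, e1, e2⟩ := H1.exists_of_lipschitzOnWith hΩ hb (hK.lipschitzOnWith (s := Ω))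
    have hw₂ : w₂ ∈ H1.vanishingOn Ω γ :=
      subset_closure ⟨_, hφθ, hc, hφγ.mono fun x hx => by rw [hx, mul_zero, Pi.zero_apply], e1⟩
    have := hu.neumann w₂ hw₂ ⟨χ.rIn, χ.rIn_pos, e1.mono fun x hx hxb => by
      simp only [hx, χ.one_of_mem_closedBall (Metric.ball_subset_closedBall hxb), sub_self,
        zero_mul]⟩
    unfold normalDerivativePairing at this
    have e3 : ∀ X : Euc d → Euc d, ∫ x in Ω, inner ℝ (X x) (H1.grad w₂ x)
        = ∫ x in Ω, inner ℝ (X x) (∇ (fun x => (1 - χ x) * φ x) x) := fun X =>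
      integral_congr_ae (e2.mono fun x hx => by simp only [hx])
    rw [e3, e3] at this
    exact this
  rw [← h2, ← zero_add (∫ x in Ω, inner ℝ (H1.grad u x) (∇ (fun x => (1 - χ x) * φ x) x)), ← h1,
    ← integral_add (integrable_inner_grad hΩ hb u (continuous_gradient_of_contDiff hφχ))
      (integrable_inner_grad hΩ hb u (continuous_gradient_of_contDiff hφθ))]
  refine integral_congr_ae (ae_of_all _ fun x => ?_)
  simp only
  rw [← inner_add_right, gradient_mul' (hdχ x) (hdφ x),
    gradient_mul' (by fun_prop) (hdφ x), gradient, gradient, gradient, fderiv_const_sub, map_neg]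
  congr 1
  module

/-- The cutoff function is moved from the test function to the fundamental solution; the terms that
arise contain `∇χ`, hence vanish near the singularity. -/
theorem integral_inner_gradient_cutoff {Ω : Set (Euc d)} (hΩ : IsOpen Ω)
    (hb : Bornology.IsBounded Ω) {y : Euc d} {χ : ContDiffBump y}
    {H : Euc d → ℝ} (hH : ContDiff ℝ ∞ H) {U : Set (Euc d)} (hU : IsOpen U) (hΩU : closure Ω ⊆ U)
    (hHU : ∀ x ∈ U, H x = (1 - χ x) * fundamentalSolution d (x - y))
    {φ : Euc d → ℝ} (hφ : ContDiff ℝ ∞ φ) :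
    ∫ x in Ω, inner ℝ (∇ (fun x => fundamentalSolution d (x - y)) x)
      (∇ (fun x => (1 - χ x) * φ x) x)
    = (∫ x in Ω, inner ℝ (∇ H x) (∇ φ x)) - (∫ x in Ω, inner ℝ (cutoffField χ x) (∇ φ x))
      - ∫ x in Ω, cutoffSource χ x * φ x := by
  have hdχ : Differentiable ℝ χ := χ.contDiff.differentiable (n := 1) (by simp)
  have hdφ : Differentiable ℝ φ := hφ.differentiable (by simp)
  have i1 : Integrable (fun x => inner ℝ (∇ H x) (∇ φ x)) (volume.restrict Ω) :=
    memLp_one_iff_integrable.1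
      (memLp_restrict_of_continuous hΩ hb
        ((continuous_gradient_of_contDiff hH).inner (continuous_gradient_of_contDiff hφ)) 1)
  have i2 : Integrable (fun x => inner ℝ (cutoffField χ x) (∇ φ x)) (volume.restrict Ω) :=
    memLp_one_iff_integrable.1 (memLp_restrict_of_continuous hΩ hb
      ((contDiff_cutoffField χ).continuous.inner (continuous_gradient_of_contDiff hφ)) 1)
  have i3 : Integrable (fun x => cutoffSource χ x * φ x) (volume.restrict Ω) :=
    memLp_one_iff_integrable.1 (memLp_restrict_of_continuous hΩ hb
      ((contDiff_cutoffSource χ).continuous.mul hφ.continuous) 1)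
  have i12 := i1.sub i2
  rw [← integral_sub i1 i2, ← integral_sub (by exact i12) i3]
  refine integral_congr_ae ?_
  filter_upwards [ae_restrict_mem hΩ.measurableSet] with x hx
  have hHx : H =ᶠ[𝓝 x] fun x => (1 - χ x) * fundamentalSolution d (x - y) := by
    filter_upwards [hU.mem_nhds (hΩU (subset_closure hx))] with z hz using hHU z hz
  rw [hHx.gradient_eq, gradient_one_sub_mul_fundamentalSolution, cutoffSource,
    gradient_mul' (by fun_prop) (hdφ x),
    show ∇ (fun x => 1 - χ x) x = - ∇ χ x by
      rw [gradient, gradient, fderiv_const_sub, map_neg]]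
  simp only [inner_add_left, inner_add_right, inner_smul_left, inner_smul_right, inner_neg_right,
    conj_trivial]
  ring

/-- The sum of a solution of the mixed problem and the cut-off fundamental solution vanishes on `γ`.
-/
theorem SolvesMixedProblem.add_mem_V {Ω γ : Set (Euc d)} (hΩ : IsOpen Ω)
    (hγ : γ ⊆ frontier Ω) {y : Euc d} {χ : ContDiffBump y}
    (hχ : Metric.closedBall y χ.rOut ⊆ Ω) {u : H1 Ω} (hu : SolvesMixedProblem Ω γ y u)
    {H : Euc d → ℝ} (hH : ContDiff ℝ ∞ H) (hHc : HasCompactSupport H) {U : Set (Euc d)}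
    (hU : IsOpen U) (hΩU : closure Ω ⊆ U)
    (hHU : ∀ x ∈ U, H x = (1 - χ x) * fundamentalSolution d (x - y)) {h : H1 Ω}
    (hh : H1.fn h =ᵐ[volume.restrict Ω] H) : u + h ∈ H1.V Ω γ := by
  refine map_mem_closure (f := fun w => w + h) (by fun_prop) hu.dirichlet ?_
  rintro w ⟨φ, hφ, hφc, hφγ, hw⟩
  refine ⟨fun x => φ x + H x, hφ.add hH, hφc.add hHc, ?_, ?_⟩
  · have h1 : ∀ᶠ x in 𝓝ˢ γ, x ∈ U :=
      hU.mem_nhdsSet.2 (hγ.trans (frontier_subset_closure.trans hΩU))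
    -- near `γ`, which lies outside the support of `χ`, the function `H` equals `Γ(· - y)`
    have h2 : ∀ᶠ x in 𝓝ˢ γ, x ∈ (Metric.closedBall y χ.rOut)ᶜ := by
      refine Metric.isClosed_closedBall.isOpen_compl.mem_nhdsSet.2 fun x hx hxb => ?_
      have := hγ hx
      rw [hΩ.frontier_eq] at this
      exact this.2 (hχ hxb)
    filter_upwards [hφγ, h1, h2] with x hx h1 h2
    rw [hx, hHU x h1, χ.zero_of_le_dist (le_of_lt (by simpa using h2)), sub_zero, one_mul,
      neg_add_cancel]
  · filter_upwards [H1.fn_add w h, hw, hh] with x h1 h2 h3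
    rw [h1, Pi.add_apply, h2, h3]

theorem SolvesMixedProblem.variational_of_contDiff {Ω γ : Set (Euc d)} (hΩ : IsOpen Ω)
    (hb : Bornology.IsBounded Ω) {y : Euc d} {χ : ContDiffBump y}
    (hχ : Metric.closedBall y χ.rOut ⊆ Ω) {u : H1 Ω} (hu : SolvesMixedProblem Ω γ y u)
    {H : Euc d → ℝ} (hH : ContDiff ℝ ∞ H) (hHc : HasCompactSupport H) {U : Set (Euc d)}
    (hU : IsOpen U) (hΩU : closure Ω ⊆ U)
    (hHU : ∀ x ∈ U, H x = (1 - χ x) * fundamentalSolution d (x - y)) {h : H1 Ω}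
    (hh : H1.fn h =ᵐ[volume.restrict Ω] H) {φ : Euc d → ℝ} (hφ : ContDiff ℝ ∞ φ)
    (hφc : HasCompactSupport φ) (hφγ : ∀ᶠ x in 𝓝ˢ γ, φ x = 0) {w : H1 Ω}
    (hw : H1.fn w =ᵐ[volume.restrict Ω] φ) :
    ∫ x in Ω, inner ℝ (H1.grad (u + h) x) (H1.grad w x)
      = (∫ x in Ω, inner ℝ (cutoffField χ x) (H1.grad w x))
        + ∫ x in Ω, cutoffSource χ x * H1.fn w x := by
  have h5 : H1.grad (u + h) =ᵐ[volume.restrict Ω] fun x => H1.grad u x + ∇ H x :=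
    (H1.grad_add u h).trans
      ((EventuallyEq.refl _ _).add (H1.grad_ae_eq_of_contDiff hΩ hb hH hHc hh))
  have h6 : ∫ x in Ω, inner ℝ (H1.grad (u + h) x) (H1.grad w x)
      = (∫ x in Ω, inner ℝ (H1.grad u x) (∇ φ x)) + ∫ x in Ω, inner ℝ (∇ H x) (∇ φ x) := by
    rw [← integral_add (integrable_inner_grad hΩ hb u (continuous_gradient_of_contDiff hφ))
      (memLp_one_iff_integrable.1 (memLp_restrict_of_continuous hΩ hb
        ((continuous_gradient_of_contDiff hH).inner (continuous_gradient_of_contDiff hφ)) 1))]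
    refine integral_congr_ae ?_
    filter_upwards [h5, H1.grad_ae_eq_of_contDiff hΩ hb hφ hφc hw] with x e1 e2
    rw [e1, e2, inner_add_left]
  have h7 : ∫ x in Ω, inner ℝ (cutoffField χ x) (H1.grad w x)
      = ∫ x in Ω, inner ℝ (cutoffField χ x) (∇ φ x) :=
    integral_congr_ae ((H1.grad_ae_eq_of_contDiff hΩ hb hφ hφc hw).mono fun x hx => by
      simp only [hx])
  have h8 : ∫ x in Ω, cutoffSource χ x * H1.fn w x = ∫ x in Ω, cutoffSource χ x * φ x :=
    integral_congr_ae (hw.mono fun x hx => by simp only [hx])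
  rw [h6, h7, h8, hu.integral_inner_gradient hΩ hb hχ hφ hφc hφγ,
    integral_inner_gradient_cutoff hΩ hb hH hU hΩU hHU hφ]
  ring

theorem H1.inner_gradL_eq_of_forall_smooth {Ω γ : Set (Euc d)}
    {X Y : Lp (Euc d) 2 (volume.restrict Ω)} {S : Lp ℝ 2 (volume.restrict Ω)}
    (h : ∀ w ∈ H1.smoothVanishing Ω γ,
      inner ℝ Y (H1.gradL Ω w) = inner ℝ X (H1.gradL Ω w) + inner ℝ S (H1.fnL Ω w))
    {φ : H1 Ω} (hφ : φ ∈ H1.V Ω γ) :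
    inner ℝ Y (H1.gradL Ω φ) = inner ℝ X (H1.gradL Ω φ) + inner ℝ S (H1.fnL Ω φ) := by
  have h1 := (H1.gradL Ω).continuous
  have h2 := (H1.fnL Ω).continuous
  have hclosed : IsClosed {φ : H1 Ω | inner ℝ Y (H1.gradL Ω φ)
      = inner ℝ X (H1.gradL Ω φ) + inner ℝ S (H1.fnL Ω φ)} :=
    isClosed_eq (continuous_const.inner h1)
      ((continuous_const.inner h1).add (continuous_const.inner h2))
  exact closure_minimal (s := (H1.smoothVanishing Ω γ : Set (H1 Ω))) h hclosed hφ

/-- The sum of a solution of the mixed problem and the cut-off fundamental solution solves a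
variational problem on the space of all functions vanishing on `γ`, with data that are of class
`C¹` and do not depend on the domain. -/
theorem SolvesMixedProblem.variational {Ω γ : Set (Euc d)} (hΩ : IsOpen Ω)
    (hb : Bornology.IsBounded Ω) {y : Euc d} {χ : ContDiffBump y}
    (hχ : Metric.closedBall y χ.rOut ⊆ Ω) {u : H1 Ω} (hu : SolvesMixedProblem Ω γ y u)
    {H : Euc d → ℝ} (hH : ContDiff ℝ ∞ H) (hHc : HasCompactSupport H) {U : Set (Euc d)}
    (hU : IsOpen U) (hΩU : closure Ω ⊆ U)
    (hHU : ∀ x ∈ U, H x = (1 - χ x) * fundamentalSolution d (x - y)) {h : H1 Ω}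
    (hh : H1.fn h =ᵐ[volume.restrict Ω] H) {φ : H1 Ω} (hφ : φ ∈ H1.V Ω γ) :
    ∫ x in Ω, inner ℝ (H1.grad (u + h) x) (H1.grad φ x)
      = (∫ x in Ω, inner ℝ (cutoffField χ x) (H1.grad φ x))
        + ∫ x in Ω, cutoffSource χ x * H1.fn φ x := by
  have hX := memLp_restrict_of_continuous hΩ hb (contDiff_cutoffField χ).continuous 2
  have hS := memLp_restrict_of_continuous hΩ hb (contDiff_cutoffSource χ).continuous 2
  obtain ⟨X, hX⟩ : ∃ X : Lp (Euc d) 2 (volume.restrict Ω), ∀ φ : H1 Ω,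
      inner ℝ X (H1.gradL Ω φ) = ∫ x in Ω, inner ℝ (cutoffField χ x) (H1.grad φ x) :=
    ⟨_, H1.inner_toLp_gradL hX⟩
  obtain ⟨S, hS⟩ : ∃ S : Lp ℝ 2 (volume.restrict Ω), ∀ φ : H1 Ω,
      inner ℝ S (H1.fnL Ω φ) = ∫ x in Ω, cutoffSource χ x * H1.fn φ x :=
    ⟨_, H1.inner_toLp_fnL hS⟩
  have hs : ∀ w ∈ H1.smoothVanishing Ω γ, ∫ x in Ω, inner ℝ (H1.grad (u + h) x) (H1.grad w x)
      = (∫ x in Ω, inner ℝ (cutoffField χ x) (H1.grad w x))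
        + ∫ x in Ω, cutoffSource χ x * H1.fn w x := by
    rintro w ⟨φ, hφ, hφc, hφγ, hw⟩
    exact hu.variational_of_contDiff hΩ hb hχ hH hHc hU hΩU hHU hh hφ hφc hφγ hw
  generalize u + h = w₀ at hs ⊢
  refine (H1.inner_gradL_gradL w₀ φ).symm.trans
    ((H1.inner_gradL_eq_of_forall_smooth (X := X) (S := S) (fun w hw => ?_) hφ).trans
      (congrArg₂ (· + ·) (hX φ) (hS φ)))
  exact (H1.inner_gradL_gradL w₀ w).trans
    ((hs w hw).trans (congrArg₂ (· + ·) (hX w) (hS w)).symm)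

/-! ### The transformed coefficients -/

theorem contDiff_det : ContDiff ℝ 1 (fun A : Euc d →L[ℝ] Euc d => A.det) := by
  set b := EuclideanSpace.basisFun (Fin d) ℝ
  have h : (fun A : Euc d →L[ℝ] Euc d => A.det) = fun A =>
      ∑ σ : Equiv.Perm (Fin d), Equiv.Perm.sign σ • ∏ i, inner ℝ (b (σ i)) (A (b i)) := by
    funext A
    rw [ContinuousLinearMap.det, ← LinearMap.det_toMatrix b.toBasis, Matrix.det_apply]
    simp only [LinearMap.toMatrix_apply, OrthonormalBasis.coe_toBasis_repr_apply,
      OrthonormalBasis.repr_apply_apply, OrthonormalBasis.coe_toBasis,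
      ContinuousLinearMap.coe_coe]
  rw [h]
  refine ContDiff.sum fun σ _ => ContDiff.const_smul _ (contDiff_prod fun i _ => ?_)
  exact contDiff_const.inner ℝ (contDiff_id.clm_apply contDiff_const)

theorem isInvertible_of_det_ne_zero {A : Euc d →L[ℝ] Euc d} (h : A.det ≠ 0) : A.IsInvertible :=
  ⟨A.toContinuousLinearEquivOfDetNeZero h, A.coe_toContinuousLinearEquivOfDetNeZero h⟩

/-- The coefficient matrix `|det A| A⁻¹ A⁻ᵀ` of the transformed Laplacian. -/
def transformedMatrix (q : Euc d × (Euc d →L[ℝ] Euc d)) : Euc d →L[ℝ] Euc d :=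
  |q.2.det| • (q.2.inverse ∘L ContinuousLinearMap.adjoint q.2.inverse)

/-- The transformed field `|det A| A⁻¹ X(x)`. -/
def transformedField (X : Euc d → Euc d) (q : Euc d × (Euc d →L[ℝ] Euc d)) : Euc d :=
  |q.2.det| • q.2.inverse (X q.1)

/-- The transformed source `|det A| S(x)`. -/
def transformedSource (S : Euc d → ℝ) (q : Euc d × (Euc d →L[ℝ] Euc d)) : ℝ :=
  |q.2.det| * S q.1

theorem contDiff_adjoint :
    ContDiff ℝ 1 (fun A : Euc d →L[ℝ] Euc d => ContinuousLinearMap.adjoint A) :=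
  (ContinuousLinearMap.adjoint (𝕜 := ℝ) (E := Euc d) (F := Euc d)).contDiff

theorem contDiffOn_abs_det :
    ContDiffOn ℝ 1 (fun q : Euc d × (Euc d →L[ℝ] Euc d) => |q.2.det|) (invertiblePairs d) :=
  fun q hq => (ContDiffAt.abs ((contDiff_det.comp contDiff_snd).contDiffAt (x := q))
    hq).contDiffWithinAt

theorem contDiffOn_inverse :
    ContDiffOn ℝ 1 (fun q : Euc d × (Euc d →L[ℝ] Euc d) => q.2.inverse) (invertiblePairs d) := by
  intro q hq
  obtain ⟨e, he⟩ := isInvertible_of_det_ne_zero hq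
  have h : ContDiffAt ℝ 1 (ContinuousLinearMap.inverse : (Euc d →L[ℝ] Euc d) → _) q.2 := by
    rw [← he]
    exact contDiffAt_map_inverse e
  exact (h.comp q contDiffAt_snd).contDiffWithinAt

theorem contDiffOn_transformedMatrix :
    ContDiffOn ℝ 1 (transformedMatrix (d := d)) (invertiblePairs d) :=
  contDiffOn_abs_det.smul (contDiffOn_inverse.clm_comp
    (contDiff_adjoint.comp_contDiffOn contDiffOn_inverse))

theorem contDiffOn_transformedField {X : Euc d → Euc d} (hX : ContDiff ℝ 1 X) :
    ContDiffOn ℝ 1 (transformedField X) (invertiblePairs d) :=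
  contDiffOn_abs_det.smul (contDiffOn_inverse.clm_apply (hX.comp contDiff_fst).contDiffOn)

theorem contDiffOn_transformedSource {S : Euc d → ℝ} (hS : ContDiff ℝ 1 S) :
    ContDiffOn ℝ 1 (transformedSource S) (invertiblePairs d) :=
  contDiffOn_abs_det.mul (hS.comp contDiff_fst).contDiffOn

theorem adjoint_inverse_adjoint {A : Euc d →L[ℝ] Euc d} (h : A.IsInvertible) (z : Euc d) :
    ContinuousLinearMap.adjoint A.inverse (ContinuousLinearMap.adjoint A z) = z := by
  rw [← ContinuousLinearMap.comp_apply, ← ContinuousLinearMap.adjoint_comp, h.self_comp_inverse,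
    ContinuousLinearMap.adjoint_id]
  rfl

theorem apply_inverse {A : Euc d →L[ℝ] Euc d} (h : A.IsInvertible) (z : Euc d) :
    A (A.inverse z) = z := by
  rw [← ContinuousLinearMap.comp_apply, h.self_comp_inverse]
  rfl

/-- The gradients of `w ∘ T` and `φ ∘ T` are `DTᵀ ∇w` and `DTᵀ ∇φ`; in terms of them, the matrix
represents `|det DT| ∇w · ∇φ`. -/
theorem inner_transformedMatrix {q : Euc d × (Euc d →L[ℝ] Euc d)} (hq : q ∈ invertiblePairs d)
    (z z' : Euc d) : inner ℝ (transformedMatrix q (ContinuousLinearMap.adjoint q.2 z))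
      (ContinuousLinearMap.adjoint q.2 z') = |q.2.det| * inner ℝ z z' := by
  have h := isInvertible_of_det_ne_zero hq
  rw [transformedMatrix, _root_.smul_apply, ContinuousLinearMap.comp_apply,
    adjoint_inverse_adjoint h, inner_smul_left, ContinuousLinearMap.adjoint_inner_right,
    apply_inverse h]
  rfl

theorem inner_transformedField {X : Euc d → Euc d} {q : Euc d × (Euc d →L[ℝ] Euc d)}
    (hq : q ∈ invertiblePairs d) (z' : Euc d) :
    inner ℝ (transformedField X q) (ContinuousLinearMap.adjoint q.2 z')
      = |q.2.det| * inner ℝ (X q.1) z' := by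
  rw [transformedField, inner_smul_left, ContinuousLinearMap.adjoint_inner_right,
    apply_inverse (isInvertible_of_det_ne_zero hq)]
  rfl

/-- The transformed matrix is uniformly positive definite. -/
theorem exists_transformedMatrix_coercive (R : ℝ) {c : ℝ} (hc : 0 < c) :
    ∃ κ > 0, ∀ q ∈ boundedPairs d R c, ∀ v, κ * ‖v‖ ^ 2 ≤ inner ℝ (transformedMatrix q v) v := by
  obtain ⟨κ, hκ, hκb⟩ := exists_pos_le_abs_det (d := d) R hc
  refine ⟨κ / (R ^ 2 + 1), by positivity, fun q hq v => ?_⟩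
  have hinv := isInvertible_of_det_ne_zero (boundedPairs_subset_invertiblePairs hc hq)
  set z := ContinuousLinearMap.adjoint q.2.inverse v with hz
  have hv : ContinuousLinearMap.adjoint q.2 z = v := by
    rw [hz, ← ContinuousLinearMap.comp_apply, ← ContinuousLinearMap.adjoint_comp,
      hinv.inverse_comp_self, ContinuousLinearMap.adjoint_id]
    rfl
  have hle : ‖v‖ ≤ R * ‖z‖ := by
    have := (ContinuousLinearMap.adjoint q.2).le_opNorm z
    rw [hv, LinearIsometryEquiv.norm_map] at this
    exact this.trans (by gcongr; exact hq.2.1)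
  have hR : 0 ≤ R := (norm_nonneg _).trans hq.2.1
  have h2 : ‖v‖ ^ 2 ≤ (R ^ 2 + 1) * ‖z‖ ^ 2 := by
    calc ‖v‖ ^ 2 ≤ (R * ‖z‖) ^ 2 := by gcongr
      _ ≤ _ := by rw [mul_pow]; gcongr; linarith
  have h3 := inner_transformedMatrix (boundedPairs_subset_invertiblePairs hc hq) z z
  rw [hv] at h3
  rw [h3, real_inner_self_eq_norm_sq, div_mul_eq_mul_div, div_le_iff₀ (by positivity)]
  calc κ * ‖v‖ ^ 2 ≤ |q.2.det| * ((R ^ 2 + 1) * ‖z‖ ^ 2) := by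
        gcongr
        exact hκb q hq
    _ = _ := by ring

/-! ### Differentiability of the solution of a variational problem -/

section Lp

variable {α G : Type*} [MeasurableSpace α] {μ : Measure α} [NormedAddCommGroup G] [NormedSpace ℝ G]

theorem IsBddC1.exists_Lp [IsFiniteMeasure μ] {I : Set ℝ} (hI : IsOpen I) {M : ℝ}
    {F F' : ℝ → α → G} (h : IsBddC1 μ I M F F') (hb : ∀ t ∈ I, ∃ C, ∀ᵐ x ∂μ, ‖F t x‖ ≤ C)
    (p : ℝ≥0∞) : ∃ a a' : ℝ → Lp G p μ, IsBddC1 μ I M (fun t => a t) (fun t => a' t) ∧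
      (∀ t ∈ I, a t =ᵐ[μ] F t) ∧ ∀ t ∈ I, a' t =ᵐ[μ] F' t := by
  classical
  have h1 : ∀ t ∈ I, MemLp (F t) p μ := fun t ht => by
    obtain ⟨C, hC⟩ := hb t ht
    exact MemLp.of_bound (h.meas t ht) C hC
  have h2 : ∀ t ∈ I, MemLp (F' t) p μ := fun t ht =>
    MemLp.of_bound (h.meas_deriv t ht) M (h.bound t ht)
  set a : ℝ → Lp G p μ := fun t => if ht : t ∈ I then (h1 t ht).toLp else 0 with ha
  set a' : ℝ → Lp G p μ := fun t => if ht : t ∈ I then (h2 t ht).toLp else 0 with ha'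
  have e1 : ∀ t ∈ I, a t =ᵐ[μ] F t := fun t ht => by
    simp only [ha, dif_pos ht]
    exact (h1 t ht).coeFn_toLp
  have e2 : ∀ t ∈ I, a' t =ᵐ[μ] F' t := fun t ht => by
    simp only [ha', dif_pos ht]
    exact (h2 t ht).coeFn_toLp
  exact ⟨a, a', h.congr hI (fun t ht => (e1 t ht).symm) (fun t ht => (e2 t ht).symm), e1,
    e2⟩

end Lp

theorem IsBddC1.exists_Lp_comp {α G' : Type*} [MeasurableSpace α] {μ : Measure α}
    [IsFiniteMeasure μ] [NormedAddCommGroup G'] [NormedSpace ℝ G'] [FiniteDimensional ℝ G']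
    {I : Set ℝ} (hI : IsOpen I) {M R c : ℝ} (hM : 0 ≤ M) (hc : 0 < c)
    {F F' : ℝ → α → Euc d × (Euc d →L[ℝ] Euc d)} (h : IsBddC1 μ I M F F')
    (hF : ∀ t ∈ I, ∀ᵐ x ∂μ, F t x ∈ boundedPairs d R c)
    {Φ : Euc d × (Euc d →L[ℝ] Euc d) → G'} (hΦ : ContDiffOn ℝ 1 Φ (invertiblePairs d))
    (p : ℝ≥0∞) : ∃ M', 0 ≤ M' ∧ ∃ a a' : ℝ → Lp G' p μ,
      IsBddC1 μ I M' (fun t => a t) (fun t => a' t) ∧ ∀ t ∈ I, a t =ᵐ[μ] fun x => Φ (F t x) := by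
  have hK := isCompact_boundedPairs d R c
  have hKU := boundedPairs_subset_invertiblePairs (d := d) (R := R) hc
  obtain ⟨M', hM', h'⟩ := h.comp hI hM (isOpen_invertiblePairs d) hK hKU hΦ hF
  obtain ⟨C, hC⟩ := hK.exists_bound_of_continuousOn (hΦ.continuousOn.mono hKU)
  obtain ⟨a, a', h1, h2, -⟩ := h'.exists_Lp hI
    (fun t ht => ⟨C, (hF t ht).mono fun x hx => hC _ hx⟩) p
  exact ⟨M', hM', a, a', h1, h2⟩

/-- The solutions of a family of coercive variational problems in divergence form depend on the
parameter in a continuously differentiable way if the coefficients and the data do. -/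
theorem contDiffOn_of_variational {α : Type*} [MeasurableSpace α] {μ : Measure α}
    [IsFiniteMeasure μ] {V : Type*} [NormedAddCommGroup V] [InnerProductSpace ℝ V] [CompleteSpace V]
    (D : V →L[ℝ] Lp (Euc d) 2 μ) (ι : V →L[ℝ] Lp ℝ 2 μ) {C : ℝ} (hC : 0 < C)
    (hD : ∀ g, ‖g‖ ^ 2 ≤ C * ‖D g‖ ^ 2) {I : Set ℝ} (hI : IsOpen I) {M₁ M₂ M₃ κ : ℝ}
    (hM₁ : 0 ≤ M₁) (hκ : 0 < κ) {a a' : ℝ → Lp (Euc d →L[ℝ] Euc d) ∞ μ}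
    (ha : IsBddC1 μ I M₁ (fun t => a t) (fun t => a' t))
    (hcoer : ∀ t ∈ I, ∀ᵐ x ∂μ, ∀ v, κ * ‖v‖ ^ 2 ≤ inner ℝ (a t x v) v)
    {X X' : ℝ → Lp (Euc d) 2 μ} (hX : IsBddC1 μ I M₂ (fun t => X t) (fun t => X' t))
    {S S' : ℝ → Lp ℝ 2 μ} (hS : IsBddC1 μ I M₃ (fun t => S t) (fun t => S' t)) {w : ℝ → V}
    (hw : ∀ t ∈ I, ∀ φ, inner ℝ (mulOp (a t) (D (w t))) (D φ)
      = inner ℝ (X t) (D φ) + inner ℝ (S t) (ι φ)) : ContDiffOn ℝ 1 w I := by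
  set D' := ContinuousLinearMap.adjoint D
  set ι' := ContinuousLinearMap.adjoint ι
  refine contDiffOn_of_coercive_equation (c := κ / C) (C := ‖D'‖ * (M₁ * ‖D‖)) hI
    (L := fun t => D' ∘L mulOp (a t) ∘L D) (L' := fun t => D' ∘L mulOp (a' t) ∘L D)
    (f := fun t => D' (X t) + ι' (S t)) (f' := fun t => D' (X' t) + ι' (S' t)) (by positivity)
    ?_ ?_ ?_ ?_ ?_ ?_ ?_
  · intro t ht g
    rw [ContinuousLinearMap.comp_apply, ContinuousLinearMap.comp_apply,
      ContinuousLinearMap.adjoint_inner_left, L2.inner_def]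
    have h1 : κ * ‖D g‖ ^ 2 ≤ ∫ x, inner ℝ (mulOp (a t) (D g) x) (D g x) ∂μ := by
      rw [← real_inner_self_eq_norm_sq, L2.inner_def, ← integral_const_mul]
      refine integral_mono_ae ((L2.integrable_inner _ _).const_mul _) (L2.integrable_inner _ _) ?_
      filter_upwards [coeFn_mulOp (a t) (D g), hcoer t ht] with x h1 h2
      rw [h1, real_inner_self_eq_norm_sq]
      exact h2 _
    refine le_trans ?_ h1
    rw [div_mul_eq_mul_div, div_le_iff₀ hC, mul_assoc]
    refine mul_le_mul_of_nonneg_left ?_ hκ.le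
    rw [mul_comm]
    exact hD g
  · intro t ht g
    exact D'.hasFDerivAt.comp_hasDerivAt t (ha.hasDerivAt_mulOp hI ht (D g))
  · intro g
    exact D'.continuous.comp_continuousOn (ha.continuousOn_mulOp hI (D g))
  · intro t ht
    refine (ContinuousLinearMap.opNorm_comp_le _ _).trans ?_
    gcongr
    refine (ContinuousLinearMap.opNorm_comp_le _ _).trans ?_
    gcongr
    exact norm_mulOp_le _ hM₁ (ha.bound t ht)
  · intro t ht
    exact (D'.hasFDerivAt.comp_hasDerivAt t (hX.hasDerivAt ht)).add
      (ι'.hasFDerivAt.comp_hasDerivAt t (hS.hasDerivAt ht))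
  · exact (D'.continuous.comp_continuousOn hX.continuousOn_deriv).add
      (ι'.continuous.comp_continuousOn hS.continuousOn_deriv)
  · intro t ht
    refine ext_inner_right ℝ fun φ => ?_
    rw [ContinuousLinearMap.comp_apply, ContinuousLinearMap.comp_apply,
      ContinuousLinearMap.adjoint_inner_left, inner_add_left,
      ContinuousLinearMap.adjoint_inner_left, ContinuousLinearMap.adjoint_inner_left, hw t ht]

/-! ### Regularity in time of the transported solution -/

section

set_option synthInstance.maxHeartbeats 200000

instance H1.instNormedSpaceV (Ω γ : Set (Euc d)) : NormedSpace ℝ (H1.V Ω γ) :=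
  InnerProductSpace.toNormedSpace

/-- The restriction to `V` of the embedding of `H¹` into `L²`. -/
def H1.fnV (Ω γ : Set (Euc d)) : H1.V Ω γ →L[ℝ] Lp ℝ 2 (volume.restrict Ω) :=
  (H1.fnL Ω).comp (H1.V Ω γ).subtypeL

/-- The restriction to `V` of the gradient. -/
def H1.gradV (Ω γ : Set (Euc d)) : H1.V Ω γ →L[ℝ] Lp (Euc d) 2 (volume.restrict Ω) :=
  (H1.gradL Ω).comp (H1.V Ω γ).subtypeL

end

theorem H1.contDiff_coe_V {Ω γ : Set (Euc d)} : ContDiff ℝ 1 (fun w : H1.V Ω γ => (w : H1 Ω)) :=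
  IsBoundedLinearMap.contDiff
    ⟨(H1.V Ω γ).subtype.isLinear, 1, one_pos, fun x => by rw [one_mul]; rfl⟩

namespace IsBiLip

variable {Ω γ : Set (Euc d)} {T : Euc d → Euc d}

theorem ae_mem_invertiblePairs (h : IsBiLip Ω T) :
    ∀ᵐ x ∂(volume.restrict Ω), (T x, fderiv ℝ T x) ∈ invertiblePairs d := by
  obtain ⟨K, c, κ, κ', -, hκ, hae⟩ := h.exists_det_bounds
  filter_upwards [hae] with x hx
  exact abs_pos.1 (hκ.trans_le hx.2.2.2.1)

/-- The transformation of a variational problem under a bi-Lipschitz change of variables. -/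
theorem exists_variational_comp (h : IsBiLip Ω T) (hγ : IsCompact γ) (hγΩ : γ ⊆ closure Ω)
    {X : Euc d → Euc d} {S : Euc d → ℝ} {w : H1 (T '' Ω)} (hw : w ∈ H1.V (T '' Ω) (T '' γ))
    (heq : ∀ φ ∈ H1.V (T '' Ω) (T '' γ), ∫ x in T '' Ω, inner ℝ (H1.grad w x) (H1.grad φ x)
      = (∫ x in T '' Ω, inner ℝ (X x) (H1.grad φ x)) + ∫ x in T '' Ω, S x * H1.fn φ x) :
    ∃ w' ∈ H1.V Ω γ, H1.fn w' =ᵐ[volume.restrict Ω] (fun x => H1.fn w (T x)) ∧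
      ∀ φ ∈ H1.V Ω γ,
        ∫ x in Ω, inner ℝ (transformedMatrix (T x, fderiv ℝ T x) (H1.grad w' x)) (H1.grad φ x)
          = (∫ x in Ω, inner ℝ (transformedField X (T x, fderiv ℝ T x)) (H1.grad φ x))
            + ∫ x in Ω, transformedSource S (T x, fderiv ℝ T x) * H1.fn φ x := by
  obtain ⟨w', hw', h1, h2⟩ := h.exists_comp_mem_vanishingOn hγ hγΩ hw
  refine ⟨w', hw', h1, fun φ hφ => ?_⟩
  obtain ⟨ψ, hψ, h3, h4⟩ := h.exists_comp_eq hγ hγΩ hφ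
  have e1 : ∫ x in Ω, inner ℝ (transformedMatrix (T x, fderiv ℝ T x) (H1.grad w' x))
      (H1.grad φ x) = ∫ x in T '' Ω, inner ℝ (H1.grad w x) (H1.grad ψ x) := by
    rw [h.integral_image]
    refine integral_congr_ae ?_
    filter_upwards [h2, h4, h.ae_mem_invertiblePairs] with x e2 e4 hx
    rw [e2, e4]
    exact inner_transformedMatrix hx _ _
  have e2 : ∫ x in Ω, inner ℝ (transformedField X (T x, fderiv ℝ T x)) (H1.grad φ x)
      = ∫ x in T '' Ω, inner ℝ (X x) (H1.grad ψ x) := by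
    rw [h.integral_image]
    refine integral_congr_ae ?_
    filter_upwards [h4, h.ae_mem_invertiblePairs] with x e4 hx
    rw [e4]
    exact inner_transformedField hx _
  have e3 : ∫ x in Ω, transformedSource S (T x, fderiv ℝ T x) * H1.fn φ x
      = ∫ x in T '' Ω, S x * H1.fn ψ x := by
    rw [h.integral_image]
    refine integral_congr_ae ?_
    filter_upwards [h3] with x e3
    rw [e3, transformedSource, mul_assoc]
  rw [e1, e2, e3]
  exact heq ψ hψ

theorem exists_comp_of_contDiff (h : IsBiLip Ω T) {H : Euc d → ℝ} (hH : ContDiff ℝ ∞ H)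
    (hHc : HasCompactSupport H) : ∃ w : H1 Ω, H1.fn w =ᵐ[volume.restrict Ω] (fun x => H (T x)) ∧
      H1.grad w =ᵐ[volume.restrict Ω] pullGrad T (∇ H) := by
  obtain ⟨K, hK⟩ := hH.lipschitzWith_of_hasCompactSupport hHc (by simp)
  obtain ⟨K', hK'⟩ := h.lipschitz
  obtain ⟨w, h1, h2⟩ := H1.exists_of_lipschitzOnWith h.isOpen h.isBounded
    (hK.comp_lipschitzOnWith (hK'.mono subset_closure))
  refine ⟨w, h1, h2.trans ?_⟩
  filter_upwards [h.ae_differentiableAt] with x hx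
  exact gradient_comp (hH.differentiable (by simp) _) hx

end IsBiLip

/-- A family in `H¹` is of class `C¹` if its members and their gradients are. -/
theorem H1.contDiffOn {Ω : Set (Euc d)} {I : Set ℝ} (hI : IsOpen I) {M M' : ℝ} {h : ℝ → H1 Ω}
    {a a' : ℝ → Lp ℝ 2 (volume.restrict Ω)} {b b' : ℝ → Lp (Euc d) 2 (volume.restrict Ω)}
    (ha : IsBddC1 (volume.restrict Ω) I M (fun t => a t) (fun t => a' t))
    (hb : IsBddC1 (volume.restrict Ω) I M' (fun t => b t) (fun t => b' t))
    (hfn : ∀ t ∈ I, H1.fnL Ω (h t) = a t) (hgrad : ∀ t ∈ I, H1.gradL Ω (h t) = b t) :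
    ContDiffOn ℝ 1 h I := by
  have h1 : ContDiffOn ℝ 1 a I :=
    contDiffOn_one_of_hasDerivAt hI (fun t ht => ha.hasDerivAt ht) ha.continuousOn_deriv
  have h2 : ContDiffOn ℝ 1 b I :=
    contDiffOn_one_of_hasDerivAt hI (fun t ht => hb.hasDerivAt ht) hb.continuousOn_deriv
  have h3 : ContDiffOn ℝ 1 (fun t => WithLp.toLp 2 (a t, b t)) I :=
    (WithLp.prodContinuousLinearEquiv 2 ℝ (Lp ℝ 2 (volume.restrict Ω))
      (Lp (Euc d) 2 (volume.restrict Ω))).symm.contDiff.comp_contDiffOn (h1.prodMk h2)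
  refine (((H1 Ω).orthogonalProjectionOnto).contDiff.comp_contDiffOn h3).congr fun t ht => ?_
  have h4 : WithLp.toLp 2 (a t, b t) = (h t : WithLp 2 _) := by
    rw [← hfn t ht, ← hgrad t ht]
    rfl
  rw [Function.comp_apply, h4, Submodule.orthogonalProjectionOnto_mem_subspace_eq_self]

set_option maxHeartbeats 1000000 in
set_option synthInstance.maxHeartbeats 200000 in
/-- The transport of a solution of the mixed problem to the reference domain, as the difference of
the solution of the transformed variational problem and the transported cut-off fundamental
solution. -/
theorem SolvesMixedProblem.exists_transport {Ω γ : Set (Euc d)} {T : Euc d → Euc d}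
    (hb : IsBiLip Ω T) (hγc : IsCompact γ) (hγf : γ ⊆ frontier Ω) {y : Euc d} {χ : ContDiffBump y}
    (hχ : Metric.closedBall y χ.rOut ⊆ T '' Ω) {u : H1 (T '' Ω)}
    (hu : SolvesMixedProblem (T '' Ω) (T '' γ) y u) {H : Euc d → ℝ} (hH : ContDiff ℝ ∞ H)
    (hHc : HasCompactSupport H) {U : Set (Euc d)} (hU : IsOpen U) (hsubU : closure (T '' Ω) ⊆ U)
    (hHU : ∀ x ∈ U, H x = (1 - χ x) * fundamentalSolution d (x - y)) :
    ∃ w ∈ H1.V Ω γ, ∃ h : H1 Ω,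
      H1.fn (w - h) =ᵐ[volume.restrict Ω] (fun x => H1.fn u (T x)) ∧
      H1.fn h =ᵐ[volume.restrict Ω] (fun x => H (T x)) ∧
      H1.grad h =ᵐ[volume.restrict Ω] IsBiLip.pullGrad T (∇ H) ∧
      ∀ φ ∈ H1.V Ω γ, ∫ x in Ω,
      inner ℝ (transformedMatrix (T x, fderiv ℝ (T) x) (H1.grad w x)) (H1.grad φ x)
        = (∫ x in Ω, inner ℝ (transformedField (cutoffField χ) (T x, fderiv ℝ (T) x))
            (H1.grad φ x))
          + ∫ x in Ω, transformedSource (cutoffSource χ) (T x, fderiv ℝ (T) x) * H1.fn φ x := by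
  obtain ⟨K, hK⟩ := hH.lipschitzWith_of_hasCompactSupport hHc (by simp)
  obtain ⟨k, hk, -⟩ := H1.exists_of_lipschitzOnWith hb.isOpen_image hb.isBounded_image
    (hK.lipschitzOnWith (s := T '' Ω))
  have hmem := hu.add_mem_V hb.isOpen_image
    (by rw [hb.frontier_image]; exact image_mono hγf) hχ hH hHc hU hsubU hHU hk
  have hvar := fun (φ : H1 (T '' Ω)) (hφ : φ ∈ H1.V (T '' Ω) (T '' γ)) =>
    hu.variational hb.isOpen_image hb.isBounded_image hχ hH hHc hU hsubU hHU hk hφ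
  have hadd := hb.ae_comp (H1.fn_add u k)
  generalize u + k = w₀ at hmem hvar hadd
  obtain ⟨w, hw, hw1, hw2⟩ :=
    hb.exists_variational_comp hγc (hγf.trans frontier_subset_closure) hmem hvar
  obtain ⟨h, hh1, hh2⟩ := hb.exists_comp_of_contDiff hH hHc
  refine ⟨w, hw, h, ?_, hh1, hh2, hw2⟩
  filter_upwards [H1.fn_sub w h, hw1, hh1, hb.ae_comp hk, hadd] with x e1 e2 e3 e4 e5
  rw [e1, Pi.sub_apply, e2, e3, e5, Pi.add_apply, e4, add_sub_cancel_right]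

theorem L2_inner_eq_integral_of_ae {α E : Type*} [MeasurableSpace α] {μ : Measure α}
    [NormedAddCommGroup E] [InnerProductSpace ℝ E] (f g : Lp E 2 μ) {f' : α → E}
    (h : f =ᵐ[μ] f') : inner ℝ f g = ∫ x, inner ℝ (f' x) (g x) ∂μ := by
  rw [L2.inner_def]
  exact integral_congr_ae (h.mono fun x hx => by simp only [hx])

set_option maxHeartbeats 1000000 in
set_option synthInstance.maxHeartbeats 200000 in
/-- The solutions of the transformed variational problems are of class `C¹` in time. -/
theorem IsBoundedLipschitzDomain.contDiffOn_of_transformed {Ω γ₀ γ₁ : Set (Euc d)}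
    (hΩ : IsBoundedLipschitzDomain Ω) (hγ₁ : IsClosed γ₁) (hunion : γ₀ ∪ γ₁ = frontier Ω)
    (hdisj : Disjoint γ₀ γ₁) (hne : γ₀.Nonempty) {I : Set ℝ} (hI : IsOpen I) {M R c : ℝ}
    (hM : 0 ≤ M) (hc : 0 < c) {F F' : ℝ → Euc d → Euc d × (Euc d →L[ℝ] Euc d)}
    (hF' : IsBddC1 (volume.restrict Ω) I M F F')
    (hFI : ∀ t ∈ I, ∀ᵐ x ∂(volume.restrict Ω), F t x ∈ boundedPairs d R c)
    {X : Euc d → Euc d} (hX : ContDiff ℝ 1 X) {S : Euc d → ℝ} (hS : ContDiff ℝ 1 S)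
    {w : ℝ → H1.V Ω γ₀} (hw : ∀ t ∈ I, ∀ φ ∈ H1.V Ω γ₀,
      ∫ x in Ω, inner ℝ (transformedMatrix (F t x) (H1.grad (w t).1 x)) (H1.grad φ x)
        = (∫ x in Ω, inner ℝ (transformedField X (F t x)) (H1.grad φ x))
          + ∫ x in Ω, transformedSource S (F t x) * H1.fn φ x) : ContDiffOn ℝ 1 w I := by
  have hfin := isFiniteMeasure_restrict_of_isBounded hΩ.isBounded
  obtain ⟨M₁, hM₁, a, a', ha, ha2⟩ := hF'.exists_Lp_comp hI hM hc hFI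
    contDiffOn_transformedMatrix ∞
  obtain ⟨M₂, -, Y, Y', hY, hX2⟩ := hF'.exists_Lp_comp hI hM hc hFI
    (contDiffOn_transformedField hX) 2
  obtain ⟨M₃, -, Z, Z', hZ, hS2⟩ := hF'.exists_Lp_comp hI hM hc hFI
    (contDiffOn_transformedSource hS) 2
  obtain ⟨k, hk, hcoer⟩ := exists_transformedMatrix_coercive (d := d) R hc
  obtain ⟨C, hC, hP⟩ := hΩ.exists_poincare hγ₁ hunion hdisj hne
  refine contDiffOn_of_variational (V := H1.V Ω γ₀) (H1.gradV Ω γ₀) (H1.fnV Ω γ₀) (C := C + 1)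
    (by positivity) ?_ hI hM₁ hk ha ?_ hY hZ ?_
  · intro g
    have h1 := hP g.1 g.2
    have h2 := H1.norm_sq_eq g.1
    change ‖g.1‖ ^ 2 ≤ (C + 1) * ‖H1.gradL Ω g.1‖ ^ 2
    linarith
  · intro t ht
    filter_upwards [ha2 t ht, hFI t ht] with x h1 h2 v
    rw [h1]
    exact hcoer _ h2 v
  · intro t ht φ
    have h1 := hw t ht φ.1 φ.2
    have e1 := L2_inner_eq_integral_of_ae (mulOp (a t) (H1.gradV Ω γ₀ (w t))) (H1.gradV Ω γ₀ φ)
      (f' := fun x => transformedMatrix (F t x) (H1.grad (w t).1 x)) (by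
        filter_upwards [coeFn_mulOp (a t) (H1.gradV Ω γ₀ (w t)), ha2 t ht] with x e1 e2
        exact e1.trans (congrArg (fun A : Euc d →L[ℝ] Euc d => A (H1.grad (w t).1 x)) e2))
    have e2 := L2_inner_eq_integral_of_ae (Y t) (H1.gradV Ω γ₀ φ) (hX2 t ht)
    have e3 := L2_inner_eq_integral_of_ae (Z t) (H1.fnV Ω γ₀ φ) (hS2 t ht)
    have e4 : ∫ x in Ω, inner ℝ (transformedSource S (F t x)) (H1.fnV Ω γ₀ φ x)
        = ∫ x in Ω, transformedSource S (F t x) * H1.fn φ.1 x :=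
      integral_congr_ae (ae_of_all _ fun x => mul_comm _ _)
    exact e1.trans (h1.trans (congrArg₂ (· + ·) e2.symm (e3.trans e4).symm))

namespace IsDifferentiableDeformation

variable {Ω γ₀ γ₁ : Set (Euc d)} {ε : ℝ} {T : ℝ → Euc d → Euc d}

/-- For times near `t₀`, the domains contain a fixed ball around `y`: their boundaries `T_t(∂Ω)`
move continuously, hence stay away from `y`. -/
theorem exists_closedBall_subset_image (hT : IsDifferentiableDeformation Ω ε T)
    (hΩ : IsBoundedLipschitzDomain Ω) {y : Euc d} (hyt : ∀ t ∈ Ioo (-ε) ε, y ∈ T t '' Ω) {t₀ : ℝ}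
    (ht₀ : t₀ ∈ Ioo (-ε) ε) :
    ∃ δ > 0, ∃ r > 0, ∀ t ∈ Metric.ball t₀ δ, Metric.closedBall y r ⊆ T t '' Ω := by
  obtain ⟨δ, hδ, hsub, C, hC, hlip⟩ := hT.exists_time_lipschitz hΩ ht₀
  have hcl : IsClosed (T t₀ '' frontier Ω) :=
    ((hΩ.isBounded.isCompact_closure.of_isClosed_subset isClosed_frontier
      frontier_subset_closure).image_of_continuousOn
        ((hT.continuousOn ht₀).mono frontier_subset_closure)).isClosed
  have hb : ∀ t ∈ Ioo (-ε) ε, IsBiLip Ω (T t) := fun t ht =>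
    hT.isBiLip hΩ.isOpen hΩ.isBounded ht
  have hy : y ∈ (T t₀ '' frontier Ω)ᶜ := by
    rw [← (hb t₀ ht₀).frontier_image, (hb t₀ ht₀).isOpen_image.frontier_eq]
    exact fun h => h.2 (hyt t₀ ht₀)
  obtain ⟨r, hr, hball⟩ := Metric.isOpen_iff.1 hcl.isOpen_compl y hy
  refine ⟨min δ (r / 2 / (C + 1)), by positivity, r / 3, by positivity, fun t ht => ?_⟩
  have ht1 : t ∈ Metric.ball t₀ δ := Metric.ball_subset_ball (min_le_left _ _) ht
  have ht2 : |t - t₀| < r / 2 / (C + 1) := (Metric.mem_ball.1 ht).trans_le (min_le_right _ _)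
  refine (convex_closedBall y (r / 3)).isPreconnected.subset_of_disjoint_frontier
    (hb t (hsub ht1)).isOpen_image
    ⟨y, Metric.mem_closedBall_self (by positivity), hyt t (hsub ht1)⟩ ?_
  rw [(hb t (hsub ht1)).frontier_image]
  refine Set.disjoint_right.2 ?_
  rintro _ ⟨x, hx, rfl⟩ hxb
  refine hball ?_ (mem_image_of_mem (T t₀) hx)
  have h1 := hlip x (frontier_subset_closure hx) t₀ (Metric.mem_ball_self hδ) t ht1
  rw [abs_sub_comm] at h1
  have h2 : C * |t - t₀| ≤ r / 2 := by
    rw [lt_div_iff₀ (by positivity)] at ht2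
    nlinarith [abs_nonneg (t - t₀)]
  rw [mem_ball_iff_norm]
  rw [mem_closedBall_iff_norm] at hxb
  calc ‖T t₀ x - y‖ = ‖(T t₀ x - T t x) + (T t x - y)‖ := by congr 1; abel
    _ ≤ ‖T t₀ x - T t x‖ + ‖T t x - y‖ := norm_add_le _ _
    _ < r := by linarith

set_option maxHeartbeats 1000000 in
set_option synthInstance.maxHeartbeats 200000 in
/-- Near each time, the transported solution is of class `C¹`. -/
theorem exists_contDiffOn_ball (hT : IsDifferentiableDeformation Ω ε T)
    (hΩ : IsBoundedLipschitzDomain Ω) (hγ₁ : IsClosed γ₁)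
    (hγ₀ : IsClosed γ₀) (hunion : γ₀ ∪ γ₁ = frontier Ω) (hdisj : Disjoint γ₀ γ₁)
    (hne : γ₀.Nonempty) {y : Euc d} (hyt : ∀ t ∈ Ioo (-ε) ε, y ∈ T t '' Ω)
    {u : (t : ℝ) → H1 (T t '' Ω)}
    (hu : ∀ t ∈ Ioo (-ε) ε, SolvesMixedProblem (T t '' Ω) (T t '' γ₀) y (u t)) {t₀ : ℝ}
    (ht₀ : t₀ ∈ Ioo (-ε) ε) :
    ∃ δ > 0, Metric.ball t₀ δ ⊆ Ioo (-ε) ε ∧ ∃ v : ℝ → H1 Ω,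
      ContDiffOn ℝ 1 v (Metric.ball t₀ δ) ∧ ∀ t ∈ Metric.ball t₀ δ,
        H1.fn (v t) =ᵐ[volume.restrict Ω] fun x => H1.fn (u t) (T t x) := by
  have hfin := isFiniteMeasure_restrict_of_isBounded hΩ.isBounded
  have hγf : γ₀ ⊆ frontier Ω := hunion ▸ subset_union_left
  have hγΩ : γ₀ ⊆ closure Ω := hγf.trans frontier_subset_closure
  have hγc : IsCompact γ₀ := hΩ.isBounded.isCompact_closure.of_isClosed_subset hγ₀ hγΩ
  obtain ⟨δ₁, hδ₁, r, hr, hball⟩ := hT.exists_closedBall_subset_image hΩ hyt ht₀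
  obtain ⟨δ₂, hδ₂, hsub, M, R, c, hM, hc, -, hR, ⟨D', hD'⟩, hF⟩ := hT.exists_isBddC1_pair hΩ ht₀
  set δ := min δ₁ δ₂ with hδ
  set I := Metric.ball t₀ δ with hIdef
  have hI : IsOpen I := Metric.isOpen_ball
  have hI1 : I ⊆ Metric.ball t₀ δ₁ := Metric.ball_subset_ball (min_le_left _ _)
  have hI2 : I ⊆ Metric.ball t₀ δ₂ := Metric.ball_subset_ball (min_le_right _ _)
  have hIε : I ⊆ Ioo (-ε) ε := hI2.trans hsub
  refine ⟨δ, lt_min hδ₁ hδ₂, hIε, ?_⟩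
  have hFI : ∀ t ∈ I, ∀ᵐ x ∂(volume.restrict Ω), (T t x, fderiv ℝ (T t) x) ∈ boundedPairs d R c :=
    fun t ht => (hF t (hI2 ht)).mono fun x hx => hx.2
  have hF' := hD'.mono hI2 le_rfl
  -- the singularity is cut off inside the fixed ball; `κ` makes the support compact without
  -- changing the function on any of the domains
  let χ : ContDiffBump y := ⟨r / 2, r, by positivity, by linarith⟩
  obtain ⟨κ, hκ, hκc, U, hU, hRU, hκU⟩ := exists_cutoff (Metric.closedBall (0 : Euc d) R)
    Metric.isBounded_closedBall
  set H : Euc d → ℝ := fun x => κ x * ((1 - χ x) * fundamentalSolution d (x - y)) with hHdef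
  have hH : ContDiff ℝ ∞ H := hκ.mul (contDiff_one_sub_mul_fundamentalSolution χ)
  have hHc : HasCompactSupport H := hκc.mul_right
  have hHU : ∀ x ∈ U, H x = (1 - χ x) * fundamentalSolution d (x - y) := fun x hx => by
    change κ x * _ = _
    exact (congrArg (· * _) (hκU x hx)).trans (one_mul _)
  -- the transported variational problem
  have hex : ∀ t, ∃ (w : H1.V Ω γ₀) (h : H1 Ω), t ∈ I →
      H1.fn (w.1 - h) =ᵐ[volume.restrict Ω] (fun x => H1.fn (u t) (T t x)) ∧
      H1.fn h =ᵐ[volume.restrict Ω] (fun x => H (T t x)) ∧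
      H1.grad h =ᵐ[volume.restrict Ω] IsBiLip.pullGrad (T t) (∇ H) ∧
      ∀ φ ∈ H1.V Ω γ₀, ∫ x in Ω,
        inner ℝ (transformedMatrix (T t x, fderiv ℝ (T t) x) (H1.grad w.1 x)) (H1.grad φ x)
          = (∫ x in Ω, inner ℝ (transformedField (cutoffField χ) (T t x, fderiv ℝ (T t) x))
              (H1.grad φ x))
            + ∫ x in Ω, transformedSource (cutoffSource χ) (T t x, fderiv ℝ (T t) x)
              * H1.fn φ x := by
    intro t
    by_cases ht : t ∈ I
    swap
    · exact ⟨0, 0, fun h => absurd h ht⟩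
    have hb : IsBiLip Ω (T t) := hT.isBiLip hΩ.isOpen hΩ.isBounded (hIε ht)
    have hsubU : closure (T t '' Ω) ⊆ U := by
      refine hb.closure_image.subset.trans ?_
      rintro _ ⟨x, hx, rfl⟩
      exact hRU (mem_closedBall_zero_iff.2 (hR x hx t (hI2 ht)))
    obtain ⟨w, hw, h, hwh⟩ := (hu t (hIε ht)).exists_transport hb hγc hγf (hball t (hI1 ht)) hH hHc
      hU hsubU hHU
    exact ⟨⟨w, hw⟩, h, fun _ => hwh⟩
  choose w h hwh using hex
  refine ⟨fun t => (w t).1 - h t, ContDiffOn.sub ?_ ?_, fun t ht => (hwh t ht).1⟩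
  · exact H1.contDiff_coe_V.comp_contDiffOn (hΩ.contDiffOn_of_transformed hγ₁ hunion
      hdisj hne hI hM hc hF' hFI (contDiff_cutoffField χ) (contDiff_cutoffSource χ)
      fun t ht => (hwh t ht).2.2.2)
  · have hΦ : ContDiffOn ℝ 1 (fun q : Euc d × (Euc d →L[ℝ] Euc d) =>
        ContinuousLinearMap.adjoint q.2 (∇ H q.1)) (invertiblePairs d) :=
      ((contDiff_adjoint.comp contDiff_snd).clm_apply ((contDiff_iff_contDiffAt.2 fun x =>
        contDiffAt_gradient (n := 1) hH.contDiffAt).comp contDiff_fst)).contDiffOn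
    obtain ⟨M₁, -, a, a', ha, ha2⟩ := hF'.exists_Lp_comp hI hM hc hFI (Φ := fun q => H q.1)
      ((hH.of_le (by simp)).comp contDiff_fst).contDiffOn 2
    obtain ⟨M₂, -, b, b', hb, hb2⟩ := hF'.exists_Lp_comp hI hM hc hFI hΦ 2
    refine H1.contDiffOn hI ha hb (fun t ht => Lp.ext ?_) (fun t ht => Lp.ext ?_)
    · exact (hwh t ht).2.1.trans (ha2 t ht).symm
    · exact (hwh t ht).2.2.1.trans (hb2 t ht).symm

/-- The transported solution is of class `C¹`. -/
theorem exists_contDiffOn (hT : IsDifferentiableDeformation Ω ε T)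
    (hΩ : IsBoundedLipschitzDomain Ω) (hγ₁ : IsClosed γ₁)
    (hγ₀ : IsClosed γ₀) (hunion : γ₀ ∪ γ₁ = frontier Ω) (hdisj : Disjoint γ₀ γ₁)
    (hne : γ₀.Nonempty) {y : Euc d} (hyt : ∀ t ∈ Ioo (-ε) ε, y ∈ T t '' Ω)
    {u : (t : ℝ) → H1 (T t '' Ω)}
    (hu : ∀ t ∈ Ioo (-ε) ε, SolvesMixedProblem (T t '' Ω) (T t '' γ₀) y (u t)) :
    ∃ v : ℝ → H1 Ω, (∀ t ∈ Ioo (-ε) ε,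
        H1.fn (v t) =ᵐ[volume.restrict Ω] fun x => H1.fn (u t) (T t x)) ∧
      ContDiffOn ℝ 1 v (Ioo (-ε) ε) := by
  have hloc := fun t (ht : t ∈ Ioo (-ε) ε) =>
    hT.exists_contDiffOn_ball hΩ hγ₁ hγ₀ hunion hdisj hne hyt hu ht
  have hex : ∀ t, ∃ w : H1 Ω, t ∈ Ioo (-ε) ε →
      H1.fn w =ᵐ[volume.restrict Ω] fun x => H1.fn (u t) (T t x) := by
    intro t
    by_cases ht : t ∈ Ioo (-ε) ε
    · obtain ⟨δ, hδ, -, v, -, hv⟩ := hloc t ht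
      exact ⟨v t, fun _ => hv t (Metric.mem_ball_self hδ)⟩
    · exact ⟨0, fun h => absurd h ht⟩
  choose v hv using hex
  refine ⟨v, hv, fun t ht => ?_⟩
  obtain ⟨δ, hδ, hsub, v', hv', hv''⟩ := hloc t ht
  refine ((hv'.congr fun s hs => ?_).contDiffAt (Metric.ball_mem_nhds t hδ)).contDiffWithinAt
  exact H1.ext_fn hΩ.isOpen ((hv s (hsub hs)).trans (hv'' s hs).symm)

end IsDifferentiableDeformation

/-! ### The fundamental solution is locally integrable -/

theorem aestronglyMeasurable_fundamentalSolution :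
    AEStronglyMeasurable (fundamentalSolution d) volume := by
  refine Measurable.aestronglyMeasurable ?_
  unfold fundamentalSolution
  by_cases h : d = 2
  · simp only [if_pos h]
    fun_prop
  · simp only [if_neg h]
    exact (measurable_norm.pow_const _).div_const _

theorem integrableOn_ball_fundamentalSolution (hd : 2 ≤ d) {r : ℝ} (hr : 0 < r) :
    IntegrableOn (fundamentalSolution d) (Metric.ball 0 r) volume := by
  have hdim : Module.finrank ℝ (Euc d) = d := by simp
  have hd' : (2 : ℝ) ≤ d := by exact_mod_cast hd
  have : Nontrivial (Euc d) := Module.nontrivial_of_finrank_pos (R := ℝ) (by omega)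
  by_cases h : d = 2
  · have h2 : (d : ℝ) = 2 := by exact_mod_cast h
    -- `|log r| ≤ r + r⁻¹`
    refine integrableOn_ball_of_norm_le_rpow (α := 1) (C := (2 * Real.pi)⁻¹ * (r ^ 2 + 1))
      (by rw [hdim]; omega) (by rw [hdim]; linarith) ?_ aestronglyMeasurable_fundamentalSolution
    filter_upwards [ae_restrict_mem Metric.isOpen_ball.measurableSet,
      ae_restrict_of_ae (Measure.ae_ne volume (0 : Euc d))] with x hx hx0
    have hx1 := norm_pos_iff.2 hx0
    have hxr : ‖x‖ < r := mem_ball_zero_iff.1 hx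
    have hlog : |Real.log ‖x‖| ≤ (r ^ 2 + 1) * ‖x‖⁻¹ := by
      have e1 := Real.log_le_sub_one_of_pos hx1
      have e2 := Real.one_sub_inv_le_log_of_pos hx1
      have e3 : ‖x‖ ≤ r ^ 2 * ‖x‖⁻¹ := by
        rw [← div_eq_mul_inv, le_div_iff₀ hx1]
        nlinarith
      have e4 : 0 < ‖x‖⁻¹ := inv_pos.2 hx1
      rw [abs_le]
      constructor <;> nlinarith
    rw [fundamentalSolution, if_pos h, norm_mul, norm_neg, Real.norm_of_nonneg (by positivity),
      Real.norm_eq_abs, Real.rpow_neg_one, mul_assoc]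
    gcongr
  · have h3 : (2 : ℝ) < d := by exact_mod_cast lt_of_le_of_ne hd (Ne.symm h)
    refine integrableOn_ball_of_norm_le_rpow (α := d - 2)
      (C := (((d : ℝ) - 2) * ((d : ℝ) * volume.real (Metric.ball (0 : Euc d) 1)))⁻¹)
      (by rw [hdim]; omega) (by rw [hdim]; linarith) ?_ aestronglyMeasurable_fundamentalSolution
    refine ae_of_all _ fun x => ?_
    have h4 :
        (0 : ℝ) ≤ (((d : ℝ) - 2) * ((d : ℝ) * volume.real (Metric.ball (0 : Euc d) 1)))⁻¹ := by
      have : (0 : ℝ) ≤ d - 2 := by linarith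
      positivity
    have h5 : ‖x‖ ^ (2 - (d : ℤ)) = ‖x‖ ^ (-((d : ℝ) - 2)) := by
      rw [← Real.rpow_intCast]
      push_cast
      congr 1
      ring
    rw [fundamentalSolution, if_neg h, div_eq_inv_mul, norm_mul, Real.norm_of_nonneg h4,
      Real.norm_of_nonneg (by positivity), h5]

theorem integrableOn_fundamentalSolution_sub (hd : 2 ≤ d) {Ω : Set (Euc d)}
    (hb : Bornology.IsBounded Ω) (y : Euc d) :
    IntegrableOn (fun x => fundamentalSolution d (x - y)) Ω volume := by
  obtain ⟨r, hr, hΩr⟩ := hb.subset_ball_lt 0 y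
  refine IntegrableOn.mono_set ?_ hΩr
  have h1 := ((measurePreserving_sub_right volume y).integrableOn_comp_preimage
    (MeasurableEquiv.subRight y).measurableEmbedding).2
    (integrableOn_ball_fundamentalSolution hd hr)
  refine h1.mono_set fun x hx => ?_
  rw [mem_preimage, mem_ball_zero_iff]
  exact mem_ball_iff_norm.1 hx

/-! ### The first variation -/

theorem tsupport_laplacian_subset (φ : Euc d → ℝ) : tsupport (Δ φ) ⊆ tsupport φ := by
  refine closure_minimal (fun x hx => ?_) (isClosed_tsupport φ)
  by_contra h
  have h1 : φ =ᶠ[𝓝 x] fun _ => 0 := notMem_tsupport_iff_eventuallyEq.1 h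
  refine hx ?_
  rw [(InnerProductSpace.laplacian_congr_nhds h1).self_of_nhds]
  simp [InnerProductSpace.laplacian_eq_iteratedFDeriv_orthonormalBasis _
    (EuclideanSpace.basisFun (Fin d) ℝ)]

theorem IsTestFunction.laplacian {Ω : Set (Euc d)} {φ : Euc d → ℝ} (hφ : IsTestFunction Ω φ) :
    IsTestFunction Ω (Δ φ) where
  contDiff := by
    rw [InnerProductSpace.laplacian_eq_iteratedFDeriv_orthonormalBasis _
      (EuclideanSpace.basisFun (Fin d) ℝ)]
    refine ContDiff.sum fun i _ => ?_
    exact (ContinuousMultilinearMap.apply ℝ (fun _ : Fin 2 => Euc d) ℝ _).contDiff.comp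
      (hφ.contDiff.iteratedFDeriv_right (m := ∞) le_rfl)
  hasCompactSupport := hφ.hasCompactSupport.mono' (subset_tsupport _ |>.trans
    (tsupport_laplacian_subset φ))
  tsupport_subset := (tsupport_laplacian_subset φ).trans hφ.tsupport_subset

theorem abs_det_id : |(ContinuousLinearMap.id ℝ (Euc d)).det| = 1 := by
  change |LinearMap.det (LinearMap.id : Euc d →ₗ[ℝ] Euc d)| = 1
  rw [LinearMap.det_id, abs_one]

theorem setIntegral_mul_eq_of_tsupport_subset {Ω Ω' : Set (Euc d)} {φ : Euc d → ℝ}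
    (h : tsupport φ ⊆ Ω) (h' : tsupport φ ⊆ Ω') (f : Euc d → ℝ) :
    ∫ x in Ω, f x * φ x = ∫ x in Ω', f x * φ x := by
  rw [setIntegral_eq_integral_of_forall_compl_eq_zero fun x hx => by
      rw [image_eq_zero_of_notMem_tsupport fun hc => hx (h hc), mul_zero],
    setIntegral_eq_integral_of_forall_compl_eq_zero fun x hx => by
      rw [image_eq_zero_of_notMem_tsupport fun hc => hx (h' hc), mul_zero]]

theorem H1.mem_withTrace_of_ae_eq {Ω Ω' γ : Set (Euc d)} (hΩ : IsOpen Ω) (h : Ω' = Ω)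
    {g : Euc d → ℝ} {u : H1 Ω'} (hu : u ∈ H1.withTrace Ω' γ g) {w : H1 Ω}
    (hw : H1.fn w =ᵐ[volume.restrict Ω] H1.fn u) :
    w ∈ H1.withTrace Ω γ g ∧ H1.grad w =ᵐ[volume.restrict Ω] H1.grad u := by
  subst h
  obtain rfl := H1.ext_fn hΩ hw
  exact ⟨hu, EventuallyEq.rfl⟩

/-- An identity between continuous functionals of `(w, ∇ w)` holds for all elements of `H¹` with
prescribed trace if it holds for smooth functions. -/
theorem H1.inner_fnL_eq_of_forall_smooth {Ω γ : Set (Euc d)} (hΩ : IsOpen Ω)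
    (hb : Bornology.IsBounded Ω) {g : Euc d → ℝ} {a : Lp ℝ 2 (volume.restrict Ω)}
    {X : Euc d → Euc d} (hX : MemLp X 2 (volume.restrict Ω))
    (h : ∀ ψ : Euc d → ℝ, ContDiff ℝ ∞ ψ → HasCompactSupport ψ →
      ∫ x in Ω, a x * ψ x = - ∫ x in Ω, inner ℝ (X x) (∇ ψ x))
    {w : H1 Ω} (hw : w ∈ H1.withTrace Ω γ g) :
    inner ℝ a (H1.fnL Ω w) = - ∫ x in Ω, inner ℝ (X x) (H1.grad w x) := by
  rw [← H1.inner_toLp_gradL hX]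
  have h1 := (H1.gradL Ω).continuous
  have h2 := (H1.fnL Ω).continuous
  have hclosed : IsClosed {w : H1 Ω | inner ℝ a (H1.fnL Ω w)
      = - inner ℝ (hX.toLp X) (H1.gradL Ω w)} :=
    isClosed_eq (continuous_const.inner h2) (continuous_const.inner h1).neg
  refine closure_minimal ?_ hclosed hw
  rintro w ⟨ψ, hψ, hψc, -, hw⟩
  have e1 : inner ℝ a (H1.fnL Ω w) = ∫ x in Ω, a x * ψ x := by
    rw [L2.inner_def]
    exact integral_congr_ae (hw.mono fun x hx => (mul_comm _ _).trans (congrArg (a x * ·) hx))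
  have e2 : inner ℝ (hX.toLp X) (H1.gradL Ω w) = ∫ x in Ω, inner ℝ (X x) (∇ ψ x) :=
    (H1.inner_toLp_gradL hX w).trans (integral_congr_ae
      ((H1.grad_ae_eq_of_contDiff hΩ hb hψ hψc hw).mono fun x hx => by simp only [hx]))
  exact e1.trans ((h ψ hψ hψc).trans (congrArg Neg.neg e2.symm))

namespace IsDifferentiableDeformation

variable {Ω γ₀ γ₁ : Set (Euc d)} {ε : ℝ} {T : ℝ → Euc d → Euc d}

/-- A compact subset of `Ω` is contained in the perturbed domains for small times. -/
theorem eventually_subset_image (hT : IsDifferentiableDeformation Ω ε T) (hε : 0 < ε)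
    (hΩ : IsBoundedLipschitzDomain Ω) {k : Set (Euc d)} (hk : IsCompact k) (hkΩ : k ⊆ Ω) :
    ∀ᶠ t in 𝓝 (0 : ℝ), k ⊆ T t '' Ω := by
  have h0 : (0 : ℝ) ∈ Ioo (-ε) ε := ⟨by linarith, hε⟩
  obtain ⟨δ, hδ, hsub, C, hC, hlip⟩ := hT.exists_time_lipschitz hΩ h0
  obtain ⟨r, hr, hrΩ⟩ := hk.exists_thickening_subset_open hΩ.isOpen hkΩ
  have hev : ∀ᶠ t in 𝓝 (0 : ℝ), C * |t| < r / 2 :=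
    ContinuousAt.eventually_lt (by fun_prop) continuousAt_const (by simpa using hr)
  filter_upwards [hev, Metric.ball_mem_nhds 0 hδ] with t ht htδ p hp
  have hb : IsBiLip Ω (T t) := hT.isBiLip hΩ.isOpen hΩ.isBounded (hsub htδ)
  have hclose : ∀ x ∈ closure Ω, ‖T t x - x‖ < r / 2 := fun x hx => by
    have h1 := hlip x hx t htδ 0 (Metric.mem_ball_self hδ)
    rw [hT.zero x hx, sub_zero] at h1
    exact h1.trans_lt ht
  refine (convex_ball p (r / 2)).isPreconnected.subset_of_disjoint_frontier hb.isOpen_image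
    ⟨T t p, mem_ball_iff_norm.2 (hclose p (subset_closure (hkΩ hp))),
      mem_image_of_mem _ (hkΩ hp)⟩ ?_ (Metric.mem_ball_self (by positivity))
  rw [hb.frontier_image]
  refine Set.disjoint_right.2 ?_
  rintro _ ⟨x, hx, rfl⟩ hxb
  rw [hΩ.isOpen.frontier_eq] at hx
  refine hx.2 (hrΩ (Metric.mem_thickening_iff.2 ⟨p, hp, ?_⟩))
  have h1 := hclose x hx.1
  rw [mem_ball_iff_norm] at hxb
  rw [dist_eq_norm]
  calc ‖x - p‖ = ‖(T t x - p) - (T t x - x)‖ := by congr 1; abel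
    _ ≤ ‖T t x - p‖ + ‖T t x - x‖ := norm_sub_le _ _
    _ < r := by linarith

theorem image_zero (hT : IsDifferentiableDeformation Ω ε T) : T 0 '' Ω = Ω :=
  (image_congr fun x hx => hT.zero x (subset_closure hx)).trans (image_id' Ω)

theorem fderiv_zero (hT : IsDifferentiableDeformation Ω ε T) (hΩ : IsOpen Ω) {x : Euc d}
    (hx : x ∈ Ω) : fderiv ℝ (T 0) x = ContinuousLinearMap.id ℝ (Euc d) := by
  have h : T 0 =ᶠ[𝓝 x] id := by
    filter_upwards [hΩ.mem_nhds hx] with z hz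
    exact hT.zero z (subset_closure hz)
  rw [h.fderiv_eq, fderiv_id]

/-- The transported test functions `φ(T_t) |det DT_t|`, by which an integral over the perturbed
domain against `φ` becomes an integral over `Ω`, are differentiable in `L²` at `t = 0`. Their
derivative is `div (φ S)`, expressed by its action on smooth functions `ψ`: differentiate the
constant `∫_{T_t(Ω)} ψ φ`. -/
theorem exists_hasDerivAt_transported_test (hT : IsDifferentiableDeformation Ω ε T) (hε : 0 < ε)
    (hΩ : IsBoundedLipschitzDomain Ω) {φ : Euc d → ℝ} (hφ : IsTestFunction Ω φ) :
    ∃ (a : ℝ → Lp ℝ 2 (volume.restrict Ω)) (a' : Lp ℝ 2 (volume.restrict Ω)),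
      HasDerivAt a a' 0 ∧ a 0 =ᵐ[volume.restrict Ω] φ ∧
      (∀ᶠ t in 𝓝 0, a t =ᵐ[volume.restrict Ω] fun x => |(fderiv ℝ (T t) x).det| * φ (T t x)) ∧
      ∀ ψ : Euc d → ℝ, ContDiff ℝ ∞ ψ → HasCompactSupport ψ →
        ∫ x in Ω, a' x * ψ x = - ∫ x in Ω, inner ℝ (φ x • deformationField T x) (∇ ψ x) := by
  have hfin := isFiniteMeasure_restrict_of_isBounded hΩ.isBounded
  have h0 : (0 : ℝ) ∈ Ioo (-ε) ε := ⟨by linarith, hε⟩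
  obtain ⟨δ, hδ, hsub, M, R, c, hM, hc, -, -, ⟨D', hD'⟩, hF⟩ := hT.exists_isBddC1_pair hΩ h0
  have hI : IsOpen (Metric.ball (0 : ℝ) δ) := Metric.isOpen_ball
  have h0I : (0 : ℝ) ∈ Metric.ball (0 : ℝ) δ := Metric.mem_ball_self hδ
  have hFI : ∀ t ∈ Metric.ball (0 : ℝ) δ, ∀ᵐ x ∂(volume.restrict Ω),
      (T t x, fderiv ℝ (T t) x) ∈ boundedPairs d R c := fun t ht => (hF t ht).mono fun x hx => hx.2
  have hmem : ∀ᵐ x ∂(volume.restrict Ω), x ∈ Ω := ae_restrict_mem hΩ.isOpen.measurableSet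
  obtain ⟨M₁, -, a, a', ha, ha2⟩ := hD'.exists_Lp_comp hI hM hc hFI
    (Φ := fun q => |q.2.det| * φ q.1) (contDiffOn_abs_det.mul
      ((hφ.contDiff.of_le (by simp)).comp contDiff_fst).contDiffOn) 2
  refine ⟨a, a' 0, ha.hasDerivAt h0I, ?_, ?_, fun ψ hψ hψc => ?_⟩
  · filter_upwards [ha2 0 h0I, hmem] with x hx hxΩ
    rw [hx, hT.fderiv_zero hΩ.isOpen hxΩ, hT.zero x (subset_closure hxΩ), abs_det_id, one_mul]
  · filter_upwards [Metric.ball_mem_nhds 0 hδ] with t ht using ha2 t ht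
  have hψ1 : ContDiff ℝ 1 ψ := hψ.of_le (by simp)
  have hK := isCompact_boundedPairs d R c
  obtain ⟨M₂, -, h'⟩ := hD'.comp hI hM isOpen_univ hK (subset_univ _)
    (Φ := fun q : Euc d × (Euc d →L[ℝ] Euc d) => ψ q.1) (hψ1.comp contDiff_fst).contDiffOn hFI
  obtain ⟨C, hC⟩ := hψ.continuous.bounded_above_of_compact_support hψc
  obtain ⟨b, b', hb, hb2, hb3⟩ := h'.exists_Lp hI (fun t ht => ⟨C, ae_of_all _ fun x => hC _⟩) 2
  have hd1 := (ha.hasDerivAt h0I).inner ℝ (hb.hasDerivAt h0I)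
  have hconst : ∀ᶠ t in 𝓝 (0 : ℝ), inner ℝ (a t) (b t) = ∫ x in Ω, ψ x * φ x := by
    filter_upwards [Metric.ball_mem_nhds 0 hδ,
      hT.eventually_subset_image hε hΩ hφ.hasCompactSupport hφ.tsupport_subset] with t ht hsub'
    have hbt : IsBiLip Ω (T t) := hT.isBiLip hΩ.isOpen hΩ.isBounded (hsub ht)
    rw [setIntegral_mul_eq_of_tsupport_subset hφ.tsupport_subset hsub', hbt.integral_image,
      L2.inner_def]
    refine integral_congr_ae ?_
    filter_upwards [ha2 t ht, hb2 t ht] with x e1 e2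
    rw [e1, e2]
    change ψ (T t x) * (|(fderiv ℝ (T t) x).det| * φ (T t x)) = _
    ring
  have hd2 : HasDerivAt (fun t => inner ℝ (a t) (b t)) 0 0 :=
    (hasDerivAt_const (0 : ℝ) (∫ x in Ω, ψ x * φ x)).congr_of_eventuallyEq hconst
  have hsum := hd1.unique hd2
  have e1 : inner ℝ (a 0) (b' 0) = ∫ x in Ω, inner ℝ (φ x • deformationField T x) (∇ ψ x) := by
    rw [L2.inner_def]
    refine integral_congr_ae ?_
    filter_upwards [ha2 0 h0I, hb3 0 h0I, hmem] with x e1 e2 hxΩ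
    rw [e1, e2, hT.fderiv_zero hΩ.isOpen hxΩ, hT.zero x (subset_closure hxΩ)]
    have e3 : fderiv ℝ (fun q : Euc d × (Euc d →L[ℝ] Euc d) => ψ q.1)
        (x, ContinuousLinearMap.id ℝ (Euc d)) (deriv (fun t => T t x) 0, D' 0 x)
        = fderiv ℝ ψ x (deformationField T x) := by
      have : HasFDerivAt (fun q : Euc d × (Euc d →L[ℝ] Euc d) => ψ q.1)
          ((fderiv ℝ ψ x).comp (ContinuousLinearMap.fst ℝ _ _))
          (x, ContinuousLinearMap.id ℝ (Euc d)) :=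
        HasFDerivAt.comp (f := Prod.fst) (x, ContinuousLinearMap.id ℝ (Euc d))
          (hψ1.differentiable (by simp) x).hasFDerivAt hasFDerivAt_fst
      rw [this.fderiv]
      rfl
    have e4 : inner ℝ (deformationField T x) (∇ ψ x) = fderiv ℝ ψ x (deformationField T x) :=
      (real_inner_comm _ _).trans inner_gradient_left
    rw [e3, real_inner_smul_left, e4, abs_det_id, one_mul]
    exact mul_comm _ _
  have e2 : inner ℝ (a' 0) (b 0) = ∫ x in Ω, a' 0 x * ψ x := by
    rw [L2.inner_def]
    refine integral_congr_ae ?_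
    filter_upwards [hb2 0 h0I, hmem] with x e1 hxΩ
    rw [e1, hT.zero x (subset_closure hxΩ)]
    exact mul_comm _ _
  linarith

theorem memLp_inner_deformationField (hT : IsDifferentiableDeformation Ω ε T) (hε : 0 < ε)
    (hΩ : IsBoundedLipschitzDomain Ω) {G : Euc d → Euc d} (hG : MemLp G 2 (volume.restrict Ω)) :
    MemLp (fun x => inner ℝ (deformationField T x) (G x)) 2 (volume.restrict Ω) := by
  obtain ⟨K, hK⟩ := hT.lipschitzOnWith_deformationField hε hΩ
  obtain ⟨C, hC⟩ := hΩ.isBounded.isCompact_closure.exists_bound_of_continuousOn hK.continuousOn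
  have hm : AEStronglyMeasurable (deformationField T) (volume.restrict Ω) :=
    (hK.continuousOn.mono subset_closure).aestronglyMeasurable hΩ.isOpen.measurableSet
  refine MemLp.of_le_mul (c := C) hG (hm.inner hG.1) ?_
  filter_upwards [ae_restrict_mem hΩ.isOpen.measurableSet] with x hx
  refine (norm_inner_le_norm _ _).trans ?_
  gcongr
  exact hC x (subset_closure hx)

theorem memLp_smul_deformationField (hT : IsDifferentiableDeformation Ω ε T) (hε : 0 < ε)
    (hΩ : IsBoundedLipschitzDomain Ω) {φ : Euc d → ℝ} (hφ : Continuous φ) :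
    MemLp (fun x => φ x • deformationField T x) 2 (volume.restrict Ω) := by
  have hfin := isFiniteMeasure_restrict_of_isBounded hΩ.isBounded
  obtain ⟨K, hK⟩ := hT.lipschitzOnWith_deformationField hε hΩ
  have hc : ContinuousOn (fun x => φ x • deformationField T x) (closure Ω) :=
    hφ.continuousOn.smul hK.continuousOn
  obtain ⟨C, hC⟩ := hΩ.isBounded.isCompact_closure.exists_bound_of_continuousOn hc
  refine MemLp.of_bound ((hc.mono subset_closure).aestronglyMeasurable hΩ.isOpen.measurableSet) C ?_
  filter_upwards [ae_restrict_mem hΩ.isOpen.measurableSet] with x hx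
  exact hC x (subset_closure hx)

/-- The first variation of functions `u t` on `T_t(Ω)` whose transports `v t` are differentiable in
`H¹`: the integral of `u t` against a test function `φ` is that of `v t` against the transported
test function `φ(T_t) |det DT_t|`, and is differentiated by the product rule. -/
theorem hasDistribDerivAtZero_of_hasDerivAt (hT : IsDifferentiableDeformation Ω ε T) (hε : 0 < ε)
    (hΩ : IsBoundedLipschitzDomain Ω) {u : (t : ℝ) → H1 (T t '' Ω)} {v : ℝ → H1 Ω} {v' : H1 Ω}
    (hv : ∀ t ∈ Ioo (-ε) ε, H1.fn (v t) =ᵐ[volume.restrict Ω] fun x => H1.fn (u t) (T t x))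
    (hd : HasDerivAt v v' 0) {g : Euc d → ℝ} (h0 : v 0 ∈ H1.withTrace Ω γ₀ g) :
    HasDistribDerivAtZero Ω (fun t => H1.fn (u t))
      (fun x => H1.fn v' x - inner ℝ (deformationField T x) (H1.grad (v 0) x)) := by
  intro φ hφ
  obtain ⟨a, a', ha, ha0, hat, hψ⟩ := hT.exists_hasDerivAt_transported_test hε hΩ hφ
  have hX := hT.memLp_smul_deformationField hε hΩ hφ.contDiff.continuous
  have h1 := H1.inner_fnL_eq_of_forall_smooth hΩ.isOpen hΩ.isBounded hX hψ h0
  have hdv : HasDerivAt (fun t => H1.fnL Ω (v t)) (H1.fnL Ω v') 0 :=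
    (H1.fnL Ω).hasFDerivAt.comp_hasDerivAt 0 hd
  have hd1 := ha.inner ℝ hdv
  have e1 : inner ℝ (a 0) (H1.fnL Ω v') = ∫ x in Ω, H1.fn v' x * φ x := by
    rw [L2.inner_def]
    exact integral_congr_ae (ha0.mono fun x hx => congrArg (H1.fn v' x * ·) hx)
  have e2 : inner ℝ (a 0) (H1.fnL Ω v') + inner ℝ a' (H1.fnL Ω (v 0))
      = ∫ x in Ω, (H1.fn v' x - inner ℝ (deformationField T x) (H1.grad (v 0) x)) * φ x := by
    have hφ2 : MemLp φ 2 (volume.restrict Ω) :=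
      memLp_restrict_of_continuous hΩ.isOpen hΩ.isBounded hφ.contDiff.continuous 2
    have i1 : Integrable (fun x => H1.fn v' x * φ x) (volume.restrict Ω) :=
      (H1.memLp_fn v').integrable_mul hφ2
    have i2 : Integrable (fun x => inner ℝ (deformationField T x) (H1.grad (v 0) x) * φ x)
        (volume.restrict Ω) :=
      (hT.memLp_inner_deformationField hε hΩ (H1.memLp_grad (v 0))).integrable_mul hφ2
    have e3 : ∫ x in Ω, inner ℝ (φ x • deformationField T x) (H1.grad (v 0) x)
        = ∫ x in Ω, inner ℝ (deformationField T x) (H1.grad (v 0) x) * φ x :=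
      integral_congr_ae (ae_of_all _ fun x => (real_inner_smul_left _ _ _).trans (mul_comm _ _))
    have e4 : ∫ x in Ω, (H1.fn v' x - inner ℝ (deformationField T x) (H1.grad (v 0) x)) * φ x
        = (∫ x in Ω, H1.fn v' x * φ x)
          - ∫ x in Ω, inner ℝ (deformationField T x) (H1.grad (v 0) x) * φ x :=
      (integral_congr_ae (ae_of_all _ fun x => sub_mul _ _ _)).trans (integral_sub i1 i2)
    exact (congrArg₂ (· + ·) e1 (h1.trans (congrArg Neg.neg e3))).trans
      ((sub_eq_add_neg _ _).symm.trans e4.symm)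
  rw [← e2]
  refine hd1.congr_of_eventuallyEq ?_
  filter_upwards [hat, Ioo_mem_nhds (by linarith : -ε < 0) hε,
    hT.eventually_subset_image hε hΩ hφ.hasCompactSupport hφ.tsupport_subset] with t ht htε hsub
  have hbt : IsBiLip Ω (T t) := hT.isBiLip hΩ.isOpen hΩ.isBounded htε
  refine (setIntegral_mul_eq_of_tsupport_subset hφ.tsupport_subset hsub _).trans
    ((hbt.integral_image _).trans ?_)
  rw [L2.inner_def]
  refine integral_congr_ae ?_
  filter_upwards [ht, hv t htε] with x e1 e2
  rw [e1]
  refine Eq.trans ?_ (congrArg (· * (|(fderiv ℝ (T t) x).det| * φ (T t x))) e2.symm)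
  ring

/-- The Green's function and its regular part have the same first variation, as they differ by a
function that is locally integrable and does not depend on `t`. -/
theorem hasDistribDerivAtZero_greenFunction (hT : IsDifferentiableDeformation Ω ε T) (hε : 0 < ε)
    (hΩ : IsBoundedLipschitzDomain Ω) (hd : 2 ≤ d) (y : Euc d) {u : (t : ℝ) → H1 (T t '' Ω)}
    {f : Euc d → ℝ} (h : HasDistribDerivAtZero Ω (fun t => H1.fn (u t)) f) :
    HasDistribDerivAtZero Ω (fun t => greenFunction y (u t)) f := by
  intro φ hφ
  have hφc := hφ.contDiff.continuous
  obtain ⟨C, hC⟩ := hφc.bounded_above_of_compact_support hφ.hasCompactSupport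
  refine ((h φ hφ).const_add
    (∫ x in Ω, fundamentalSolution d (x - y) * φ x)).congr_of_eventuallyEq ?_
  filter_upwards [Ioo_mem_nhds (by linarith : -ε < 0) hε,
    hT.eventually_subset_image hε hΩ hφ.hasCompactSupport hφ.tsupport_subset] with t htε hsub
  have hbt : IsBiLip Ω (T t) := hT.isBiLip hΩ.isOpen hΩ.isBounded htε
  have i1 : Integrable (fun x => fundamentalSolution d (x - y) * φ x)
      (volume.restrict (T t '' Ω)) :=
    (integrableOn_fundamentalSolution_sub hd hbt.isBounded_image y).mul_bdd
      hφc.aestronglyMeasurable (ae_of_all _ hC)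
  have i2 : Integrable (fun x => H1.fn (u t) x * φ x) (volume.restrict (T t '' Ω)) :=
    (H1.memLp_fn (u t)).integrable_mul
      (memLp_restrict_of_continuous hbt.isOpen_image hbt.isBounded_image hφc 2)
  have e := fun f => setIntegral_mul_eq_of_tsupport_subset hφ.tsupport_subset hsub f
  rw [e, e, e, ← integral_add i1 i2]
  exact integral_congr_ae (ae_of_all _ fun x => add_mul _ _ _)

/-- The derivative of harmonic functions is harmonic: its pairing with `Δ φ`, which is again a test
function, is the derivative of the pairings of `u t` with `Δ φ`, all of which are `0`. -/
theorem isWeaklyHarmonic_of_hasDistribDerivAtZero (hT : IsDifferentiableDeformation Ω ε T)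
    (hε : 0 < ε) (hΩ : IsBoundedLipschitzDomain Ω) {u : (t : ℝ) → H1 (T t '' Ω)}
    (hu : ∀ t ∈ Ioo (-ε) ε, IsWeaklyHarmonic (T t '' Ω) (H1.fn (u t)))
    {f : Euc d → ℝ} (h : HasDistribDerivAtZero Ω (fun t => H1.fn (u t)) f) :
    IsWeaklyHarmonic Ω f := by
  intro φ hφ
  have hΔ := hφ.laplacian
  refine (h _ hΔ).unique ((hasDerivAt_const (0 : ℝ) (0 : ℝ)).congr_of_eventuallyEq ?_)
  filter_upwards [Ioo_mem_nhds (by linarith : -ε < 0) hε,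
    hT.eventually_subset_image hε hΩ hφ.hasCompactSupport hφ.tsupport_subset] with t htε hsub
  rw [setIntegral_mul_eq_of_tsupport_subset hΔ.tsupport_subset
    ((tsupport_laplacian_subset φ).trans hsub)]
  exact hu t htε φ ⟨hφ.contDiff, hφ.hasCompactSupport, hsub⟩

end IsDifferentiableDeformation

end

theorem mainTheorem4 {d : ℕ} (hd : 2 ≤ d)
    (Ω : Set (Euc d)) (hΩ : IsBoundedLipschitzDomain Ω)
    (γ₀ γ₁ : Set (Euc d)) (hγ₀ : IsClosed γ₀) (hγ₁ : IsClosed γ₁)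
    (hunion : γ₀ ∪ γ₁ = frontier Ω) (hdisj : Disjoint γ₀ γ₁) (hne : γ₀.Nonempty)
    (ε : ℝ) (hε : 0 < ε) (T : ℝ → Euc d → Euc d) (hT : IsDifferentiableDeformation Ω ε T)
    (y : Euc d) (hy : y ∈ Ω) (hyt : ∀ t ∈ Ioo (-ε) ε, y ∈ T t '' Ω)
    (u : (t : ℝ) → H1 (T t '' Ω))
    (hu : ∀ t ∈ Ioo (-ε) ε, SolvesMixedProblem (T t '' Ω) (T t '' γ₀) y (u t)) :
    ∃ v : ℝ → H1 Ω,
      (∀ t ∈ Ioo (-ε) ε,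
        H1.fn (v t) =ᵐ[volume.restrict Ω] fun x => H1.fn (u t) (T t x)) ∧
      ContDiffOn ℝ 1 v (Ioo (-ε) ε) ∧
      (∃ K : ℝ≥0, LipschitzOnWith K (deformationField T) (closure Ω)) ∧
      ∃ δN : Euc d → ℝ,
        HasDistribDerivAtZero Ω (fun t => greenFunction y (u t)) δN ∧
        HasDistribDerivAtZero Ω (fun t => H1.fn (u t)) δN ∧
        IsWeaklyHarmonic Ω δN ∧
        MemLp δN 2 (volume.restrict Ω) ∧
        δN =ᵐ[volume.restrict Ω] fun x =>
          H1.fn (deriv v 0) x - inner ℝ (deformationField T x) (H1.grad (u 0) x) := by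
  have h0 : (0 : ℝ) ∈ Ioo (-ε) ε := ⟨by linarith, hε⟩
  obtain ⟨v, hv, hvC⟩ := hT.exists_contDiffOn hΩ hγ₁ hγ₀ hunion hdisj hne hyt hu
  have hd0 : HasDerivAt v (deriv v 0) 0 :=
    ((hvC.contDiffAt (Ioo_mem_nhds h0.1 h0.2)).differentiableAt (by simp)).hasDerivAt
  have hv0 : H1.fn (v 0) =ᵐ[volume.restrict Ω] H1.fn (u 0) := by
    filter_upwards [hv 0 h0, ae_restrict_mem hΩ.isOpen.measurableSet] with x hx hxΩ
    exact hx.trans (congrArg (H1.fn (u 0)) (hT.zero x (subset_closure hxΩ)))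
  obtain ⟨hmem, hgrad⟩ :=
    H1.mem_withTrace_of_ae_eq hΩ.isOpen hT.image_zero (hu 0 h0).dirichlet hv0
  have hδ := hT.hasDistribDerivAtZero_of_hasDerivAt hε hΩ hv hd0 hmem
  refine ⟨v, hv, hvC, hT.lipschitzOnWith_deformationField hε hΩ, _,
    hT.hasDistribDerivAtZero_greenFunction hε hΩ hd y hδ, hδ,
    hT.isWeaklyHarmonic_of_hasDistribDerivAtZero hε hΩ (fun t ht => (hu t ht).harmonic) hδ,
    (H1.memLp_fn (deriv v 0)).sub
      (hT.memLp_inner_deformationField hε hΩ (H1.memLp_grad (v 0))), ?_⟩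
  exact hgrad.mono fun x hx =>
    congrArg (fun G => H1.fn (deriv v 0) x - inner ℝ (deformationField T x) G) hx
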